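/- Work over $\mathbb{C}$ and write $\mathbb{P}^2=\mathbb{P}^2_{\mathbb{C}}$. For labeled points $\mathcal{X}=(x_1,\dots,x_5)$ and $\mathcal{Y}=(y_1,\dots,y_5)$ of $\mathbb{P}^2$, the camera centers variety $E_5=E_{\mathcal{X},\mathcal{Y}}\subset\mathbb{P}^2\times\mathbb{P}^2$ is the set of all pairs $(a,b)$ for which there is a nonzero $3\times 3$ matrix $F$ with $$Fa=0,\qquad F^{\top}b=0,\qquad y_i^{\top}Fx_i=0\quad(i=1,\dots,5).$$ Let $\pi_x(a,b)=a$ and $\pi_y(a,b)=b$. A rational map $\mathbb{P}^2\dashrightarrow\mathbb{P}^2$ has degree $n$ if it is given by three forms of degree $n$ without a common factor; a Cremona transformation is a birational map $\mathbb{P}^2\dashrightarrow\mathbb{P}^2$. For $i+j=\dim E_5$, the multidegree $d_{(i,j)}(E_5)$ is the number of points $(a,b)\in E_5$ such that $a$ lies on $i$ generic lines and $b$ lies on $j$ generic lines of $\mathbb{P}^2$. "Generic" means: on a dense Zariski-open subset of the parameter space. **Theorem.** For generic $(\mathcal{X},\mathcal{Y})\in(\mathbb{P}^2)^5\times(\mathbb{P}^2)^5$,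 the set $E_5$ is an irreducible Zariski-closed surface (of dimension $2$) in $\mathbb{P}^2\times\mathbb{P}^2$. Furthermore: 1. Both projections $\pi_x,\pi_y:E_5\to\mathbb{P}^2$ are surjective and have rational inverses $\pi_x^{-1},\pi_y^{-1}:\mathbb{P}^2\dashrightarrow E_5$. The composite $\pi_y\circ\pi_x^{-1}:\mathbb{P}^2\dashrightarrow\mathbb{P}^2$, $a\mapsto b$, is a Cremona transformation of degree $5$. Explicitly, choose projective coordinates on the two planes in which $x_1,\dots,x_4$, and likewise $y_1,\dots,y_4$, are $[1:0:0],[0:1:0],[0:0:1],[1:1:1]$, and let $x_5=[\xi_1:\xi_2:\xi_3]$ and $y_5=[\eta_1:\eta_2:\eta_3]$ in these coordinates. Then the map is $$[a_1:a_2:a_3]\longmapsto[a_1q_2q_3:a_2q_1q_3:a_3q_1q_2],$$ where $$\begin{aligned} q_1&=\eta_2(a_1-a_2)(a_3\xi_1-a_1\xi_3)-\eta_3(a_3-a_1)(a_1\xi_2-a_2\xi_1),\\ q_2&=\eta_3(a_2-a_3)(a_1\xi_2-a_2\xi_1)-\eta_1(a_1-a_2)(a_2\xi_3-a_3\xi_2),\\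 q_3&=\eta_1(a_3-a_1)(a_2\xi_3-a_3\xi_2)-\eta_2(a_2-a_3)(a_3\xi_1-a_1\xi_3), \end{aligned}$$ and these three quintic forms have no common factor. 2. The multidegrees are $d_{(2,0)}(E_5)=d_{(0,2)}(E_5)=1$ and $d_{(1,1)}(E_5)=5$. -/

import Mathlib

open MvPolynomial

/-- The complex projective plane. -/
abbrev P2 : Type := Projectivization ℂ (Fin 3 → ℂ)

/-- The vector `v` is a vector of homogeneous coordinates of the point `p`. -/
def Represents (p : P2) (v : Fin 3 → ℂ) : Prop :=
  ∃ h : v ≠ 0, Projectivization.mk ℂ v h = p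

/-- The product `(ℙ²)^κ` of complex projective planes, one factor for each `k : κ`. -/
def MultiP2 (κ : Type) : Type := κ → P2

/-- `f`, a polynomial in one triple of variables for each factor, is homogeneous of degree `δ k`
in the `k`-th triple of variables, for every `k`. -/
def IsMultihomogeneous {κ : Type} (f : MvPolynomial (κ × Fin 3) ℂ) (δ : κ → ℕ) : Prop :=
  ∀ m ∈ f.support, ∀ k, ∑ i, m (k, i) = δ k

/-- Evaluation at the chosen homogeneous coordinates of the points `p k`. For multihomogeneous `f`
the vanishing of the result does not depend on the choice. -/
noncomputable def evalAt {κ : Type} (f : MvPolynomial (κ × Fin 3) ℂ) (p : MultiP2 κ) : ℂ :=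
  eval (fun ki : κ × Fin 3 => (p ki.1).rep ki.2) f

/-- The Zariski topology: the non-vanishing loci of multihomogeneous polynomials form a basis. -/
instance zariskiTopology (κ : Type) : TopologicalSpace (MultiP2 κ) :=
  TopologicalSpace.generateFrom
    {U | ∃ f δ, IsMultihomogeneous f δ ∧ U = {p : MultiP2 κ | evalAt f p ≠ 0}}

/-- `P` holds for generic points of `(ℙ²)^κ`: on a dense Zariski-open subset. -/
def Generically {κ : Type} (P : MultiP2 κ → Prop) : Prop :=
  ∃ U : Set (MultiP2 κ), IsOpen U ∧ Dense U ∧ ∀ p ∈ U, P p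

/-- The camera centers variety of `x` and `y`: all pairs `(a, b) = (e 0, e 1)` for which there is a
nonzero matrix `F` (up to scale, a point of `ℙ⁸`) with `F a = 0`, `Fᵀ b = 0` and `yᵢᵀ F xᵢ = 0`. -/
def cameraCentersVariety {n : ℕ} (x y : Fin n → P2) : Set (MultiP2 (Fin 2)) :=
  {e | ∃ F : Matrix (Fin 3) (Fin 3) ℂ, F ≠ 0 ∧
    F.mulVec (e 0).rep = 0 ∧ F.transpose.mulVec (e 1).rep = 0 ∧
    ∀ i, dotProduct (y i).rep (F.mulVec (x i).rep) = 0}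

/-- A rational map `ℙ² ⇢ ℙ²`, given by its reduced representative: three forms of the same degree
without a common factor (in particular not all zero). -/
structure PlaneRationalMap where
  degree : ℕ
  form : Fin 3 → MvPolynomial (Fin 3) ℂ
  homogeneous : ∀ i, (form i).IsHomogeneous degree
  reduced : ∀ q, (∀ i, q ∣ form i) → IsUnit q

namespace PlaneRationalMap

/-- The vector of values of the three forms. -/
noncomputable def evalVec (φ : PlaneRationalMap) (v : Fin 3 → ℂ) : Fin 3 → ℂ :=
  fun i => eval v (φ.form i)

/-- The domain of definition: the complement of the base points. -/
def domain (φ : PlaneRationalMap) : Set P2 := {p | φ.evalVec p.rep ≠ 0}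

/-- `φ` is defined at `p` and takes the value `q` there. -/
def Sends (φ : PlaneRationalMap) (p q : P2) : Prop := Represents q (φ.evalVec p.rep)

/-- `ψ ∘ φ` is the identity as a rational map: the composite is defined somewhere, and it is the
identity wherever it is defined. -/
def IsLeftInverse (ψ φ : PlaneRationalMap) : Prop :=
  (∃ p q, φ.Sends p q ∧ q ∈ ψ.domain) ∧
    ∀ p q, φ.Sends p q → q ∈ ψ.domain → ψ.Sends q p

/-- A Cremona transformation of the plane is a birational self-map of `ℙ²`. -/
def IsCremona (φ : PlaneRationalMap) : Prop :=
  ∃ ψ : PlaneRationalMap, ψ.IsLeftInverse φ ∧ φ.IsLeftInverse ψ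

end PlaneRationalMap

/-- The rational map `σ = (σ 0, σ 1) : ℙ² ⇢ ℙ² × ℙ²` takes values in `E` and is a rational inverse
of the `k`-th coordinate projection `π : E → ℙ²`: `π ∘ σ` is the identity where `σ` is defined, and
`σ ∘ π` is defined on a dense (open) subset of `E` and is the identity there. -/
def IsRationalInverse (E : Set (MultiP2 (Fin 2))) (k : Fin 2) (σ : Fin 2 → PlaneRationalMap) :
    Prop :=
  (∀ (p : P2) (e : MultiP2 (Fin 2)), (∀ j, (σ j).Sends p (e j)) → e ∈ E ∧ e k = p) ∧
  E ⊆ closure {e ∈ E | ∀ j, e k ∈ (σ j).domain} ∧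
  ∀ e ∈ E, (∀ j, e k ∈ (σ j).domain) → ∀ j, (σ j).Sends (e k) (e j)

/-- The point `p` lies on the line whose dual coordinates are `l`. -/
def OnLine (l p : P2) : Prop := dotProduct l.rep p.rep = 0

/-- The multidegree `d_(i,j)` of `E` is `d`: `E` meets `i` generic lines in the first plane and `j`
generic lines in the second one in exactly `d` points. (To be used for `i + j = dim E`.) -/
def HasMultidegree (E : Set (MultiP2 (Fin 2))) (i j d : ℕ) : Prop :=
  Generically fun l : MultiP2 (Fin i ⊕ Fin j) =>
    {e ∈ E | (∀ s, OnLine (l (Sum.inl s)) (e 0)) ∧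
      ∀ t, OnLine (l (Sum.inr t)) (e 1)}.encard = d

/-- The points `e₁, e₂, e₃` and `e₄ = e₁ + e₂ + e₃` of the standard projective frame. -/
def frame : Fin 4 → Fin 3 → ℂ :=
  ![![1, 0, 0], ![0, 1, 0], ![0, 0, 1], ![1, 1, 1]]

/-- In the projective coordinates given by the invertible matrix `G`, the first four points of `x`
are the standard frame, and `ξ` is a coordinate vector of the fifth point. -/
def StandardPosition (x : Fin 5 → P2) (G : Matrix (Fin 3) (Fin 3) ℂ) (ξ : Fin 3 → ℂ) : Prop :=
  G.det ≠ 0 ∧ (∀ i : Fin 4, Represents (x i.castSucc) (G.mulVec (frame i))) ∧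
    Represents (x 4) (G.mulVec ξ)

/-- The explicit quintic forms `(a₁ q₂ q₃, a₂ q₁ q₃, a₃ q₁ q₂)`, with quadratic forms `qᵢ` in `a`
that depend on the fifth points `ξ` and `η`. -/
def quinticMap (ξ η a : Fin 3 → ℂ) : Fin 3 → ℂ :=
  let q₁ := η 1 * (a 0 - a 1) * (a 2 * ξ 0 - a 0 * ξ 2) -
    η 2 * (a 2 - a 0) * (a 0 * ξ 1 - a 1 * ξ 0)
  let q₂ := η 2 * (a 1 - a 2) * (a 0 * ξ 1 - a 1 * ξ 0) -
    η 0 * (a 0 - a 1) * (a 1 * ξ 2 - a 2 * ξ 1)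
  let q₃ := η 0 * (a 2 - a 0) * (a 1 * ξ 2 - a 2 * ξ 1) -
    η 1 * (a 1 - a 2) * (a 2 * ξ 0 - a 0 * ξ 2)
  ![a 0 * q₂ * q₃, a 1 * q₁ * q₃, a 2 * q₁ * q₂]

/-! Take coordinates in which the first four points of each plane are the standard frame. The
incidences at the three vertices say that `F` has zero diagonal. Together with `F a = 0` this makes
the i-th row orthogonal to a and to eᵢ, hence equal to pᵢ (eᵢ × a) as long as a is not a vertex
(`IsEpipolar.exists_rowMatrix`). The two remaining incidences are linear in p, with coefficient
vectors a × 1 and η * (a × ξ), where 1 = (1,1,1) and * is the entrywise product. Their cross product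
is q, so p is a multiple of q wherever q ≠ 0 (`quadrics_eq_cross`, `exists_eq_smul_quadrics`).
Finally `Fᵀ b = 0` says that the vector (pᵢ bᵢ) is parallel to a; clearing denominators in bᵢ = aᵢ /
qᵢ gives the quintics. Transposing `F` exchanges the planes, so the inverse is the same formula with
ξ and η exchanged.

For fifth points in general position the quintics vanish together only at six points
(`exists_eq_smul_basePoints`). They have no common factor, since that would vanish on a curve, which
has infinitely many points. Over a base point the matrices contain a pencil, whose left kernels
sweep out a conic in the fibre (`exists_isEpipolar_not_smul_of_quintics_eq_zero`, `exists_conic`).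

`IsBirationalCorrespondence` records these facts, and the geometry of `E` follows from them. Each
graph is irreducible, being parametrized by polynomials. A point over a base point of the first map
lies on a curve of `E` that has only finitely many points over base points of the second map, so it
is in the closure of the second graph. The two graphs share a nonempty open part, hence `E` is the
closure of either (`eq_closure_graphPart`). Each graph is homeomorphic to an open part of the plane,
which gives dimension 2.

Two generic lines in one plane meet in one point outside the base locus, whence the multidegrees 1.
For the mixed multidegree, restricting m · φ to a line gives a polynomial of degree at most 5, and
its roots are the points to be counted when the line avoids the base points (`encard_lineSection`).
Having five distinct roots is an open polynomial condition, so a single line suffices as witness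
(`isTransversalLine_example`). In the same way all genericity hypotheses become the nonvanishing of
one polynomial in the coordinates of the ten points, and nonempty open sets are dense because
products of planes are irreducible (`IsPolyFun.generically`). -/

section Representatives

/-! ### Homogeneous coordinates of points and of tuples of points -/

theorem represents_rep (p : P2) : Represents p p.rep :=
  ⟨p.rep_nonzero, p.mk_rep⟩

theorem Represents.ne_zero {p : P2} {v : Fin 3 → ℂ} (h : Represents p v) : v ≠ 0 := h.1

theorem represents_mk {v : Fin 3 → ℂ} (h : v ≠ 0) : Represents (Projectivization.mk ℂ v h) v :=
  ⟨h, rfl⟩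

theorem Represents.smul {p : P2} {v : Fin 3 → ℂ} (h : Represents p v) {t : ℂ} (ht : t ≠ 0) :
    Represents p (t • v) := by
  obtain ⟨hv, rfl⟩ := h
  refine ⟨smul_ne_zero ht hv, ?_⟩
  rw [Projectivization.mk_eq_mk_iff']
  exact ⟨t, rfl⟩

theorem Represents.exists_smul {p : P2} {v w : Fin 3 → ℂ} (hv : Represents p v)
    (hw : Represents p w) : ∃ t : ℂ, t ≠ 0 ∧ w = t • v := by
  obtain ⟨h1, rfl⟩ := hv
  obtain ⟨h2, h3⟩ := hw
  rw [Projectivization.mk_eq_mk_iff'] at h3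
  obtain ⟨t, ht⟩ := h3
  refine ⟨t, ?_, ht.symm⟩
  rintro rfl
  simp at ht
  exact h2 ht.symm

theorem Represents.unique {p q : P2} {v : Fin 3 → ℂ} (hp : Represents p v)
    (hq : Represents q v) : p = q := by
  obtain ⟨_, rfl⟩ := hp
  obtain ⟨_, rfl⟩ := hq
  rfl

theorem Represents.congr_smul {p : P2} {v w : Fin 3 → ℂ} {t : ℂ} (ht : t ≠ 0)
    (h : v = t • w) : Represents p v ↔ Represents p w := by
  subst h
  refine ⟨fun h => ?_, fun h => h.smul ht⟩
  have := h.smul (inv_ne_zero ht)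
  rwa [smul_smul, inv_mul_cancel₀ ht, one_smul] at this

/-- `v k` is a vector of homogeneous coordinates of `p k`, for every `k`. -/
def RepresentsTuple {κ : Type} (p : MultiP2 κ) (v : κ → Fin 3 → ℂ) : Prop :=
  ∀ k, Represents (p k) (v k)

theorem representsTuple_rep {κ : Type} (p : MultiP2 κ) :
    RepresentsTuple p (fun k => (p k).rep) := fun k => represents_rep (p k)

theorem exists_representsTuple {κ : Type} {v : κ → Fin 3 → ℂ} (h : ∀ k, v k ≠ 0) :
    ∃ p : MultiP2 κ, RepresentsTuple p v :=
  ⟨fun k => Projectivization.mk ℂ (v k) (h k), fun k => represents_mk (h k)⟩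

theorem RepresentsTuple.exists_smul {κ : Type} {p : MultiP2 κ} {v w : κ → Fin 3 → ℂ}
    (hv : RepresentsTuple p v) (hw : RepresentsTuple p w) :
    ∃ t : κ → ℂ, (∀ k, t k ≠ 0) ∧ w = fun k => t k • v k := by
  choose t ht h using fun k => (hv k).exists_smul (hw k)
  exact ⟨t, ht, funext h⟩

theorem RepresentsTuple.smul {κ : Type} {p : MultiP2 κ} {v : κ → Fin 3 → ℂ}
    (hv : RepresentsTuple p v) {t : κ → ℂ} (ht : ∀ k, t k ≠ 0) :
    RepresentsTuple p (fun k => t k • v k) := fun k => (hv k).smul (ht k)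

theorem RepresentsTuple.unique {κ : Type} {p q : MultiP2 κ} {v : κ → Fin 3 → ℂ}
    (hp : RepresentsTuple p v) (hq : RepresentsTuple q v) : p = q :=
  funext fun k => (hp k).unique (hq k)

end Representatives

/-! ### Polynomial functions of a tuple of vectors -/

section PolynomialFunctions

theorem eval_aeval_eq {ι σ : Type*} (f : MvPolynomial ι ℂ) (a : ι → MvPolynomial σ ℂ) (v : σ → ℂ) :
    eval v (aeval a f) = eval (fun i => eval v (a i)) f := by
  induction f using MvPolynomial.induction_on with
  | C c => simp
  | add p q hp hq => rw [map_add, map_add, map_add, hp, hq]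
  | mul_X p i hp => rw [map_mul, map_mul, map_mul, hp, aeval_X, eval_X]

variable {κ : Type}

/-- `g` is a polynomial function of a tuple of vectors. -/
def IsPolyFun (g : (κ → Fin 3 → ℂ) → ℂ) : Prop :=
  ∃ f : MvPolynomial (κ × Fin 3) ℂ, ∀ v, eval (Function.uncurry v) f = g v

namespace IsPolyFun

variable {g h : (κ → Fin 3 → ℂ) → ℂ}

theorem const (c : ℂ) : IsPolyFun (fun _ : κ → Fin 3 → ℂ => c) := ⟨C c, by simp⟩

theorem coord (k : κ) (i : Fin 3) : IsPolyFun (fun v => v k i) := ⟨X (k, i), by simp⟩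

theorem add (hg : IsPolyFun g) (hh : IsPolyFun h) : IsPolyFun (fun v => g v + h v) := by
  obtain ⟨a, ha⟩ := hg
  obtain ⟨b, hb⟩ := hh
  exact ⟨a + b, by simp [ha, hb]⟩

theorem sub (hg : IsPolyFun g) (hh : IsPolyFun h) : IsPolyFun (fun v => g v - h v) := by
  obtain ⟨a, ha⟩ := hg
  obtain ⟨b, hb⟩ := hh
  exact ⟨a - b, by simp [ha, hb]⟩

theorem mul (hg : IsPolyFun g) (hh : IsPolyFun h) : IsPolyFun (fun v => g v * h v) := by
  obtain ⟨a, ha⟩ := hg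
  obtain ⟨b, hb⟩ := hh
  exact ⟨a * b, by simp [ha, hb]⟩

theorem sum {ι : Type*} (s : Finset ι) {g : ι → (κ → Fin 3 → ℂ) → ℂ}
    (hg : ∀ i ∈ s, IsPolyFun (g i)) : IsPolyFun (fun v => ∑ i ∈ s, g i v) := by
  choose! f hf using hg
  exact ⟨∑ i ∈ s, f i, fun v => by simpa using Finset.sum_congr rfl fun i hi => hf i hi v⟩

theorem prod {ι : Type*} (s : Finset ι) {g : ι → (κ → Fin 3 → ℂ) → ℂ}
    (hg : ∀ i ∈ s, IsPolyFun (g i)) : IsPolyFun (fun v => ∏ i ∈ s, g i v) := by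
  choose! f hf using hg
  exact ⟨∏ i ∈ s, f i, fun v => by
    simpa [map_prod] using Finset.prod_congr rfl fun i hi => hf i hi v⟩

theorem det {n : Type*} [Fintype n] [DecidableEq n] {M : (κ → Fin 3 → ℂ) → Matrix n n ℂ}
    (hM : ∀ i j, IsPolyFun (fun v => M v i j)) : IsPolyFun (fun v => (M v).det) := by
  simp only [Matrix.det_apply']
  exact sum _ fun σ _ => (const _).mul (prod _ fun i _ => hM _ _)

theorem eval {ι : Type*} (f : MvPolynomial ι ℂ) {φ : (κ → Fin 3 → ℂ) → ι → ℂ}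
    (hφ : ∀ i, IsPolyFun (fun v => φ v i)) : IsPolyFun (fun v => MvPolynomial.eval (φ v) f) := by
  choose a ha using hφ
  refine ⟨aeval a f, fun v => ?_⟩
  rw [eval_aeval_eq]
  congr 2
  funext i
  exact ha i v

/-- The polynomial ring is a domain and ℂ is infinite, so a product of nonzero polynomials is
nonzero somewhere. This merges separate witnesses of open conditions into one. -/
theorem exists_ne_zero_and (hg : IsPolyFun g) (hh : IsPolyFun h) (h1 : ∃ v, g v ≠ 0)
    (h2 : ∃ v, h v ≠ 0) : ∃ v, g v ≠ 0 ∧ h v ≠ 0 := by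
  obtain ⟨a, ha⟩ := hg
  obtain ⟨b, hb⟩ := hh
  by_contra! hc
  have hab : a * b = 0 := by
    refine MvPolynomial.funext fun w => ?_
    have hw : w = Function.uncurry (Function.curry w) := by simp
    rw [hw, map_mul, ha, hb, map_zero]
    by_cases hgw : g (Function.curry w) = 0
    · simp [hgw]
    · simp [hc _ hgw]
  obtain ⟨v, hv⟩ := h1
  obtain ⟨w, hw⟩ := h2
  rcases mul_eq_zero.1 hab with h0 | h0
  · exact hv (by rw [← ha, h0, map_zero])
  · exact hw (by rw [← hb, h0, map_zero])

theorem exists_ne_zero_forall {ι : Type*} (s : Finset ι) {g : ι → (κ → Fin 3 → ℂ) → ℂ}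
    (hg : ∀ i ∈ s, IsPolyFun (g i)) (h : ∀ i ∈ s, ∃ v, g i v ≠ 0) :
    ∃ v, ∀ i ∈ s, g i v ≠ 0 := by
  classical
  induction s using Finset.induction_on with
  | empty => exact ⟨0, by simp⟩
  | insert a s ha ih =>
    obtain ⟨v, hv⟩ := ih (fun i hi => hg i (Finset.mem_insert_of_mem hi))
      (fun i hi => h i (Finset.mem_insert_of_mem hi))
    obtain ⟨w, h1, h2⟩ := (hg a (Finset.mem_insert_self _ _)).exists_ne_zero_and
      (prod s fun i hi => hg i (Finset.mem_insert_of_mem hi)) (h a (Finset.mem_insert_self _ _))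
      ⟨v, Finset.prod_ne_zero_iff.2 hv⟩
    refine ⟨w, fun i hi => ?_⟩
    rcases Finset.mem_insert.1 hi with rfl | hi
    · exact h1
    · exact Finset.prod_ne_zero_iff.1 h2 i hi

end IsPolyFun

end PolynomialFunctions

/-! ### The Zariski topology on products of planes -/

section Zariski

variable {κ : Type}

theorem IsMultihomogeneous.eval_smul [Fintype κ] {f : MvPolynomial (κ × Fin 3) ℂ} {δ : κ → ℕ}
    (hf : IsMultihomogeneous f δ) (v : κ → Fin 3 → ℂ) (t : κ → ℂ) :
    eval (Function.uncurry fun k => t k • v k) f =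
      (∏ k, t k ^ δ k) * eval (Function.uncurry v) f := by
  rw [eval_eq', eval_eq', Finset.mul_sum]
  refine Finset.sum_congr rfl fun m hm => ?_
  rw [mul_left_comm]
  congr 1
  have h1 : ∏ k, t k ^ δ k = ∏ ki : κ × Fin 3, t ki.1 ^ m ki := by
    rw [Fintype.prod_prod_type]
    refine Finset.prod_congr rfl fun k _ => ?_
    rw [← hf m hm k]
    exact (Finset.prod_pow_eq_pow_sum _ _ _).symm
  rw [h1, ← Finset.prod_mul_distrib]
  refine Finset.prod_congr rfl fun ki _ => ?_
  simp [Function.uncurry, mul_pow]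

theorem IsMultihomogeneous.evalAt_ne_zero_iff [Fintype κ] {f : MvPolynomial (κ × Fin 3) ℂ}
    {δ : κ → ℕ} (hf : IsMultihomogeneous f δ) {p : MultiP2 κ} {v : κ → Fin 3 → ℂ}
    (hv : RepresentsTuple p v) : evalAt f p ≠ 0 ↔ eval (Function.uncurry v) f ≠ 0 := by
  obtain ⟨t, ht, rfl⟩ := (representsTuple_rep p).exists_smul hv
  rw [hf.eval_smul, mul_ne_zero_iff, and_iff_right]
  · rfl
  · exact Finset.prod_ne_zero_iff.2 fun k _ => pow_ne_zero _ (ht k)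

theorem IsMultihomogeneous.mul {f g : MvPolynomial (κ × Fin 3) ℂ} {δ ε : κ → ℕ}
    (hf : IsMultihomogeneous f δ) (hg : IsMultihomogeneous g ε) :
    IsMultihomogeneous (f * g) (δ + ε) := by
  classical
  intro m hm k
  obtain ⟨a, ha, b, hb, rfl⟩ := Finset.mem_add.1 (support_mul f g hm)
  simp [Finset.sum_add_distrib, hf a ha k, hg b hb k]

theorem isTopologicalBasis_zariski : TopologicalSpace.IsTopologicalBasis
    {U | ∃ f δ, IsMultihomogeneous f δ ∧ U = {p : MultiP2 κ | evalAt f p ≠ 0}} where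
  exists_subset_inter := by
    rintro _ ⟨f, δ, hf, rfl⟩ _ ⟨g, ε, hg, rfl⟩ x ⟨hx1, hx2⟩
    refine ⟨_, ⟨f * g, δ + ε, hf.mul hg, rfl⟩, ?_, ?_⟩
    · simp only [Set.mem_ofPred_eq, evalAt, map_mul] at *
      exact mul_ne_zero hx1 hx2
    · intro p hp
      simp only [Set.mem_ofPred_eq, evalAt, map_mul] at *
      exact mul_ne_zero_iff.1 hp
  sUnion_eq := by
    classical
    refine Set.eq_univ_of_forall fun p => ?_
    refine ⟨_, ⟨1, 0, ?_, rfl⟩, ?_⟩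
    · intro m hm k
      rw [← C_1, mem_support_iff, coeff_C] at hm
      obtain rfl : m = 0 := by
        by_contra h
        exact hm (if_neg (Ne.symm h))
      simp
    · simp [evalAt]
  eq_generateFrom := rfl

/-- The polynomial `t ↦ f (t • v)` on the torus of scalings. -/
noncomputable def scalingPoly (f : MvPolynomial (κ × Fin 3) ℂ) (v : κ → Fin 3 → ℂ) :
    MvPolynomial κ ℂ :=
  aeval (fun ki : κ × Fin 3 => C (v ki.1 ki.2) * X ki.1) f

theorem eval_scalingPoly (f : MvPolynomial (κ × Fin 3) ℂ) (v : κ → Fin 3 → ℂ) (t : κ → ℂ) :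
    eval t (scalingPoly f v) = eval (Function.uncurry fun k => t k • v k) f := by
  rw [scalingPoly, eval_aeval_eq]
  congr 2
  funext ki
  simp [Function.uncurry, mul_comm]

/-- The multihomogeneous component of `f` of multidegree `δ`. -/
noncomputable def multiComponent (f : MvPolynomial (κ × Fin 3) ℂ) (δ : κ → ℕ) :
    MvPolynomial (κ × Fin 3) ℂ :=
  open Classical in
  ∑ m ∈ f.support with (∀ k, ∑ i, m (k, i) = δ k), monomial m (coeff m f)

theorem isMultihomogeneous_multiComponent (f : MvPolynomial (κ × Fin 3) ℂ) (δ : κ → ℕ) :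
    IsMultihomogeneous (multiComponent f δ) δ := by
  classical
  intro m hm
  have := support_sum hm
  simp only [Finset.mem_biUnion, Finset.mem_filter] at this
  obtain ⟨a, ⟨_, h2⟩, h3⟩ := this
  have := support_monomial_subset h3
  rw [Finset.mem_singleton] at this
  exact this ▸ h2

/-- A monomial of multidegree δ picks up the factor t^δ under scaling, so the coefficients in t
separate the multihomogeneous components. -/
theorem coeff_scalingPoly [Fintype κ] (f : MvPolynomial (κ × Fin 3) ℂ) (v : κ → Fin 3 → ℂ)
    (δ : κ →₀ ℕ) :
    coeff δ (scalingPoly f v) = eval (Function.uncurry v) (multiComponent f δ) := by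
  classical
  rw [scalingPoly, aeval_def, eval₂_eq', coeff_sum, multiComponent, map_sum, Finset.sum_filter]
  refine Finset.sum_congr rfl fun m _ => ?_
  have h1 : ∏ ki : κ × Fin 3, (C (v ki.1 ki.2) * X ki.1 : MvPolynomial κ ℂ) ^ m ki =
      monomial (Finsupp.equivFunOnFinite.symm fun k => ∑ i, m (k, i))
        (∏ ki : κ × Fin 3, v ki.1 ki.2 ^ m ki) := by
    simp only [mul_pow, Finset.prod_mul_distrib]
    rw [monomial_eq, map_prod]
    congr 1
    · simp
    · rw [Fintype.prod_prod_type, Finsupp.prod_fintype _ _ (by simp)]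
      refine Finset.prod_congr rfl fun k _ => ?_
      simp [Finset.prod_pow_eq_pow_sum]
  rw [h1, algebraMap_eq, coeff_C_mul, coeff_monomial, eval_monomial]
  have h2 : (Finsupp.equivFunOnFinite.symm fun k => ∑ i, m (k, i)) = δ ↔
      ∀ k, ∑ i, m (k, i) = δ k := by
    rw [DFunLike.ext_iff]
    simp
  simp only [h2]
  split_ifs
  · rw [Finsupp.prod_fintype _ _ (by simp)]
    rfl
  · simp

theorem exists_smul_eval_ne_zero [Fintype κ] {f : MvPolynomial (κ × Fin 3) ℂ}
    {v : κ → Fin 3 → ℂ} (h : scalingPoly f v ≠ 0) :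
    ∃ t : κ → ℂ, (∀ k, t k ≠ 0) ∧ eval (Function.uncurry fun k => t k • v k) f ≠ 0 := by
  -- The extra factor of all variables keeps the witness t off the coordinate hyperplanes.
  have h0 : scalingPoly f v * ∏ k, X k ≠ 0 :=
    mul_ne_zero h (Finset.prod_ne_zero_iff.2 fun k _ => X_ne_zero k)
  obtain ⟨t, ht⟩ : ∃ t, eval t (scalingPoly f v * ∏ k, X k) ≠ 0 := by
    by_contra! hc
    exact h0 (MvPolynomial.funext fun t => by rw [hc, map_zero])
  rw [map_mul, map_prod, eval_scalingPoly] at ht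
  refine ⟨t, fun k => ?_, left_ne_zero_of_mul ht⟩
  simpa using Finset.prod_ne_zero_iff.1 (right_ne_zero_of_mul ht) k (Finset.mem_univ k)

/-- `g` need not be multihomogeneous. If it is nonzero at some coordinates of p, then one of its
multihomogeneous components is nonzero at p; wherever that component is nonzero, some rescaling of
the coordinates makes `g` nonzero. So the set is a union of basic open sets. -/
theorem IsPolyFun.isOpen [Fintype κ] {g : (κ → Fin 3 → ℂ) → ℂ} (hg : IsPolyFun g) :
    IsOpen {p : MultiP2 κ | ∃ v, RepresentsTuple p v ∧ g v ≠ 0} := by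
  obtain ⟨f, hf⟩ := hg
  rw [isTopologicalBasis_zariski.isOpen_iff]
  rintro p ⟨v, hv, hgv⟩
  have hs : scalingPoly f v ≠ 0 := by
    intro h
    apply hgv
    rw [← hf]
    have := eval_scalingPoly f v 1
    rw [h, map_zero] at this
    simpa using this.symm
  obtain ⟨δ, hδ⟩ := ne_zero_iff.1 hs
  have hm := isMultihomogeneous_multiComponent f δ
  rw [coeff_scalingPoly] at hδ
  refine ⟨_, ⟨_, _, hm, rfl⟩, (hm.evalAt_ne_zero_iff hv).2 hδ, ?_⟩
  intro q hq
  have h1 : scalingPoly f (fun k => (q k).rep) ≠ 0 := by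
    rw [ne_zero_iff]
    exact ⟨δ, by rw [coeff_scalingPoly]; exact hq⟩
  obtain ⟨t, ht, h2⟩ := exists_smul_eval_ne_zero h1
  exact ⟨_, (representsTuple_rep q).smul ht, by rwa [← hf]⟩

theorem IsPolyFun.isClosed [Fintype κ] {g : (κ → Fin 3 → ℂ) → ℂ} (hg : IsPolyFun g) :
    IsClosed {p : MultiP2 κ | ∀ v, RepresentsTuple p v → g v = 0} := by
  rw [← isOpen_compl_iff]
  convert hg.isOpen using 1
  ext p
  simp

/-- The set of tuples with a polynomial parametrization is irreducible. -/
theorem isIrreducible_parametrized [Fintype κ] {ι : Type}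
    {Φ : (ι → Fin 3 → ℂ) → κ → Fin 3 → ℂ} (hΦ : ∀ k i, IsPolyFun (fun w => Φ w k i))
    (hne : ∃ w, ∀ k, Φ w k ≠ 0) :
    IsIrreducible {p : MultiP2 κ | ∃ w, RepresentsTuple p (Φ w)} := by
  constructor
  · obtain ⟨w, hw⟩ := hne
    obtain ⟨p, hp⟩ := exists_representsTuple hw
    exact ⟨p, w, hp⟩
  · rintro U V hU hV ⟨p, ⟨w1, hp⟩, hpU⟩ ⟨q, ⟨w2, hq⟩, hqV⟩
    obtain ⟨_, ⟨f, δ, hf, rfl⟩, hpf, hfU⟩ := isTopologicalBasis_zariski.isOpen_iff.1 hU p hpU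
    obtain ⟨_, ⟨g, ε, hg, rfl⟩, hqg, hgV⟩ := isTopologicalBasis_zariski.isOpen_iff.1 hV q hqV
    have hw1 := (hf.evalAt_ne_zero_iff hp).1 hpf
    have hw2 := (hg.evalAt_ne_zero_iff hq).1 hqg
    have hcoord : ∀ k, ∃ i, Φ w1 k i ≠ 0 := fun k => by
      by_contra! h
      exact (hp k).ne_zero (funext h)
    choose i hi using hcoord
    have hfp : IsPolyFun fun w => eval (Function.uncurry (Φ w)) f :=
      IsPolyFun.eval f fun ki => hΦ ki.1 ki.2
    have hgp : IsPolyFun fun w => eval (Function.uncurry (Φ w)) g :=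
      IsPolyFun.eval g fun ki => hΦ ki.1 ki.2
    -- Both open sets are pulled back to parameters; this product, nonzero at `w1`, guarantees that
    -- the common parameter found below defines a point.
    have hprod : IsPolyFun fun w => ∏ k, Φ w k (i k) := IsPolyFun.prod _ fun k _ => hΦ k (i k)
    have h1 := hfp.exists_ne_zero_and hprod ⟨w1, hw1⟩
      ⟨w1, Finset.prod_ne_zero_iff.2 fun k _ => hi k⟩
    obtain ⟨w, ⟨h3, h4⟩⟩ := (hfp.mul hprod).exists_ne_zero_and hgp
      (by simpa [mul_ne_zero_iff] using h1) ⟨w2, hw2⟩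
    have h5 : ∀ k, Φ w k ≠ 0 := fun k h => by
      refine Finset.prod_ne_zero_iff.1 (right_ne_zero_of_mul h3) k (Finset.mem_univ k) ?_
      rw [h]; rfl
    obtain ⟨r, hr⟩ := exists_representsTuple h5
    exact ⟨r, ⟨w, hr⟩, hfU ((hf.evalAt_ne_zero_iff hr).2 (left_ne_zero_of_mul h3)),
      hgV ((hg.evalAt_ne_zero_iff hr).2 h4)⟩

instance irreducibleSpace_multiP2 [Fintype κ] : IrreducibleSpace (MultiP2 κ) := by
  have h := isIrreducible_parametrized (Φ := fun w : κ → Fin 3 → ℂ => w)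
    (fun k i => IsPolyFun.coord k i) ⟨fun _ _ => 1, fun _ h => one_ne_zero (congrFun h 0)⟩
  have hu : {p : MultiP2 κ | ∃ w, RepresentsTuple p w} = Set.univ :=
    Set.eq_univ_of_forall fun p => ⟨_, representsTuple_rep p⟩
  rw [hu] at h
  exact { isPreirreducible_univ := h.2, toNonempty := ⟨h.1.some⟩ }

theorem IsPolyFun.generically [Fintype κ] {g : (κ → Fin 3 → ℂ) → ℂ} (hg : IsPolyFun g)
    (hne : ∃ v, g v ≠ 0) {P : MultiP2 κ → Prop}
    (h : ∀ p v, RepresentsTuple p v → g v ≠ 0 → P p) : Generically P := by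
  refine ⟨_, hg.isOpen, hg.isOpen.dense ?_, fun p ⟨v, hv, hgv⟩ => h p v hv hgv⟩
  -- The given witness may contain zero vectors, so it is moved to where all coordinates of index 0
  -- are nonzero.
  obtain ⟨v, h1, h2⟩ := hg.exists_ne_zero_and
    (IsPolyFun.prod Finset.univ fun k _ => IsPolyFun.coord k 0) hne
    ⟨fun _ _ => 1, by simp⟩
  have h3 : ∀ k, v k ≠ 0 := fun k h => by
    exact Finset.prod_ne_zero_iff.1 h2 k (Finset.mem_univ k) (by rw [h]; rfl)
  obtain ⟨p, hp⟩ := exists_representsTuple h3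
  exact ⟨p, v, hp, h1⟩

/-- A map between subsets of products of planes with a polynomial lift is continuous. -/
theorem continuous_of_polyFun [Fintype κ] {ι : Type} [Fintype ι] {S : Set (MultiP2 ι)}
    {F : S → MultiP2 κ} {Φ : (ι → Fin 3 → ℂ) → κ → Fin 3 → ℂ}
    (hΦ : ∀ k i, IsPolyFun (fun w => Φ w k i))
    (hF : ∀ (p : S) w, RepresentsTuple p.1 w → RepresentsTuple (F p) (Φ w)) :
    Continuous F := by
  rw [isTopologicalBasis_zariski.continuous_iff]
  rintro _ ⟨f, δ, hf, rfl⟩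
  have hfp : IsPolyFun fun w => eval (Function.uncurry (Φ w)) f :=
    IsPolyFun.eval f fun ki => hΦ ki.1 ki.2
  convert hfp.isOpen.preimage (continuous_subtype_val (p := (· ∈ S))) using 1
  ext p
  constructor
  · intro hp
    exact ⟨_, representsTuple_rep _,
      (hf.evalAt_ne_zero_iff (hF p _ (representsTuple_rep _))).1 hp⟩
  · rintro ⟨v, hv, hne⟩
    exact (hf.evalAt_ne_zero_iff (hF p _ hv)).2 hne

end Zariski

/-! ### Plane curves have many points -/

section Curves

/-- The linear form with coefficient vector `l`. -/
noncomputable def linForm (l : Fin 3 → ℂ) : MvPolynomial (Fin 3) ℂ := ∑ i, C (l i) * X i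

theorem eval_linForm (l v : Fin 3 → ℂ) : eval v (linForm l) = dotProduct l v := by
  simp [linForm, dotProduct]

theorem totalDegree_linForm_le (l : Fin 3 → ℂ) : (linForm l).totalDegree ≤ 1 := by
  refine totalDegree_finsetSum_le fun i _ => ?_
  refine (totalDegree_mul _ _).trans ?_
  simp

theorem linForm_injective : Function.Injective linForm := by
  intro l m h
  funext i
  have := congrArg (eval (Pi.single i 1)) h
  simpa [eval_linForm] using this

/-- An irreducible polynomial has positive degree, so the cofactor in a polynomial of degree at most
1 is constant. -/
theorem exists_eq_smul_of_dvd_linForm {Q : MvPolynomial (Fin 3) ℂ} (hQ : Irreducible Q)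
    {l : Fin 3 → ℂ} (hl : l ≠ 0) (h : Q ∣ linForm l) : ∃ c : ℂ, c ≠ 0 ∧ linForm l = C c * Q := by
  obtain ⟨r, hr⟩ := h
  have hl0 : linForm l ≠ 0 := fun h0 => hl (linForm_injective (h0.trans (by simp [linForm])))
  have hr0 : r ≠ 0 := by rintro rfl; simp [hr] at hl0
  have hd := totalDegree_mul_of_isDomain hQ.ne_zero hr0
  rw [← hr] at hd
  have h1 := totalDegree_linForm_le l
  have h2 : Q.totalDegree ≠ 0 := by
    intro h0
    have hc := totalDegree_eq_zero_iff_eq_C.1 h0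
    apply hQ.not_isUnit
    rw [hc]
    refine IsUnit.map C (isUnit_iff_ne_zero.2 fun h3 => hQ.ne_zero ?_)
    rw [hc, h3, map_zero]
  have h3 : r.totalDegree = 0 := by omega
  have hc := totalDegree_eq_zero_iff_eq_C.1 h3
  refine ⟨coeff 0 r, fun h4 => hr0 (by rw [hc, h4, map_zero]), ?_⟩
  rw [hr, mul_comm, ← hc]

theorem exists_pair_dot_eq_zero (v : Fin 3 → ℂ) : ∃ l m : Fin 3 → ℂ, l ≠ 0 ∧ m ≠ 0 ∧
    dotProduct l v = 0 ∧ dotProduct m v = 0 ∧ ∀ c : ℂ, l ≠ c • m := by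
  by_cases h0 : v 0 = 0
  · by_cases h1 : v 1 = 0
    · refine ⟨![1, 0, 0], ![0, 1, 0], fun h => ?_, fun h => ?_, ?_, ?_, fun c h => ?_⟩
      · simpa using congrFun h 0
      · simpa using congrFun h 1
      · simp [dotProduct, Fin.sum_univ_three, h0]
      · simp [dotProduct, Fin.sum_univ_three, h1]
      · simpa using congrFun h 0
    · refine ⟨![1, 0, 0], ![0, -v 2, v 1], fun h => ?_, fun h => ?_, ?_, ?_, fun c h => ?_⟩
      · simpa using congrFun h 0
      · exact h1 (by simpa using congrFun h 2)
      · simp [dotProduct, Fin.sum_univ_three, h0]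
      · simp [dotProduct, Fin.sum_univ_three]; ring
      · simpa using congrFun h 0
  · refine ⟨![-v 1, v 0, 0], ![-v 2, 0, v 0], fun h => ?_, fun h => ?_, ?_, ?_, fun c h => ?_⟩
    · exact h0 (by simpa using congrFun h 1)
    · exact h0 (by simpa using congrFun h 2)
    · simp [dotProduct, Fin.sum_univ_three]; ring
    · simp [dotProduct, Fin.sum_univ_three]; ring
    · exact h0 (by simpa using congrFun h 1)

/-- Two independent linear forms vanish at `v`, and they cannot both be constant multiples of `Q`.
-/
theorem exists_linForm_not_dvd {Q : MvPolynomial (Fin 3) ℂ} (hQ : Irreducible Q)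
    (v : Fin 3 → ℂ) : ∃ l, dotProduct l v = 0 ∧ ¬ Q ∣ linForm l := by
  by_contra! hc
  obtain ⟨l, m, hl, hm, hlv, hmv, hlm⟩ := exists_pair_dot_eq_zero v
  obtain ⟨c, hc0, h1⟩ := exists_eq_smul_of_dvd_linForm hQ hl (hc l hlv)
  obtain ⟨d, hd0, h2⟩ := exists_eq_smul_of_dvd_linForm hQ hm (hc m hmv)
  apply hlm (c * d⁻¹)
  apply linForm_injective
  have h3 : linForm ((c * d⁻¹) • m) = C (c * d⁻¹) * linForm m := by
    simp [linForm, Finset.mul_sum, mul_assoc]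
  rw [h3, h2, h1, ← mul_assoc, ← C_mul, mul_assoc, inv_mul_cancel₀ hd0, mul_one]

/-- A plane curve has a point outside any finite set and any curve of which it is not a part. -/
theorem exists_zero_of_irreducible {Q h : MvPolynomial (Fin 3) ℂ} (hQ : Irreducible Q)
    (hh : ¬ Q ∣ h) {S : Set P2} (hS : S.Finite) :
    ∃ (v : Fin 3 → ℂ) (hv : v ≠ 0), eval v Q = 0 ∧ eval v h ≠ 0 ∧
      Projectivization.mk ℂ v hv ∉ S := by
  classical
  by_contra! hc
  choose l hl hlQ using fun v : Fin 3 → ℂ => exists_linForm_not_dvd hQ v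
  have hprime : Prime Q := hQ.prime
  -- If the claim failed, `s` would vanish on the whole zero set of `Q`: the factor `h` covers the
  -- zeros not lying over `S`, the product covers those over `S`, and `linForm (l 0)` covers the
  -- origin. The Nullstellensatz for the prime ideal (Q) then gives `Q ∣ s`, although `Q` divides no
  -- factor.
  set s := h * linForm (l 0) * ∏ p ∈ hS.toFinset, linForm (l p.rep) with hs
  have hnd : ¬ Q ∣ s := by
    intro hd
    rcases hprime.dvd_or_dvd hd with hd | hd
    · rcases hprime.dvd_or_dvd hd with hd | hd
      · exact hh hd
      · exact hlQ _ hd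
    · obtain ⟨p, _, hp⟩ := (Prime.dvd_finsetProd_iff hprime _).1 hd
      exact hlQ _ hp
  have hPrime : (Ideal.span {Q}).IsPrime :=
    (Ideal.span_singleton_prime hQ.ne_zero).2 hprime
  apply hnd
  rw [← Ideal.mem_span_singleton, ← IsPrime.vanishingIdeal_zeroLocus (K := ℂ) (Ideal.span {Q}),
    mem_vanishingIdeal_iff]
  intro v hv
  have hv0 : eval v Q = 0 := by
    rw [mem_zeroLocus_iff] at hv
    simpa using hv Q (Ideal.mem_span_singleton_self Q)
  have hgoal : eval v s = 0 := by
    rw [hs, map_mul, map_mul, eval_linForm, map_prod]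
    by_cases hvz : v = 0
    · simp [hvz]
    · by_cases hvh : eval v h = 0
      · simp [hvh]
      · have hmem := hc v hvz hv0 hvh
        rw [mul_eq_zero]
        right
        refine Finset.prod_eq_zero (hS.mem_toFinset.2 hmem) ?_
        obtain ⟨t, ht, hvt⟩ := (represents_rep _).exists_smul (represents_mk hvz)
        rw [eval_linForm]
        nth_rewrite 2 [hvt]
        rw [dotProduct_smul, hl, smul_zero]
  simpa using hgoal

theorem exists_irreducible_dvd_eval_eq_zero {Q : MvPolynomial (Fin 3) ℂ} (hQ : Q ≠ 0)
    {v : Fin 3 → ℂ} (hv : eval v Q = 0) :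
    ∃ Q₁, Irreducible Q₁ ∧ Q₁ ∣ Q ∧ eval v Q₁ = 0 := by
  induction Q using WfDvdMonoid.induction_on_irreducible with
  | zero => exact absurd rfl hQ
  | unit u hu => exact absurd hv (hu.map (eval v)).ne_zero
  | mul a i ha hi ih =>
    rw [map_mul, mul_eq_zero] at hv
    rcases hv with hv | hv
    · exact ⟨i, hi, dvd_mul_right _ _, hv⟩
    · obtain ⟨Q₁, h1, h2, h3⟩ := ih ha hv
      exact ⟨Q₁, h1, h2.mul_left _, h3⟩

/-- A plane curve has no isolated points. -/
theorem exists_zero_near {Q h : MvPolynomial (Fin 3) ℂ} {v : Fin 3 → ℂ} (hQv : eval v Q = 0)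
    (hhv : eval v h ≠ 0) {S : Set P2} (hS : S.Finite) :
    ∃ (w : Fin 3 → ℂ) (hw : w ≠ 0), eval w Q = 0 ∧ eval w h ≠ 0 ∧
      Projectivization.mk ℂ w hw ∉ S := by
  -- When `Q = 0` every vector is a zero, so any nonzero polynomial vanishing at `v` may replace it.
  wlog hQ : Q ≠ 0 generalizing Q
  · have hX : (X 0 - C (v 0) : MvPolynomial (Fin 3) ℂ) ≠ 0 := by
      intro h0
      have := congrArg (eval (fun _ => v 0 + 1)) h0
      simp at this
    obtain ⟨w, hw, _, h2⟩ := this (Q := X 0 - C (v 0)) (by simp) hX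
    refine ⟨w, hw, ?_, h2⟩
    rw [not_not.1 hQ, map_zero]
  obtain ⟨Q₁, h1, h2, h3⟩ := exists_irreducible_dvd_eval_eq_zero hQ hQv
  have hnd : ¬ Q₁ ∣ h := by
    rintro ⟨r, rfl⟩
    simp [h3] at hhv
  obtain ⟨w, hw, h4, h5⟩ := exists_zero_of_irreducible h1 hnd hS
  obtain ⟨r, rfl⟩ := h2
  exact ⟨w, hw, by simp [h4], h5⟩

/-- Three polynomials whose common zeros lie over finitely many points of `ℙ²` have no common
factor. -/
theorem isUnit_of_dvd_of_finite {f : Fin 3 → MvPolynomial (Fin 3) ℂ} (hf : ∃ i, f i ≠ 0)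
    {S : Set P2} (hS : S.Finite)
    (h : ∀ v (hv : v ≠ 0), (∀ i, eval v (f i) = 0) → Projectivization.mk ℂ v hv ∈ S)
    {q : MvPolynomial (Fin 3) ℂ} (hq : ∀ i, q ∣ f i) : IsUnit q := by
  by_contra hu
  obtain ⟨i, hi⟩ := hf
  have hq0 : q ≠ 0 := by
    rintro rfl
    exact hi (zero_dvd_iff.1 (hq i))
  obtain ⟨Q, hQ, hQq⟩ := WfDvdMonoid.exists_irreducible_factor hu hq0
  obtain ⟨v, hv, h1, _, h3⟩ := exists_zero_of_irreducible hQ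
    (fun hd => hQ.not_isUnit (isUnit_of_dvd_one hd)) hS
  refine h3 (h v hv fun j => ?_)
  obtain ⟨r, hr⟩ := hQq.trans (hq j)
  rw [hr, map_mul, h1, zero_mul]

end Curves

/-! ### Cone ideals and the dimension of the plane -/

section Dimension

variable {κ : Type}

theorem scalingPoly_eq_zero_of_forall [Fintype κ] {f : MvPolynomial (κ × Fin 3) ℂ} {p : MultiP2 κ}
    {v : κ → Fin 3 → ℂ} (hv : RepresentsTuple p v)
    (h : ∀ w, RepresentsTuple p w → eval (Function.uncurry w) f = 0) : scalingPoly f v = 0 := by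
  by_contra h0
  obtain ⟨t, ht, h1⟩ := exists_smul_eval_ne_zero h0
  exact h1 (h _ (hv.smul ht))

theorem eval_eq_zero_of_scalingPoly_eq_zero {f : MvPolynomial (κ × Fin 3) ℂ} {p : MultiP2 κ}
    {v w : κ → Fin 3 → ℂ} (hv : RepresentsTuple p v) (hw : RepresentsTuple p w)
    (h : scalingPoly f v = 0) : eval (Function.uncurry w) f = 0 := by
  obtain ⟨t, _, rfl⟩ := hv.exists_smul hw
  rw [← eval_scalingPoly, h, map_zero]

/-- The ideal of the polynomials that vanish at all coordinate vectors of the points of `Z`. -/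
noncomputable def coneIdeal (Z : Set (MultiP2 κ)) : Ideal (MvPolynomial (κ × Fin 3) ℂ) :=
  vanishingIdeal ℂ {w | ∃ p ∈ Z, ∃ v, RepresentsTuple p v ∧ w = Function.uncurry v}

theorem mem_coneIdeal {Z : Set (MultiP2 κ)} {f : MvPolynomial (κ × Fin 3) ℂ} :
    f ∈ coneIdeal Z ↔
      ∀ p ∈ Z, ∀ v, RepresentsTuple p v → eval (Function.uncurry v) f = 0 := by
  rw [coneIdeal, mem_vanishingIdeal_iff]
  constructor
  · intro h p hp v hv
    simpa using h _ ⟨p, hp, v, hv, rfl⟩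
  · rintro h _ ⟨p, hp, v, hv, rfl⟩
    simpa using h p hp v hv

/-- At a single point, vanishing at all coordinate vectors means that the scaling polynomial is
zero, and these polynomials form a domain. So `Z` is covered by two closed sets, one for each
factor, and irreducibility selects one. -/
theorem isPrime_coneIdeal [Fintype κ] {Z : Set (MultiP2 κ)} (hZ : IsIrreducible Z) :
    (coneIdeal Z).IsPrime := by
  constructor
  · intro h
    obtain ⟨p, hp⟩ := hZ.1
    have := mem_coneIdeal.1 ((Ideal.eq_top_iff_one _).1 h) p hp _ (representsTuple_rep p)
    simp at this
  · intro f g hfg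
    have hcl : ∀ f : MvPolynomial (κ × Fin 3) ℂ,
        IsClosed {p : MultiP2 κ | ∀ v, RepresentsTuple p v → eval (Function.uncurry v) f = 0} :=
      fun f => IsPolyFun.isClosed ⟨f, fun _ => rfl⟩
    have hcov : Z ⊆ {p | ∀ v, RepresentsTuple p v → eval (Function.uncurry v) f = 0} ∪
        {p | ∀ v, RepresentsTuple p v → eval (Function.uncurry v) g = 0} := by
      intro p hp
      have hv := representsTuple_rep p
      have h0 := scalingPoly_eq_zero_of_forall hv (mem_coneIdeal.1 hfg p hp)
      rw [scalingPoly, map_mul, mul_eq_zero] at h0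
      rcases h0 with h0 | h0
      · exact Or.inl fun w hw => eval_eq_zero_of_scalingPoly_eq_zero hv hw h0
      · exact Or.inr fun w hw => eval_eq_zero_of_scalingPoly_eq_zero hv hw h0
    rcases isPreirreducible_iff_isClosed_union_isClosed.1 hZ.2 _ _ (hcl f) (hcl g) hcov with h | h
    · exact Or.inl (mem_coneIdeal.2 fun p hp => h hp)
    · exact Or.inr (mem_coneIdeal.2 fun p hp => h hp)

theorem coneIdeal_strictAnti [Fintype κ] {Z W : Set (MultiP2 κ)} (hZ : IsClosed Z) (h : Z ⊂ W) :
    coneIdeal W < coneIdeal Z := by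
  have hle : coneIdeal W ≤ coneIdeal Z := by
    intro f hf
    rw [mem_coneIdeal] at hf ⊢
    exact fun p hp => hf p (h.subset hp)
  refine lt_of_le_of_ne hle fun heq => ?_
  obtain ⟨p, hpW, hpZ⟩ := Set.exists_of_ssubset h
  obtain ⟨U, ⟨f, δ, hf, hU⟩, hpf, hfZ⟩ :=
    isTopologicalBasis_zariski.isOpen_iff.1 hZ.isOpen_compl p hpZ
  rw [hU] at hpf hfZ
  have h1 : f ∈ coneIdeal Z := by
    rw [mem_coneIdeal]
    intro q hq v hv
    by_contra h0
    exact hfZ ((hf.evalAt_ne_zero_iff hv).2 h0) hq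
  rw [← heq, mem_coneIdeal] at h1
  have hp := representsTuple_rep p
  exact (hf.evalAt_ne_zero_iff hp).1 hpf (h1 p hpW _ hp)

theorem coneIdeal_lt_ker_eval_zero [Fintype κ] [Nonempty κ] {Z : Set (MultiP2 κ)} (hZ : Z.Nonempty) :
    coneIdeal Z < RingHom.ker (eval (0 : κ × Fin 3 → ℂ)) := by
  obtain ⟨p, hp⟩ := hZ
  have hv := representsTuple_rep p
  refine lt_of_le_of_ne (fun f hf => ?_) fun h => ?_
  · rw [RingHom.mem_ker]
    have h0 := scalingPoly_eq_zero_of_forall hv (mem_coneIdeal.1 hf p hp)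
    have h1 := eval_scalingPoly f (fun k => (p k).rep) 0
    rw [h0, map_zero] at h1
    rw [h1]
    congr 2
    funext ki
    simp [Function.uncurry]
  · obtain ⟨k⟩ := ‹Nonempty κ›
    obtain ⟨i, hi⟩ := Function.ne_iff.1 (p k).rep_nonzero
    have h1 : (X (k, i) : MvPolynomial (κ × Fin 3) ℂ) ∈ coneIdeal Z := by
      rw [h, RingHom.mem_ker]
      simp
    apply hi
    simpa using mem_coneIdeal.1 h1 p hp _ hv

/-- Cone ideals reverse a chain of irreducible closed sets into a chain of primes in three
variables. The ideal of the origin lies strictly above all of them, which lowers the bound from 3 to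
2. -/
theorem topologicalKrullDim_plane_le : topologicalKrullDim (MultiP2 Unit) ≤ 2 := by
  let R := MvPolynomial (Unit × Fin 3) ℂ
  have hdim : ringKrullDim R = 3 := by
    rw [MvPolynomial.ringKrullDim_of_isNoetherianRing]
    simp
  let F : TopologicalSpace.IrreducibleCloseds (MultiP2 Unit) → (PrimeSpectrum R)ᵒᵈ := fun Z =>
    OrderDual.toDual ⟨coneIdeal (Z : Set (MultiP2 Unit)), isPrime_coneIdeal Z.isIrreducible⟩
  have hF : StrictMono F := fun Z W h => coneIdeal_strictAnti Z.isClosed h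
  let m : (PrimeSpectrum R)ᵒᵈ := OrderDual.toDual ⟨RingHom.ker (eval (0 : Unit × Fin 3 → ℂ)),
    RingHom.ker_isPrime _⟩
  rw [topologicalKrullDim, Order.krullDim]
  refine iSup_le fun s => ?_
  have hlt : m < (s.map F hF).head :=
    coneIdeal_lt_ker_eval_zero s.head.isIrreducible.1
  have h1 := Order.LTSeries.length_le_krullDim ((s.map F hF).cons m hlt)
  rw [Order.krullDim_orderDual] at h1
  have h2 : ((s.length + 1 : ℕ) : WithBot ℕ∞) ≤ 3 := by
    rw [← hdim, ringKrullDim]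
    simpa using! h1
  have h3 : s.length + 1 ≤ 3 := by exact_mod_cast h2
  have h4 : s.length ≤ 2 := by omega
  exact_mod_cast h4

end Dimension

/-! ### Cross products, rational maps and topological preliminaries -/

theorem exists_eq_smul_of_cross_eq_zero {v w : Fin 3 → ℂ} (hv : v ≠ 0)
    (h : crossProduct v w = 0) : ∃ t : ℂ, w = t • v := by
  by_contra! hc
  have h1 : LinearIndependent ℂ ![v, w] := (LinearIndependent.pair_iff' hv).2 fun t ht => hc t ht.symm
  exact crossProduct_ne_zero_iff_linearIndependent.2 h1 h

theorem Represents.cross_eq_zero {p : P2} {v w : Fin 3 → ℂ} (hv : Represents p v)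
    (hw : Represents p w) : crossProduct v w = 0 := by
  obtain ⟨t, -, rfl⟩ := hv.exists_smul hw
  simp

theorem Represents.of_cross_eq_zero {p : P2} {v w : Fin 3 → ℂ} (hv : Represents p v)
    (hw : w ≠ 0) (h : crossProduct v w = 0) : Represents p w := by
  obtain ⟨t, rfl⟩ := exists_eq_smul_of_cross_eq_zero hv.ne_zero h
  exact hv.smul (smul_ne_zero_iff.1 hw).1

namespace IsPolyFun

variable {κ : Type} {g h : (κ → Fin 3 → ℂ) → Fin 3 → ℂ}

theorem dot (hg : ∀ i, IsPolyFun fun v => g v i) (hh : ∀ i, IsPolyFun fun v => h v i) :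
    IsPolyFun fun v => dotProduct (g v) (h v) :=
  IsPolyFun.sum _ fun i _ => (hg i).mul (hh i)

theorem cross (hg : ∀ i, IsPolyFun fun v => g v i) (hh : ∀ i, IsPolyFun fun v => h v i)
    (i : Fin 3) : IsPolyFun fun v => crossProduct (g v) (h v) i := by
  simp only [cross_apply]
  fin_cases i
  · exact ((hg 1).mul (hh 2)).sub ((hg 2).mul (hh 1))
  · exact ((hg 2).mul (hh 0)).sub ((hg 0).mul (hh 2))
  · exact ((hg 0).mul (hh 1)).sub ((hg 1).mul (hh 0))

end IsPolyFun

namespace PlaneRationalMap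

theorem evalVec_smul (φ : PlaneRationalMap) (t : ℂ) (v : Fin 3 → ℂ) :
    φ.evalVec (t • v) = t ^ φ.degree • φ.evalVec v := by
  funext i
  simp only [evalVec, Pi.smul_apply, smul_eq_mul]
  have := (φ.homogeneous i)
  rw [eval_eq', eval_eq', Finset.mul_sum]
  refine Finset.sum_congr rfl fun m hm => ?_
  have hd : ∑ j, m j = φ.degree := by
    have h1 := this (mem_support_iff.1 hm)
    rw [← h1, Finsupp.weight_apply, Finsupp.sum_fintype _ _ (by simp)]
    simp
  simp only [Pi.smul_apply, smul_eq_mul, mul_pow, Finset.prod_mul_distrib,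
    Finset.prod_pow_eq_pow_sum, hd]
  ring

theorem mem_domain_iff (φ : PlaneRationalMap) {p : P2} {v : Fin 3 → ℂ} (hv : Represents p v) :
    p ∈ φ.domain ↔ φ.evalVec v ≠ 0 := by
  obtain ⟨t, ht, rfl⟩ := (represents_rep p).exists_smul hv
  rw [evalVec_smul, smul_ne_zero_iff, and_iff_right (pow_ne_zero _ ht)]
  rfl

theorem sends_iff (φ : PlaneRationalMap) {p q : P2} {v : Fin 3 → ℂ} (hv : Represents p v) :
    φ.Sends p q ↔ Represents q (φ.evalVec v) := by
  obtain ⟨t, ht, rfl⟩ := (represents_rep p).exists_smul hv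
  rw [evalVec_smul, Represents.congr_smul (pow_ne_zero _ ht) rfl]
  rfl

theorem Sends.mem_domain {φ : PlaneRationalMap} {p q : P2} (h : φ.Sends p q) : p ∈ φ.domain :=
  h.ne_zero

theorem isPolyFun_evalVec (φ : PlaneRationalMap) {κ : Type}
    {g : (κ → Fin 3 → ℂ) → Fin 3 → ℂ} (hg : ∀ i, IsPolyFun fun v => g v i) (i : Fin 3) :
    IsPolyFun fun v => φ.evalVec (g v) i :=
  IsPolyFun.eval (φ.form i) hg

/-- The identity of the plane. -/
noncomputable def identity : PlaneRationalMap where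
  degree := 1
  form := X
  homogeneous := isHomogeneous_X ℂ
  reduced := fun q hq => by
    refine isUnit_of_dvd_of_finite ⟨0, X_ne_zero 0⟩ Set.finite_empty (fun v hv h => ?_) hq
    exact hv (funext fun i => by simpa using h i)

theorem identity_evalVec (v : Fin 3 → ℂ) : identity.evalVec v = v := by
  funext i
  simp [evalVec, identity]

theorem identity_sends {p q : P2} : identity.Sends p q ↔ p = q := by
  rw [Sends, identity_evalVec]
  exact ⟨fun h => (represents_rep p).unique h, fun h => h ▸ represents_rep p⟩

theorem mem_identity_domain (p : P2) : p ∈ identity.domain := (identity_sends.2 rfl).mem_domain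

end PlaneRationalMap

theorem IsIrreducible.subset_closure_inter {X : Type*} [TopologicalSpace X] {S U : Set X}
    (hS : IsIrreducible S) (hU : IsOpen U) (h : (S ∩ U).Nonempty) : S ⊆ closure (S ∩ U) := by
  intro x hx
  rw [mem_closure_iff]
  intro V hV hxV
  obtain ⟨y, h1, h2, h3⟩ := hS.2 U V hU hV h ⟨x, hx, hxV⟩
  exact ⟨y, h3, h1, h2⟩

theorem IsIrreducible.preimage_subtypeVal {X : Type*} [TopologicalSpace X] {E Z : Set X}
    (hZ : IsIrreducible Z) (h : Z ⊆ E) : IsIrreducible (Subtype.val ⁻¹' Z : Set E) := by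
  constructor
  · obtain ⟨x, hx⟩ := hZ.1
    exact ⟨⟨x, h hx⟩, hx⟩
  · rintro _ _ ⟨U, hU, rfl⟩ ⟨V, hV, rfl⟩ ⟨x, hxZ, hxU⟩ ⟨y, hyZ, hyV⟩
    obtain ⟨z, hz, hzU, hzV⟩ := hZ.2 U V hU hV ⟨x, hxZ, hxU⟩ ⟨y, hyZ, hyV⟩
    exact ⟨⟨z, h hz⟩, hz, hzU, hzV⟩

/-- Equality of two points of the plane is the vanishing of the cross product of their coordinates,
a polynomial condition. -/
instance t1Space_multiP2 {κ : Type} [Fintype κ] : T1Space (MultiP2 κ) := by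
  constructor
  intro p
  have h : ({p} : Set (MultiP2 κ)) = ⋂ (k : κ) (i : Fin 3),
      {q | ∀ v, RepresentsTuple q v → crossProduct (p k).rep (v k) i = 0} := by
    ext q
    simp only [Set.mem_singleton_iff, Set.mem_iInter, Set.mem_ofPred_eq]
    constructor
    · rintro rfl k i v hv
      rw [(represents_rep (q k)).cross_eq_zero (hv k)]
      rfl
    · intro h
      funext k
      refine (represents_rep (q k)).unique ?_
      exact (represents_rep (p k)).of_cross_eq_zero (q k).rep_nonzero
        (funext fun i => h k i _ (representsTuple_rep q))
  rw [h]
  exact isClosed_iInter fun k => isClosed_iInter fun i => IsPolyFun.isClosed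
    (IsPolyFun.cross (fun j => IsPolyFun.const ((p k).rep j)) (fun j => IsPolyFun.coord k j) i)

/-- `E` is a correspondence between two planes that is, up to finitely many points of each plane,
the graph of `φ 0` and of `φ 1`, and whose fibres over the base points of `φ 0` contain a curve
through each of their points. -/
structure IsBirationalCorrespondence (E : Set (MultiP2 (Fin 2))) (φ : Fin 2 → PlaneRationalMap) :
    Prop where
  isClosed : IsClosed E
  mem_iff : ∀ k (e : MultiP2 (Fin 2)), e k ∈ (φ k).domain →
    (e ∈ E ↔ (φ k).Sends (e k) (e k.rev))
  finite : ∀ k, ((φ k).domain)ᶜ.Finite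
  curve : ∀ e ∈ E, e 0 ∉ (φ 0).domain → ∃ Q : MvPolynomial (Fin 3) ℂ, eval (e 1).rep Q = 0 ∧
    ∀ (w : Fin 3 → ℂ) (b : P2), Represents b w → eval w Q = 0 →
      (![e 0, b] : MultiP2 (Fin 2)) ∈ E
  exists_common : ∃ e ∈ E, ∀ k, e k ∈ (φ k).domain

/-! ### Birational correspondences: irreducibility and rational inverses -/

namespace IsBirationalCorrespondence

variable {E : Set (MultiP2 (Fin 2))} {φ : Fin 2 → PlaneRationalMap}

/-- The lift of the map `p ↦ (p, φ k p)` (in the order given by `k`) to coordinates. -/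
noncomputable def graphLift (φ : Fin 2 → PlaneRationalMap) (k : Fin 2) (w : Fin 3 → ℂ) :
    Fin 2 → Fin 3 → ℂ := fun j => if j = k then w else (φ k).evalVec w

theorem isPolyFun_graphLift (φ : Fin 2 → PlaneRationalMap) (k : Fin 2) {κ : Type}
    {g : (κ → Fin 3 → ℂ) → Fin 3 → ℂ} (hg : ∀ i, IsPolyFun fun v => g v i) (j : Fin 2)
    (i : Fin 3) : IsPolyFun fun v => graphLift φ k (g v) j i := by
  unfold graphLift
  split_ifs
  · exact hg i
  · exact (φ k).isPolyFun_evalVec hg i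

theorem representsTuple_graphLift {k : Fin 2} {w : Fin 3 → ℂ} {e : MultiP2 (Fin 2)} :
    RepresentsTuple e (graphLift φ k w) ↔
      Represents (e k) w ∧ (φ k).Sends (e k) (e k.rev) := by
  have h : RepresentsTuple e (graphLift φ k w) ↔
      Represents (e k) w ∧ Represents (e k.rev) ((φ k).evalVec w) := by
    unfold RepresentsTuple graphLift
    rw [Fin.forall_fin_two]
    fin_cases k
    · simp
    · simp [and_comm]
  rw [h]
  exact and_congr_right fun h1 => ((φ k).sends_iff h1).symm

/-- The part of `E` that is the graph of `φ k`. -/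
def graphPart (E : Set (MultiP2 (Fin 2))) (φ : Fin 2 → PlaneRationalMap) (k : Fin 2) :
    Set (MultiP2 (Fin 2)) := {e ∈ E | e k ∈ (φ k).domain}

theorem isOpen_domain (φ : PlaneRationalMap) {κ : Type} [Fintype κ] (k : κ) :
    IsOpen {e : MultiP2 κ | e k ∈ φ.domain} := by
  have h : {e : MultiP2 κ | e k ∈ φ.domain} =
      ⋃ i, {e | ∃ v, RepresentsTuple e v ∧ φ.evalVec (v k) i ≠ 0} := by
    ext e
    simp only [Set.mem_ofPred_eq, Set.mem_iUnion]
    constructor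
    · intro h
      obtain ⟨i, hi⟩ := Function.ne_iff.1 h
      exact ⟨i, _, representsTuple_rep e, hi⟩
    · rintro ⟨i, v, hv, hi⟩
      rw [φ.mem_domain_iff (hv k)]
      exact fun h => hi (by rw [h]; rfl)
  rw [h]
  exact isOpen_iUnion fun i =>
    (φ.isPolyFun_evalVec (fun j => IsPolyFun.coord k j) i).isOpen

variable (hE : IsBirationalCorrespondence E φ)

include hE

theorem graphPart_eq (k : Fin 2) :
    graphPart E φ k = {e | ∃ w : Unit → Fin 3 → ℂ, RepresentsTuple e (graphLift φ k (w ()))} := by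
  ext e
  simp only [graphPart, Set.mem_ofPred_eq, representsTuple_graphLift]
  constructor
  · rintro ⟨h1, h2⟩
    exact ⟨fun _ => (e k).rep, represents_rep _, (hE.mem_iff k e h2).1 h1⟩
  · rintro ⟨w, _, h2⟩
    exact ⟨(hE.mem_iff k e h2.mem_domain).2 h2, h2.mem_domain⟩

theorem isIrreducible_graphPart (k : Fin 2) : IsIrreducible (graphPart E φ k) := by
  have h := hE.graphPart_eq k
  rw [h]
  refine isIrreducible_parametrized
    (fun j i => isPolyFun_graphLift φ k (fun i => IsPolyFun.coord () i) j i) ?_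
  obtain ⟨e, he, h1⟩ := hE.exists_common
  have h2 : e ∈ graphPart E φ k := ⟨he, h1 k⟩
  rw [h] at h2
  obtain ⟨w, hw⟩ := h2
  exact ⟨w, fun j => (hw j).ne_zero⟩

/-- The locus over the domain of `φ j` is open and meets the irreducible graph of `φ k` in the
common point, so it is dense in that graph. -/
theorem graphPart_subset_closure (k j : Fin 2) : graphPart E φ k ⊆ closure (graphPart E φ j) := by
  have h := (hE.isIrreducible_graphPart k).subset_closure_inter (isOpen_domain (φ j) j) ?_
  · exact h.trans (closure_mono fun e he => ⟨he.1.1, he.2⟩)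
  · obtain ⟨e, he, h1⟩ := hE.exists_common
    exact ⟨e, ⟨he, h1 k⟩, h1 j⟩

/-- Only a point e over a base point of `φ 0` needs an argument. There `E` contains a curve through
e in the fibre; every basic neighbourhood of e meets this curve outside the finitely many base
points of `φ 1`, that is, in the graph of `φ 1`. -/
theorem subset_closure_graphPart (k : Fin 2) : E ⊆ closure (graphPart E φ k) := by
  suffices h : E ⊆ closure (graphPart E φ 1) from h.trans
    (closure_minimal (hE.graphPart_subset_closure 1 k) isClosed_closure)
  intro e he
  by_cases h0 : e 0 ∈ (φ 0).domain
  · exact hE.graphPart_subset_closure 0 1 ⟨he, h0⟩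
  · obtain ⟨Q, hQ, hQE⟩ := hE.curve e he h0
    rw [isTopologicalBasis_zariski.mem_closure_iff]
    rintro _ ⟨f, δ, hf, rfl⟩ hef
    -- `h` is the neighbourhood polynomial `f` restricted to the plane with first coordinate `e 0`.
    let h : MvPolynomial (Fin 3) ℂ :=
      aeval (fun ki : Fin 2 × Fin 3 => (![fun i => C ((e 0).rep i), X] : Fin 2 → Fin 3 → _) ki.1 ki.2) f
    have hh : ∀ w, eval w h = eval (Function.uncurry ![(e 0).rep, w]) f := by
      intro w
      simp only [h]
      rw [eval_aeval_eq]
      congr 2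
      funext ⟨k, i⟩
      fin_cases k <;> simp [Function.uncurry]
    have hrep : ∀ {b : P2} {w}, Represents b w →
        RepresentsTuple (![e 0, b] : MultiP2 (Fin 2)) ![(e 0).rep, w] := by
      intro b w hw j
      fin_cases j
      · exact represents_rep (e 0)
      · exact hw
    have heq : (![e 0, e 1] : MultiP2 (Fin 2)) = e := by
      funext j
      fin_cases j <;> rfl
    have h1 : eval (e 1).rep h ≠ 0 := by
      rw [hh, ← hf.evalAt_ne_zero_iff (hrep (represents_rep (e 1))), heq]
      exact hef
    obtain ⟨w, hw, hwQ, hwh, hwS⟩ := exists_zero_near hQ h1 (hE.finite 1)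
    refine ⟨(![e 0, Projectivization.mk ℂ w hw] : MultiP2 (Fin 2)), ?_, ?_, ?_⟩
    · exact (hf.evalAt_ne_zero_iff (hrep (represents_mk hw))).2 (by rwa [← hh])
    · exact hQE w _ (represents_mk hw) hwQ
    · exact not_not.1 hwS

theorem eq_closure_graphPart (k : Fin 2) : E = closure (graphPart E φ k) :=
  (hE.subset_closure_graphPart k).antisymm
    (closure_minimal (fun _ he => he.1) hE.isClosed)

theorem isIrreducible : IsIrreducible E := by
  rw [hE.eq_closure_graphPart 0]
  exact (hE.isIrreducible_graphPart 0).closure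

/-- The rational section of the `k`-th projection. -/
theorem isRationalInverse (k : Fin 2) : IsRationalInverse E k
    (fun j => if j = k then PlaneRationalMap.identity else φ k) := by
  have hrev : ∀ j : Fin 2, j ≠ k → j = k.rev := by
    fin_cases k <;> intro j <;> fin_cases j <;> simp
  have hne : k.rev ≠ k := by fin_cases k <;> simp
  refine ⟨fun p e h => ?_, ?_, fun e he h j => ?_⟩
  · have h1 := h k
    have h2 := h k.rev
    simp only [if_true, PlaneRationalMap.identity_sends] at h1
    simp only [if_neg hne, h1] at h2
    exact ⟨(hE.mem_iff k e h2.mem_domain).2 h2, h1.symm⟩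
  · refine (hE.subset_closure_graphPart k).trans (closure_mono fun e he => ⟨he.1, fun j => ?_⟩)
    dsimp only
    split_ifs
    · exact PlaneRationalMap.mem_identity_domain _
    · exact he.2
  · have h1 := h k.rev
    simp only [if_neg hne] at h1
    dsimp only
    split_ifs with hj
    · rw [hj, PlaneRationalMap.identity_sends]
    · rw [hrev j hj]
      exact (hE.mem_iff k e h1).1 he

theorem isLeftInverse (k : Fin 2) : (φ k.rev).IsLeftInverse (φ k) := by
  constructor
  · obtain ⟨e, he, h⟩ := hE.exists_common
    exact ⟨e k, e k.rev, (hE.mem_iff k e (h k)).1 he, h k.rev⟩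
  · intro p q hpq hq
    have key : ∃ e : MultiP2 (Fin 2), e k = p ∧ e k.rev = q := by
      fin_cases k
      · exact ⟨(![p, q] : Fin 2 → P2), rfl, rfl⟩
      · exact ⟨(![q, p] : Fin 2 → P2), rfl, rfl⟩
    obtain ⟨e, rfl, rfl⟩ := key
    have he := (hE.mem_iff k e hpq.mem_domain).2 hpq
    have := (hE.mem_iff k.rev e hq).1 he
    rwa [Fin.rev_rev] at this

theorem isCremona : (φ 0).IsCremona := ⟨φ 1, hE.isLeftInverse 0, hE.isLeftInverse 1⟩

end IsBirationalCorrespondence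

/-! ### Dimension and pairs of lines in one plane -/

theorem exists_cross_ne_zero {a : Fin 3 → ℂ} (ha : a ≠ 0) : ∃ c, crossProduct a c ≠ 0 := by
  by_contra! h
  apply ha
  have h1 := h ![1, 0, 0]
  have h2 := h ![0, 1, 0]
  simp only [cross_apply] at h1 h2
  funext i
  fin_cases i
  · simpa using congrFun h2 2
  · simpa using congrFun h1 2
  · simpa using congrFun h1 1

theorem onLine_iff {l p : P2} {u v : Fin 3 → ℂ} (hu : Represents l u) (hv : Represents p v) :
    OnLine l p ↔ dotProduct u v = 0 := by
  obtain ⟨s, hs, rfl⟩ := (represents_rep l).exists_smul hu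
  obtain ⟨t, ht, rfl⟩ := (represents_rep p).exists_smul hv
  rw [OnLine, smul_dotProduct, dotProduct_smul, smul_eq_zero, smul_eq_zero]
  simp [hs, ht]

namespace IsBirationalCorrespondence

open TopologicalSpace Topology

variable {E : Set (MultiP2 (Fin 2))} {φ : Fin 2 → PlaneRationalMap}
  (hE : IsBirationalCorrespondence E φ)

include hE

theorem exists_mem_domain (k : Fin 2) : ∃ v, (φ k).evalVec v ≠ 0 := by
  obtain ⟨e, _, h⟩ := hE.exists_common
  exact ⟨_, h k⟩

/-- The projection to the `k`-th plane has the continuous inverse p ↦ (p, φ k p) over the domain, so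
the graph embeds in the plane. -/
theorem topologicalKrullDim_graphPart_le (k : Fin 2) :
    topologicalKrullDim (graphPart E φ k) ≤ 2 := by
  let D : Set (MultiP2 Unit) := {p | p () ∈ (φ k).domain}
  let F : graphPart E φ k → MultiP2 Unit := fun e _ => e.1 k
  have hF : Continuous F := continuous_of_polyFun (Φ := fun w _ => w k)
    (fun _ i => IsPolyFun.coord k i) fun p w hw _ => hw k
  let F' : graphPart E φ k → D := fun e => ⟨F e, e.2.2⟩
  have hF' : Continuous F' := hF.subtype_mk _
  have hlift : ∀ p : D, ∀ j, graphLift φ k (p.1 ()).rep j ≠ 0 := by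
    intro p j
    unfold graphLift
    split_ifs
    · exact (p.1 ()).rep_nonzero
    · exact p.2
  choose G hG using fun p : D => exists_representsTuple (hlift p)
  have hG' : ∀ (p : D) w, RepresentsTuple p.1 w → RepresentsTuple (G p) (graphLift φ k (w ())) := by
    intro p w hw
    have h1 := representsTuple_graphLift.1 (hG p)
    have h2 : G p k = p.1 () := h1.1.unique (represents_rep _)
    exact representsTuple_graphLift.2 ⟨h2 ▸ hw (), h1.2⟩
  have hGmem : ∀ p, G p ∈ graphPart E φ k := by
    intro p
    rw [hE.graphPart_eq k]
    exact ⟨fun _ => (p.1 ()).rep, hG p⟩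
  have hGc : Continuous G := continuous_of_polyFun
    (fun j i => isPolyFun_graphLift φ k (fun i => IsPolyFun.coord () i) j i) hG'
  let G' : D → graphPart E φ k := fun p => ⟨G p, hGmem p⟩
  have hGc' : Continuous G' := hGc.subtype_mk _
  have hinv : Function.LeftInverse G' F' := by
    intro e
    apply Subtype.ext
    have h1 := (hE.mem_iff k e.1 e.2.2).1 e.2.1
    exact (hG (F' e)).unique (representsTuple_graphLift.2 ⟨represents_rep _, h1⟩)
  have hind : IsInducing (Subtype.val ∘ F') :=
    IsInducing.subtypeVal.comp (hinv.isEmbedding hGc' hF').isInducing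
  exact hind.topologicalKrullDim_le.trans topologicalKrullDim_plane_le

theorem finite_diff : (E \ (graphPart E φ 0 ∪ graphPart E φ 1)).Finite := by
  have h := (hE.finite 0).prod (hE.finite 1)
  refine (h.image fun pq => (![pq.1, pq.2] : MultiP2 (Fin 2))).subset ?_
  rintro e ⟨he, hn⟩
  refine ⟨(e 0, e 1), ⟨fun h0 => hn (Or.inl ⟨he, h0⟩), fun h1 => hn (Or.inr ⟨he, h1⟩)⟩, ?_⟩
  funext j
  fin_cases j <;> rfl

/-- A dense open subset need not bound the dimension of a space, so the chain itself is localized.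
In a chain of length 3 the set `Z 1` is irreducible and not a point, so it is infinite and meets a
graph at some e. Then {e} < Z 1 < Z 2 < Z 3 restricts to a chain in that graph, which is open in `E`
and of dimension at most 2. -/
theorem topologicalKrullDim_le : topologicalKrullDim E ≤ 2 := by
  rw [topologicalKrullDim, Order.krullDim]
  refine iSup_le fun s => ?_
  by_contra hlen
  have hlen' : 3 ≤ s.length := by
    by_contra h
    exact hlen (by exact_mod_cast (by omega : s.length ≤ 2))
  -- Only the indices 0 to 3 are used, where the truncation by `min` has no effect.
  let Z : ℕ → IrreducibleCloseds E := fun n => s.toFun ⟨min n s.length, by omega⟩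
  have hZ : ∀ m n, m < n → n ≤ 3 → Z m < Z n := by
    intro m n hmn hn
    apply s.strictMono
    rw [Fin.lt_def]
    simp only
    omega
  have hmeet : ∃ k, ((Z 1 : Set E) ∩ Subtype.val ⁻¹' graphPart E φ k).Nonempty := by
    by_contra! hc
    have hfin : (Z 1 : Set E).Finite := by
      refine (hE.finite_diff.preimage Subtype.val_injective.injOn).subset fun e he => ⟨e.2, ?_⟩
      rintro (h | h)
      · exact (hc 0).subset ⟨he, h⟩
      · exact (hc 1).subset ⟨he, h⟩
    have hsub : (Z 1 : Set E).Subsingleton :=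
      hfin.isDiscrete.subsingleton_of_isPreirreducible (Z 1).isIrreducible.2
    have h01 := hZ 0 1 (by norm_num) (by norm_num)
    obtain ⟨e, he1, he0⟩ := Set.exists_of_ssubset (SetLike.coe_ssubset_coe.2 h01)
    obtain ⟨e', he'⟩ := (Z 0).isIrreducible.1
    exact he0 (hsub he1 (h01.le he') ▸ he')
  obtain ⟨k, e, he, hek⟩ := hmeet
  have hsub : graphPart E φ k ⊆ E := fun _ h => h.1
  have hopen : IsOpenEmbedding (Set.inclusion hsub) := by
    refine ⟨IsEmbedding.inclusion hsub, ?_⟩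
    rw [Set.range_inclusion]
    have := (isOpen_domain (φ k) k).preimage (continuous_subtype_val (p := (· ∈ E)))
    convert this using 1
    ext e
    exact ⟨fun h => h.2, fun h => ⟨e.2, h⟩⟩
  have hmem : ∀ n, 1 ≤ n → n ≤ 3 → e ∈ Z n := by
    intro n h1 h3
    rcases h1.eq_or_lt with rfl | h1
    · exact he
    · exact (hZ 1 n h1 h3).le he
  have hpt : ({e} : IrreducibleCloseds E) < Z 1 := by
    refine lt_of_le_of_ne (fun x hx => ?_) fun h => ?_
    · rw [IrreducibleCloseds.mem_singleton.1 hx]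
      exact he
    · have h01 := hZ 0 1 (by norm_num) (by norm_num)
      rw [← h] at h01
      obtain ⟨x, hx⟩ := (Z 0).isIrreducible.1
      have hxe := IrreducibleCloseds.mem_singleton.1 (h01.le hx)
      refine h01.not_ge fun y hy => ?_
      rw [IrreducibleCloseds.mem_singleton.1 hy, ← hxe]
      exact hx
  let I := IrreducibleCloseds.orderIsoOfIsOpenEmbedding _ hopen
  have hne : ∀ W : IrreducibleCloseds E, e ∈ W →
      W ∈ {V : IrreducibleCloseds E | (Set.inclusion hsub ⁻¹' (V : Set E)).Nonempty} :=
    fun W hW => ⟨⟨e.1, hek⟩, hW⟩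
  have hlt : ∀ {V W : IrreducibleCloseds E} (hV : e ∈ V) (hW : e ∈ W), V < W →
      I.symm ⟨V, hne V hV⟩ < I.symm ⟨W, hne W hW⟩ := by
    intro V W hV hW h
    rw [OrderIso.lt_iff_lt]
    exact h
  have he0 : e ∈ ({e} : IrreducibleCloseds E) := IrreducibleCloseds.mem_singleton.2 rfl
  have h12 := hZ 1 2 (by norm_num) (by norm_num)
  have h23 := hZ 2 3 (by norm_num) (by norm_num)
  have m1 := hmem 1 (by norm_num) (by norm_num)
  have m2 := hmem 2 (by norm_num) (by norm_num)
  have m3 := hmem 3 (by norm_num) (by norm_num)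
  let c : LTSeries (IrreducibleCloseds (graphPart E φ k)) :=
    (((RelSeries.singleton _ (I.symm ⟨Z 3, hne _ m3⟩)).cons (I.symm ⟨Z 2, hne _ m2⟩)
      (hlt m2 m3 h23)).cons (I.symm ⟨Z 1, hne _ m1⟩) (hlt m1 m2 h12)).cons
      (I.symm ⟨{e}, hne _ he0⟩) (hlt he0 m1 hpt)
  have hc := (Order.LTSeries.length_le_krullDim c).trans (hE.topologicalKrullDim_graphPart_le k)
  have hc3 : c.length = 3 := rfl
  rw [hc3] at hc
  exact absurd hc (by norm_num)

/-- A point, the closure of the graph over a line through its first coordinate, and `E` form a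
strict chain: the equation of the line holds on the middle set and fails at a graph point off the
line. -/
theorem two_le_topologicalKrullDim : 2 ≤ topologicalKrullDim E := by
  obtain ⟨e, he, hdom⟩ := hE.exists_common
  obtain ⟨c, hc⟩ := exists_cross_ne_zero (e 0).rep_nonzero
  obtain ⟨i, hi⟩ := Function.ne_iff.1 hc
  set a := (e 0).rep with ha
  set l := crossProduct a c with hl
  let M : (Unit → Fin 3 → ℂ) → Fin 3 → ℂ := fun w => w () 0 • a + w () 1 • c
  have hM : ∀ i, IsPolyFun fun w => M w i := fun i =>
    ((IsPolyFun.coord () 0).mul (IsPolyFun.const (a i))).add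
      ((IsPolyFun.coord () 1).mul (IsPolyFun.const (c i)))
  have hlM : ∀ w, dotProduct l (M w) = 0 := by
    intro w
    have h1 : dotProduct l a = 0 := by rw [hl, dotProduct_comm, dot_self_cross]
    have h2 : dotProduct l c = 0 := by rw [hl, dotProduct_comm, dot_cross_self]
    simp [M, dotProduct_add, dotProduct_smul, h1, h2]
  have hM1 : M (fun _ => ![1, 0, 0]) = a := by simp [M]
  have he0 := (hE.mem_iff 0 e (hdom 0)).1 he
  have hea : RepresentsTuple e (graphLift φ 0 a) :=
    representsTuple_graphLift.2 ⟨represents_rep _, he0⟩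
  let T : Set (MultiP2 (Fin 2)) := {p | ∃ w, RepresentsTuple p (graphLift φ 0 (M w))}
  have heT : e ∈ T := ⟨fun _ => ![1, 0, 0], by rw [hM1]; exact hea⟩
  have hTirr : IsIrreducible T := isIrreducible_parametrized
    (fun j i => isPolyFun_graphLift φ 0 hM j i) ⟨fun _ => ![1, 0, 0], fun j => by
      rw [hM1]; exact (hea j).ne_zero⟩
  have hmemE : ∀ {p w}, RepresentsTuple p (graphLift φ 0 w) → p ∈ E := by
    intro p w hp
    have h1 := (representsTuple_graphLift.1 hp).2
    exact (hE.mem_iff 0 p h1.mem_domain).2 h1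
  have hTE : closure T ⊆ E := closure_minimal (fun p ⟨_, hw⟩ => hmemE hw) hE.isClosed
  obtain ⟨r, hr⟩ := Function.ne_iff.1 (hdom 0)
  have hlift : ∀ w, (φ 0).evalVec w ≠ 0 → w ≠ 0 →
      ∃ p : MultiP2 (Fin 2), RepresentsTuple p (graphLift φ 0 w) := by
    intro w h1 h2
    refine exists_representsTuple fun j => ?_
    unfold graphLift
    split_ifs
    · exact h2
    · exact h1
  -- a second point of the curve
  obtain ⟨w, hw1, hw2⟩ := ((φ 0).isPolyFun_evalVec hM r).exists_ne_zero_and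
    (IsPolyFun.coord () 1) ⟨fun _ => ![1, 0, 0], by rw [hM1]; exact hr⟩ ⟨fun _ _ => 1, one_ne_zero⟩
  have hMw : crossProduct a (M w) ≠ 0 := by
    intro h
    apply hi
    have h1 : crossProduct a (M w) = w () 1 • l := by simp [M, hl]
    rw [h1] at h
    rw [(smul_eq_zero.1 h).resolve_left hw2]
  obtain ⟨p, hp⟩ := hlift (M w) (fun h => hw1 (by rw [h]; rfl))
    (fun h => hMw (by rw [h, map_zero]))
  have hpe : p ≠ e := by
    rintro rfl
    exact hMw ((represents_rep _).cross_eq_zero (representsTuple_graphLift.1 hp).1)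
  -- a point of `E` off the curve
  obtain ⟨u, hu1, hu2⟩ := ((φ 0).isPolyFun_evalVec
    (fun i => IsPolyFun.coord () i) r).exists_ne_zero_and
    (IsPolyFun.dot (fun i => IsPolyFun.const (l i)) (fun i => IsPolyFun.coord () i))
    ⟨fun _ => a, hr⟩ ⟨fun _ => Pi.single i 1, by simpa using hi⟩
  obtain ⟨q, hq⟩ := hlift (u ()) (fun h => hu1 (by rw [h]; rfl))
    (fun h => hu2 (by rw [h, dotProduct_zero]))
  have hqT : q ∉ closure T := by
    intro hqT
    have hcl : IsClosed {p : MultiP2 (Fin 2) | ∀ v, RepresentsTuple p v → dotProduct l (v 0) = 0} :=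
      IsPolyFun.isClosed
        (IsPolyFun.dot (fun i => IsPolyFun.const (l i)) (fun i => IsPolyFun.coord 0 i))
    have hsub : T ⊆ {p | ∀ v, RepresentsTuple p v → dotProduct l (v 0) = 0} := by
      rintro p ⟨w, hw⟩ v hv
      obtain ⟨t, -, ht⟩ := (representsTuple_graphLift.1 hw).1.exists_smul (hv 0)
      rw [ht, dotProduct_smul, hlM, smul_zero]
    exact hu2 (closure_minimal hsub hcl hqT _ hq)
  let Z0 : IrreducibleCloseds E := {⟨e, he⟩}
  let Z1 : IrreducibleCloseds E := ⟨Subtype.val ⁻¹' closure T,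
    hTirr.closure.preimage_subtypeVal hTE, isClosed_closure.preimage continuous_subtype_val⟩
  let Z2 : IrreducibleCloseds E := ⟨Subtype.val ⁻¹' E,
    hE.isIrreducible.preimage_subtypeVal le_rfl, hE.isClosed.preimage continuous_subtype_val⟩
  have h01 : Z0 < Z1 := by
    refine lt_of_le_of_ne (fun x hx => ?_) fun h => hpe ?_
    · rw [IrreducibleCloseds.mem_singleton.1 hx]
      exact subset_closure heT
    · have : (⟨p, hmemE hp⟩ : E) ∈ Z0 := by
        rw [h]
        exact subset_closure ⟨w, hp⟩
      exact congrArg Subtype.val (IrreducibleCloseds.mem_singleton.1 this)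
  have h12 : Z1 < Z2 := by
    refine lt_of_le_of_ne (fun x _ => x.2) fun h => hqT ?_
    have : (⟨q, hmemE hq⟩ : E) ∈ Z1 := by
      rw [h]
      exact hmemE hq
    exact this
  let s₁ : LTSeries (IrreducibleCloseds E) := (RelSeries.singleton _ Z2).cons Z1 h12
  have hs₁ : s₁.head = Z1 := RelSeries.head_cons _ _ _
  let s : LTSeries (IrreducibleCloseds E) := s₁.cons Z0 (hs₁ ▸ h01)
  exact Order.LTSeries.length_le_krullDim s

theorem topologicalKrullDim_eq : topologicalKrullDim E = 2 :=
  hE.topologicalKrullDim_le.antisymm hE.two_le_topologicalKrullDim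

/-- Two generic lines in the `k`-th plane cut out one point of `E`. -/
theorem generically_encard_eq_one {κ : Type} [Fintype κ] {s t : κ} (hst : s ≠ t) (k : Fin 2) :
    Generically fun l : MultiP2 κ =>
      {e ∈ E | OnLine (l s) (e k) ∧ OnLine (l t) (e k)}.encard = 1 := by
  classical
  obtain ⟨v, hv⟩ := hE.exists_mem_domain k
  obtain ⟨r, hr⟩ := Function.ne_iff.1 hv
  have hcr : ∀ i, IsPolyFun fun l : κ → Fin 3 → ℂ => crossProduct (l s) (l t) i :=
    IsPolyFun.cross (fun i => IsPolyFun.coord s i) (fun i => IsPolyFun.coord t i)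
  refine (((φ k).isPolyFun_evalVec hcr r).mul (hcr 0)).generically ?_ ?_
  · obtain ⟨a, ha1, ha2⟩ := ((φ k).isPolyFun_evalVec
      (fun i => IsPolyFun.coord () i) r).exists_ne_zero_and (IsPolyFun.coord () 0)
      ⟨fun _ => v, hr⟩ ⟨fun _ _ => 1, one_ne_zero⟩
    -- These two lines pass through a and have cross product a₀ · a, which reduces the witness to a
    -- point in the domain with a₀ ≠ 0.
    refine ⟨Function.update (fun _ => ![a () 1, -a () 0, 0]) t ![a () 2, 0, -a () 0], ?_⟩
    have h1 : crossProduct ![a () 1, -a () 0, 0] ![a () 2, 0, -a () 0] = a () 0 • a () := by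
      rw [cross_apply]
      funext i
      fin_cases i <;> simp
      ring
    simp only [Function.update_self, Function.update_of_ne hst, h1,
      PlaneRationalMap.evalVec_smul]
    exact mul_ne_zero (mul_ne_zero (pow_ne_zero _ ha2) ha1) (mul_ne_zero ha2 ha2)
  · intro l v hlv hne
    set a := crossProduct (v s) (v t) with ha
    have hφa : (φ k).evalVec a ≠ 0 := fun h => left_ne_zero_of_mul hne (by rw [h]; rfl)
    have ha0 : a ≠ 0 := fun h => right_ne_zero_of_mul hne (by rw [h]; rfl)
    have hmem : ∀ {e : MultiP2 (Fin 2)},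
        (OnLine (l s) (e k) ∧ OnLine (l t) (e k)) ↔ Represents (e k) a := by
      intro e
      have hw := represents_rep (e k)
      rw [onLine_iff (hlv s) hw, onLine_iff (hlv t) hw]
      constructor
      · rintro ⟨h1, h2⟩
        refine hw.of_cross_eq_zero ha0 ?_
        rw [← cross_anticomm, ha, cross_cross_eq_smul_sub_smul, h1, h2]
        simp
      · intro h
        obtain ⟨c, -, hc⟩ := h.exists_smul hw
        rw [hc, ha]
        simp
    obtain ⟨e, he⟩ : ∃ e : MultiP2 (Fin 2), RepresentsTuple e (graphLift φ k a) := by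
      refine exists_representsTuple fun j => ?_
      unfold graphLift
      split_ifs
      · exact ha0
      · exact hφa
    rw [Set.encard_eq_one]
    refine ⟨e, Set.eq_singleton_iff_unique_mem.2 ⟨?_, ?_⟩⟩
    · have h1 := representsTuple_graphLift.1 he
      exact ⟨(hE.mem_iff k e h1.2.mem_domain).2 h1.2, hmem.2 h1.1⟩
    · rintro e' ⟨h1, h2⟩
      have h3 := hmem.1 h2
      have h4 := (hE.mem_iff k e' (((φ k).mem_domain_iff h3).2 hφa)).1 h1
      exact (representsTuple_graphLift.2 ⟨h3, h4⟩).unique he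

theorem hasMultidegree_two_zero : HasMultidegree E 2 0 1 := by
  have h := hE.generically_encard_eq_one (κ := Fin 2 ⊕ Fin 0) (s := Sum.inl 0) (t := Sum.inl 1)
    (by simp) 0
  simpa [HasMultidegree, Fin.forall_fin_two] using h

theorem hasMultidegree_zero_two : HasMultidegree E 0 2 1 := by
  have h := hE.generically_encard_eq_one (κ := Fin 0 ⊕ Fin 2) (s := Sum.inr 0) (t := Sum.inr 1)
    (by simp) 1
  simpa [HasMultidegree, Fin.forall_fin_two] using h

end IsBirationalCorrespondence

/-! ### Epipolar matrices as solutions of a linear system -/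

section CameraCenters

variable {n : ℕ}

/-- `F` is a fundamental matrix for the point pairs `(X i, Y i)` with kernel `a`. -/
def IsEpipolar (X Y : Fin n → Fin 3 → ℂ) (a : Fin 3 → ℂ) (F : Matrix (Fin 3) (Fin 3) ℂ) : Prop :=
  F.mulVec a = 0 ∧ ∀ i, dotProduct (Y i) (F.mulVec (X i)) = 0

/-- The defining condition of the camera centers variety, in coordinates. -/
def HasEpipolar (X Y : Fin n → Fin 3 → ℂ) (a b : Fin 3 → ℂ) : Prop :=
  ∃ F, F ≠ 0 ∧ IsEpipolar X Y a F ∧ F.transpose.mulVec b = 0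

theorem IsEpipolar.transpose {X Y : Fin n → Fin 3 → ℂ} {a b : Fin 3 → ℂ}
    {F : Matrix (Fin 3) (Fin 3) ℂ} (h : IsEpipolar X Y a F) (hb : F.transpose.mulVec b = 0) :
    IsEpipolar Y X b F.transpose := by
  refine ⟨hb, fun i => ?_⟩
  rw [Matrix.mulVec_transpose, dotProduct_comm, ← Matrix.dotProduct_mulVec]
  exact h.2 i

theorem HasEpipolar.symm {X Y : Fin n → Fin 3 → ℂ} {a b : Fin 3 → ℂ}
    (h : HasEpipolar X Y a b) : HasEpipolar Y X b a := by
  obtain ⟨F, h0, h1, h2⟩ := h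
  refine ⟨F.transpose, fun h => h0 (Matrix.transpose_eq_zero.1 h), h1.transpose h2, ?_⟩
  rw [Matrix.transpose_transpose]
  exact h1.1

theorem IsEpipolar.congr_smul {X Y X' Y' : Fin n → Fin 3 → ℂ} {a a' : Fin 3 → ℂ}
    {F : Matrix (Fin 3) (Fin 3) ℂ} (h : IsEpipolar X Y a F) {s t : Fin n → ℂ} {r : ℂ}
    (hX : ∀ i, X' i = s i • X i) (hY : ∀ i, Y' i = t i • Y i) (ha : a' = r • a) :
    IsEpipolar X' Y' a' F := by
  refine ⟨by rw [ha, Matrix.mulVec_smul, h.1, smul_zero], fun i => ?_⟩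
  rw [hX, hY, Matrix.mulVec_smul, dotProduct_smul, smul_dotProduct, h.2 i]
  simp

theorem mem_cameraCentersVariety_iff {x y : Fin n → P2} {e : MultiP2 (Fin 2)}
    {X Y : Fin n → Fin 3 → ℂ} {a b : Fin 3 → ℂ} (hX : ∀ i, Represents (x i) (X i))
    (hY : ∀ i, Represents (y i) (Y i)) (ha : Represents (e 0) a) (hb : Represents (e 1) b) :
    e ∈ cameraCentersVariety x y ↔ HasEpipolar X Y a b := by
  have key : ∀ {X Y X' Y' : Fin n → Fin 3 → ℂ} {a b a' b' : Fin 3 → ℂ},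
      (∀ i, Represents (x i) (X i)) → (∀ i, Represents (x i) (X' i)) →
      (∀ i, Represents (y i) (Y i)) → (∀ i, Represents (y i) (Y' i)) →
      Represents (e 0) a → Represents (e 0) a' → Represents (e 1) b → Represents (e 1) b' →
      HasEpipolar X Y a b → HasEpipolar X' Y' a' b' := by
    rintro X Y X' Y' a b a' b' h1 h1' h2 h2' h3 h3' h4 h4' ⟨F, h0, hF, hF'⟩
    choose s _ hs using fun i => (h1 i).exists_smul (h1' i)
    choose t _ ht using fun i => (h2 i).exists_smul (h2' i)
    obtain ⟨r, _, hr⟩ := h3.exists_smul h3'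
    obtain ⟨r', _, hr'⟩ := h4.exists_smul h4'
    refine ⟨F, h0, hF.congr_smul hs ht hr, ?_⟩
    rw [hr', Matrix.mulVec_smul, hF', smul_zero]
  have h1 : e ∈ cameraCentersVariety x y ↔
      HasEpipolar (fun i => (x i).rep) (fun i => (y i).rep) (e 0).rep (e 1).rep :=
    ⟨fun ⟨F, h0, h1, h2, h3⟩ => ⟨F, h0, ⟨h1, h3⟩, h2⟩,
      fun ⟨F, h0, ⟨h1, h3⟩, h2⟩ => ⟨F, h0, h1, h2, h3⟩⟩
  rw [h1]
  exact ⟨key (fun i => represents_rep _) hX (fun i => represents_rep _) hY (represents_rep _) ha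
    (represents_rep _) hb, key hX (fun i => represents_rep _) hY (fun i => represents_rep _) ha
    (represents_rep _) hb (represents_rep _)⟩

/-- The matrix of the linear system for the entries of `F`. -/
def epipolarSystem (X Y : Fin n → Fin 3 → ℂ) (v : Fin 2 → Fin 3 → ℂ) :
    Matrix (Fin 3 ⊕ Fin 3 ⊕ Fin n) (Fin 3 × Fin 3) ℂ := Matrix.of fun r ij =>
  Sum.elim (fun k => if ij.1 = k then v 0 ij.2 else 0)
    (Sum.elim (fun k => if ij.2 = k then v 1 ij.1 else 0) (fun k => Y k ij.1 * X k ij.2)) r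

theorem epipolarSystem_mulVec_eq_zero_iff (X Y : Fin n → Fin 3 → ℂ) (v : Fin 2 → Fin 3 → ℂ)
    (F : Matrix (Fin 3) (Fin 3) ℂ) :
    (epipolarSystem X Y v).mulVec (Function.uncurry F) = 0 ↔
      IsEpipolar X Y (v 0) F ∧ F.transpose.mulVec (v 1) = 0 := by
  have h1 : ∀ k, (epipolarSystem X Y v).mulVec (Function.uncurry F) (Sum.inl k) =
      F.mulVec (v 0) k := by
    intro k
    simp [epipolarSystem, Matrix.mulVec, dotProduct, Fintype.sum_prod_type, Function.uncurry,
      mul_comm]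
  have h2 : ∀ k, (epipolarSystem X Y v).mulVec (Function.uncurry F) (Sum.inr (Sum.inl k)) =
      F.transpose.mulVec (v 1) k := by
    intro k
    simp [epipolarSystem, Matrix.mulVec, dotProduct, Fintype.sum_prod_type, Function.uncurry,
      mul_comm]
  have h3 : ∀ k, (epipolarSystem X Y v).mulVec (Function.uncurry F) (Sum.inr (Sum.inr k)) =
      dotProduct (Y k) (F.mulVec (X k)) := by
    intro k
    simp [epipolarSystem, Matrix.mulVec, dotProduct, Fintype.sum_prod_type, Function.uncurry,
      Finset.mul_sum, mul_comm, mul_left_comm]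
  rw [funext_iff, Sum.forall, Sum.forall, IsEpipolar, funext_iff, funext_iff]
  simp only [h1, h2, h3]
  tauto

/-- The linear system A for the entries of `F` has a nonzero solution exactly when N * A is singular
for every N, since an injective A has a left inverse. Each of these determinants is polynomial in
the coordinates of the pair. -/
theorem isClosed_cameraCentersVariety (x y : Fin n → P2) :
    IsClosed (cameraCentersVariety x y) := by
  set X := fun i => (x i).rep with hX
  set Y := fun i => (y i).rep with hY
  have h : cameraCentersVariety x y = ⋂ N : Matrix (Fin 3 × Fin 3) (Fin 3 ⊕ Fin 3 ⊕ Fin n) ℂ,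
      {e | ∀ v, RepresentsTuple e v → (N * epipolarSystem X Y v).det = 0} := by
    ext e
    simp only [Set.mem_iInter, Set.mem_ofPred_eq]
    constructor
    · intro he N v hv
      obtain ⟨F, h0, h1, h2⟩ := (mem_cameraCentersVariety_iff (fun i => represents_rep (x i))
        (fun i => represents_rep (y i)) (hv 0) (hv 1)).1 he
      rw [← Matrix.exists_mulVec_eq_zero_iff]
      refine ⟨Function.uncurry F, fun h => h0 ?_, ?_⟩
      · ext i j
        exact congrFun h (i, j)
      · rw [← Matrix.mulVec_mulVec, (epipolarSystem_mulVec_eq_zero_iff X Y v F).2 ⟨h1, h2⟩,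
          Matrix.mulVec_zero]
    · intro h
      by_contra he
      have hv := representsTuple_rep e
      set v := fun k => (e k).rep
      have hker : LinearMap.ker (epipolarSystem X Y v).mulVecLin = ⊥ := by
        rw [LinearMap.ker_eq_bot']
        intro f hf
        by_contra hf0
        apply he
        rw [mem_cameraCentersVariety_iff (fun i => represents_rep (x i))
          (fun i => represents_rep (y i)) (hv 0) (hv 1)]
        have h2 := (epipolarSystem_mulVec_eq_zero_iff X Y v (Matrix.of (Function.curry f))).1
          (by exact hf)
        refine ⟨_, fun h0 => hf0 ?_, h2.1, h2.2⟩
        funext ⟨i, j⟩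
        exact congrFun (congrFun h0 i) j
      obtain ⟨g, hg⟩ := LinearMap.exists_leftInverse_of_injective _ hker
      have h1 := h (LinearMap.toMatrix' g) v hv
      have h2 : LinearMap.toMatrix' g * epipolarSystem X Y v = 1 := by
        rw [← LinearMap.toMatrix'_id, ← hg, LinearMap.toMatrix'_comp,
          ← Matrix.toLin'_apply', LinearMap.toMatrix'_toLin']
      rw [h2, Matrix.det_one] at h1
      exact one_ne_zero h1
  rw [h]
  refine isClosed_iInter fun N => IsPolyFun.isClosed (IsPolyFun.det fun i j => ?_)
  simp only [Matrix.mul_apply]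
  refine IsPolyFun.sum _ fun r _ => (IsPolyFun.const _).mul ?_
  rcases r with k | k | k
  · simp only [epipolarSystem, Matrix.of_apply, Sum.elim_inl]
    split_ifs
    · exact IsPolyFun.coord 0 _
    · exact IsPolyFun.const 0
  · simp only [epipolarSystem, Matrix.of_apply, Sum.elim_inl, Sum.elim_inr]
    split_ifs
    · exact IsPolyFun.coord 1 _
    · exact IsPolyFun.const 0
  · exact IsPolyFun.const _

/-- The space of matrices `F` with `F a = 0` and `yᵢᵀ F xᵢ = 0` for `i ∈ s`. -/
def epipolarMap (X Y : Fin n → Fin 3 → ℂ) (a : Fin 3 → ℂ) (s : Finset (Fin n)) :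
    Matrix (Fin 3) (Fin 3) ℂ →ₗ[ℂ] (Fin 3 → ℂ) × (s → ℂ) where
  toFun F := (F.mulVec a, fun i => dotProduct (Y i) (F.mulVec (X i)))
  map_add' F G := by
    ext
    · simp [Matrix.add_mulVec]
    · simp [Matrix.add_mulVec, dotProduct_add]
  map_smul' c F := by
    ext
    · simp [Matrix.smul_mulVec]
    · simp [Matrix.smul_mulVec, dotProduct_smul]

theorem le_finrank_ker_epipolarMap (X Y : Fin n → Fin 3 → ℂ) (a : Fin 3 → ℂ)
    (s : Finset (Fin n)) :
    9 ≤ 3 + s.card + Module.finrank ℂ (LinearMap.ker (epipolarMap X Y a s)) := by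
  have h1 := LinearMap.finrank_range_add_finrank_ker (epipolarMap X Y a s)
  have h2 := Submodule.finrank_le (LinearMap.range (epipolarMap X Y a s))
  simp [Module.finrank_prod, Module.finrank_matrix] at h1 h2
  omega

theorem exists_left_kernel {F : Matrix (Fin 3) (Fin 3) ℂ} {a : Fin 3 → ℂ} (ha : a ≠ 0)
    (h : F.mulVec a = 0) : ∃ b ≠ 0, F.transpose.mulVec b = 0 := by
  rw [Matrix.exists_mulVec_eq_zero_iff, Matrix.det_transpose, ← Matrix.exists_mulVec_eq_zero_iff]
  exact ⟨a, ha, h⟩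

/-- `F a = 0` and at most five incidences impose at most eight linear conditions on nine entries. A
nonzero solution is singular because `a ≠ 0`, so it also has a left kernel. -/
theorem exists_hasEpipolar {X Y : Fin n → Fin 3 → ℂ} (hn : n ≤ 5) {a : Fin 3 → ℂ} (ha : a ≠ 0) :
    ∃ b ≠ 0, HasEpipolar X Y a b := by
  have h := le_finrank_ker_epipolarMap X Y a Finset.univ
  rw [Finset.card_univ, Fintype.card_fin] at h
  have hpos : 0 < Module.finrank ℂ (LinearMap.ker (epipolarMap X Y a Finset.univ)) := by omega
  obtain ⟨⟨F, hF⟩, hF0⟩ := Module.finrank_pos_iff_exists_ne_zero.1 hpos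
  have hF1 : F ≠ 0 := fun h => hF0 (Subtype.ext h)
  rw [LinearMap.mem_ker, Prod.ext_iff] at hF
  obtain ⟨b, hb, hFb⟩ := exists_left_kernel ha hF.1
  exact ⟨b, hb, F, hF1, ⟨hF.1, fun i => congrFun hF.2 ⟨i, Finset.mem_univ i⟩⟩, hFb⟩

theorem exists_mem_fst_eq (x y : Fin n → P2) (hn : n ≤ 5) (p : P2) :
    ∃ e ∈ cameraCentersVariety x y, e 0 = p := by
  obtain ⟨b, hb, h⟩ := exists_hasEpipolar (X := fun i => (x i).rep) (Y := fun i => (y i).rep) hn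
    p.rep_nonzero
  refine ⟨(![p, Projectivization.mk ℂ b hb] : Fin 2 → P2), ?_, rfl⟩
  exact (mem_cameraCentersVariety_iff (fun i => represents_rep _) (fun i => represents_rep _)
    (represents_rep p) (represents_mk hb)).2 h

theorem exists_mem_snd_eq (x y : Fin n → P2) (hn : n ≤ 5) (p : P2) :
    ∃ e ∈ cameraCentersVariety x y, e 1 = p := by
  obtain ⟨b, hb, h⟩ := exists_hasEpipolar (X := fun i => (y i).rep) (Y := fun i => (x i).rep) hn
    p.rep_nonzero
  refine ⟨(![Projectivization.mk ℂ b hb, p] : Fin 2 → P2), ?_, rfl⟩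
  exact (mem_cameraCentersVariety_iff (fun i => represents_rep _) (fun i => represents_rep _)
    (represents_mk hb) (represents_rep p)).2 h.symm

/-- If `a` is one of the points `X i`, there is a pencil of matrices. -/
theorem exists_isEpipolar_not_smul_of_eq_smul {X Y : Fin n → Fin 3 → ℂ} (hn : n ≤ 5)
    {a : Fin 3 → ℂ} {i : Fin n} {t : ℂ} (hi : X i = t • a) (F : Matrix (Fin 3) (Fin 3) ℂ) :
    ∃ G, IsEpipolar X Y a G ∧ ∀ c : ℂ, G ≠ c • F := by
  -- The `i`-th incidence follows from `F a = 0`. Dropping it leaves at most seven conditions, hence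
  -- at least two independent matrices.
  have h := le_finrank_ker_epipolarMap X Y a (Finset.univ.erase i)
  rw [Finset.card_erase_of_mem (Finset.mem_univ i), Finset.card_univ, Fintype.card_fin] at h
  have hn0 : 0 < n := i.pos
  have hlt : Module.finrank ℂ (Submodule.span ℂ {F}) <
      Module.finrank ℂ (LinearMap.ker (epipolarMap X Y a (Finset.univ.erase i))) := by
    have := finrank_span_le_card (R := ℂ) ({F} : Set (Matrix (Fin 3) (Fin 3) ℂ))
    simp only [Set.toFinset_singleton, Finset.card_singleton] at this
    omega
  obtain ⟨G, hG, hGF⟩ : ∃ G ∈ LinearMap.ker (epipolarMap X Y a (Finset.univ.erase i)),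
      G ∉ Submodule.span ℂ {F} := by
    by_contra! hc
    exact absurd (Submodule.finrank_mono (fun G hG => hc G hG)) (not_le.2 hlt)
  rw [LinearMap.mem_ker, Prod.ext_iff] at hG
  have hGa : G.mulVec a = 0 := hG.1
  refine ⟨G, ⟨hGa, fun j => ?_⟩, fun c hc => hGF ?_⟩
  · by_cases hj : j = i
    · rw [hj, hi, Matrix.mulVec_smul, hGa, smul_zero, dotProduct_zero]
    · exact congrFun hG.2 ⟨j, Finset.mem_erase.2 ⟨hj, Finset.mem_univ j⟩⟩
  · rw [hc]
    exact Submodule.smul_mem _ _ (Submodule.mem_span_singleton_self F)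

/-- A pencil of matrices with kernel `a` sweeps out a conic. -/
theorem exists_conic {X Y : Fin n → Fin 3 → ℂ} {a b : Fin 3 → ℂ} (ha : a ≠ 0)
    {F G : Matrix (Fin 3) (Fin 3) ℂ} (hF0 : F ≠ 0) (hF : IsEpipolar X Y a F)
    (hFb : F.transpose.mulVec b = 0) (hG : IsEpipolar X Y a G) (hGF : ∀ c : ℂ, G ≠ c • F) :
    ∃ Q : MvPolynomial (Fin 3) ℂ, eval b Q = 0 ∧ ∀ w, eval w Q = 0 → HasEpipolar X Y a w := by
  obtain ⟨i, hi⟩ := Function.ne_iff.1 ha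
  let lin : Matrix (Fin 3) (Fin 3) ℂ → Fin 3 → MvPolynomial (Fin 3) ℂ := fun F j =>
    linForm (F.transpose j)
  have hlin : ∀ F w j, eval w (lin F j) = F.transpose.mulVec w j := fun F w j =>
    eval_linForm _ _
  have hev : ∀ w, eval w (crossProduct (lin F) (lin G) i) =
      crossProduct (F.transpose.mulVec w) (G.transpose.mulVec w) i := by
    intro w
    simp only [cross_apply, ← hlin]
    fin_cases i <;> simp
  -- `Fᵀ w` and `Gᵀ w` are orthogonal to a, so their cross product is a multiple of a and vanishes
  -- with its `i`-th coordinate, as `a i ≠ 0`. This one quadratic equation thus makes the two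
  -- vectors dependent, and then a nonzero member of the pencil has w in its left kernel.
  refine ⟨crossProduct (lin F) (lin G) i, ?_, fun w hw => ?_⟩
  · rw [hev, hFb]
    simp
  · rw [hev] at hw
    have horth : ∀ F : Matrix (Fin 3) (Fin 3) ℂ, F.mulVec a = 0 →
        dotProduct (F.transpose.mulVec w) a = 0 := by
      intro F hF
      rw [Matrix.mulVec_transpose, ← Matrix.dotProduct_mulVec, hF, dotProduct_zero]
    have hcross : crossProduct (F.transpose.mulVec w) (G.transpose.mulVec w) = 0 := by
      have h1 : crossProduct a
          (crossProduct (F.transpose.mulVec w) (G.transpose.mulVec w)) = 0 := by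
        rw [cross_cross_eq_smul_sub_smul', horth F hF.1, dotProduct_comm, horth G hG.1]
        simp
      obtain ⟨t, ht⟩ := exists_eq_smul_of_cross_eq_zero ha h1
      rw [ht] at hw ⊢
      rw [(mul_eq_zero.1 hw).resolve_right hi, zero_smul]
    by_cases hFw : F.transpose.mulVec w = 0
    · exact ⟨F, hF0, hF, hFw⟩
    · obtain ⟨t, ht⟩ := exists_eq_smul_of_cross_eq_zero hFw hcross
      refine ⟨G - t • F, fun h => hGF t (sub_eq_zero.1 h), ⟨?_, fun j => ?_⟩, ?_⟩
      · rw [Matrix.sub_mulVec, Matrix.smul_mulVec, hF.1, hG.1]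
        simp
      · rw [Matrix.sub_mulVec, Matrix.smul_mulVec, dotProduct_sub, dotProduct_smul, hF.2, hG.2]
        simp
      · rw [Matrix.transpose_sub, Matrix.transpose_smul, Matrix.sub_mulVec, Matrix.smul_mulVec, ht]
        simp

/-- Linear changes of coordinates in the two planes. -/
theorem hasEpipolar_mulVec_iff {X Y : Fin n → Fin 3 → ℂ} {a b : Fin 3 → ℂ}
    {G H : Matrix (Fin 3) (Fin 3) ℂ} (hG : IsUnit G.det) (hH : IsUnit H.det) :
    HasEpipolar (fun i => G.mulVec (X i)) (fun i => H.mulVec (Y i)) (G.mulVec a) (H.mulVec b) ↔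
      HasEpipolar X Y a b := by
  have key : ∀ {X Y : Fin n → Fin 3 → ℂ} {a b : Fin 3 → ℂ} {G H : Matrix (Fin 3) (Fin 3) ℂ},
      IsUnit G.det → IsUnit H.det →
      HasEpipolar (fun i => G.mulVec (X i)) (fun i => H.mulVec (Y i)) (G.mulVec a) (H.mulVec b) →
      HasEpipolar X Y a b := by
    rintro X Y a b G H hG hH ⟨F, h0, ⟨h1, h2⟩, h3⟩
    refine ⟨H.transpose * F * G, fun h => h0 ?_, ⟨?_, fun i => ?_⟩, ?_⟩
    · have hH' : IsUnit H.transpose.det := by rwa [Matrix.det_transpose]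
      have : H.transpose⁻¹ * (H.transpose * F * G) * G⁻¹ = F := by
        rw [Matrix.mul_assoc, Matrix.mul_assoc, Matrix.mul_nonsing_inv _ hG, Matrix.mul_one,
          Matrix.nonsing_inv_mul_cancel_left _ _ hH']
      rw [← this, h]
      simp
    · rw [← Matrix.mulVec_mulVec, ← Matrix.mulVec_mulVec, h1, Matrix.mulVec_zero]
    · rw [← Matrix.mulVec_mulVec, ← Matrix.mulVec_mulVec, Matrix.mulVec_transpose,
        dotProduct_comm, ← Matrix.dotProduct_mulVec, dotProduct_comm]
      exact h2 i
    · rw [Matrix.transpose_mul, Matrix.transpose_mul, Matrix.transpose_transpose,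
        ← Matrix.mulVec_mulVec, ← Matrix.mulVec_mulVec, h3, Matrix.mulVec_zero]
  refine ⟨key hG hH, fun h => ?_⟩
  apply key (G := G⁻¹) (H := H⁻¹) (Matrix.isUnit_nonsing_inv_det _ hG)
    (Matrix.isUnit_nonsing_inv_det _ hH)
  simpa [Matrix.mulVec_mulVec, Matrix.nonsing_inv_mul _ hG, Matrix.nonsing_inv_mul _ hH] using h

end CameraCenters

/-! ### The quadrics and quintics as identities over a ring -/

section QuinticForms

variable {R S : Type*} [CommRing R] [CommRing S]

/-- The quadratic forms `q₁, q₂, q₃`, over any commutative ring. -/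
def quadrics (ξ η a : Fin 3 → R) : Fin 3 → R :=
  ![η 1 * (a 0 - a 1) * (a 2 * ξ 0 - a 0 * ξ 2) - η 2 * (a 2 - a 0) * (a 0 * ξ 1 - a 1 * ξ 0),
    η 2 * (a 1 - a 2) * (a 0 * ξ 1 - a 1 * ξ 0) - η 0 * (a 0 - a 1) * (a 1 * ξ 2 - a 2 * ξ 1),
    η 0 * (a 2 - a 0) * (a 1 * ξ 2 - a 2 * ξ 1) - η 1 * (a 1 - a 2) * (a 2 * ξ 0 - a 0 * ξ 2)]

/-- The explicit quintic forms, over any commutative ring. -/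
def quintics (ξ η a : Fin 3 → R) : Fin 3 → R :=
  ![a 0 * quadrics ξ η a 1 * quadrics ξ η a 2, a 1 * quadrics ξ η a 0 * quadrics ξ η a 2,
    a 2 * quadrics ξ η a 0 * quadrics ξ η a 1]

theorem quinticMap_eq_quintics (ξ η a : Fin 3 → ℂ) : quinticMap ξ η a = quintics ξ η a := rfl

/-- Naturality in the ring lets the same formula serve as complex values, as forms in three
variables and as restrictions to a line. -/
theorem map_quintics (f : R →+* S) (ξ η a : Fin 3 → R) (i : Fin 3) :
    f (quintics ξ η a i) = quintics (f ∘ ξ) (f ∘ η) (f ∘ a) i := by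
  fin_cases i <;> simp [quintics, quadrics]

theorem quintics_smul (r s t : R) (ξ η a : Fin 3 → R) :
    quintics (r • ξ) (s • η) (t • a) = (r ^ 2 * s ^ 2 * t ^ 5) • quintics ξ η a := by
  funext i
  fin_cases i <;> simp [quintics, quadrics] <;> ring

theorem dot_quadrics_cross_one (ξ η a : Fin 3 → R) :
    quadrics ξ η a 0 * (a 1 - a 2) + quadrics ξ η a 1 * (a 2 - a 0) +
      quadrics ξ η a 2 * (a 0 - a 1) = 0 := by
  simp [quadrics]
  ring

theorem dot_quadrics_mul_cross (ξ η a : Fin 3 → R) :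
    quadrics ξ η a 0 * (η 0 * (a 1 * ξ 2 - a 2 * ξ 1)) +
      quadrics ξ η a 1 * (η 1 * (a 2 * ξ 0 - a 0 * ξ 2)) +
      quadrics ξ η a 2 * (η 2 * (a 0 * ξ 1 - a 1 * ξ 0)) = 0 := by
  simp [quadrics]
  ring

end QuinticForms

/-! ### Standard coordinates: solving for `F` and finding the base points -/

section StandardCoordinates

/-- The standard frame together with a fifth point. -/
def framePoints (ξ : Fin 3 → ℂ) : Fin 5 → Fin 3 → ℂ :=
  ![![1, 0, 0], ![0, 1, 0], ![0, 0, 1], ![1, 1, 1], ξ]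

/-- The matrix with rows `pᵢ (eᵢ × a)`. -/
def rowMatrix (p a : Fin 3 → ℂ) : Matrix (Fin 3) (Fin 3) ℂ :=
  !![0, -(p 0 * a 2), p 0 * a 1; p 1 * a 2, 0, -(p 1 * a 0); -(p 2 * a 1), p 2 * a 0, 0]

theorem isEpipolar_framePoints_iff {ξ η a : Fin 3 → ℂ} {F : Matrix (Fin 3) (Fin 3) ℂ} :
    IsEpipolar (framePoints ξ) (framePoints η) a F ↔
      (F.mulVec a = 0 ∧ F 0 0 = 0 ∧ F 1 1 = 0 ∧ F 2 2 = 0 ∧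
        F 0 0 + F 0 1 + F 0 2 + F 1 0 + F 1 1 + F 1 2 + F 2 0 + F 2 1 + F 2 2 = 0 ∧
        dotProduct η (F.mulVec ξ) = 0) := by
  have h : ∀ i : Fin 5, dotProduct (framePoints η i) (F.mulVec (framePoints ξ i)) =
      (![F 0 0, F 1 1, F 2 2,
        F 0 0 + F 0 1 + F 0 2 + F 1 0 + F 1 1 + F 1 2 + F 2 0 + F 2 1 + F 2 2,
        dotProduct η (F.mulVec ξ)] : Fin 5 → ℂ) i := by
    intro i
    fin_cases i <;>
      simp [framePoints, Matrix.mulVec, dotProduct, Fin.sum_univ_three]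
    ring
  rw [IsEpipolar]
  simp only [h, Fin.forall_fin_succ]
  simp

/-- The rows are orthogonal to a and the diagonal is zero by construction, so only the incidences at
(1,1,1) and at the fifth points remain. -/
theorem isEpipolar_rowMatrix_iff {ξ η a p : Fin 3 → ℂ} :
    IsEpipolar (framePoints ξ) (framePoints η) a (rowMatrix p a) ↔
      (p 0 * (a 1 - a 2) + p 1 * (a 2 - a 0) + p 2 * (a 0 - a 1) = 0 ∧
        p 0 * (η 0 * (a 1 * ξ 2 - a 2 * ξ 1)) + p 1 * (η 1 * (a 2 * ξ 0 - a 0 * ξ 2)) +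
          p 2 * (η 2 * (a 0 * ξ 1 - a 1 * ξ 0)) = 0) := by
  have h0 : (rowMatrix p a).mulVec a = 0 := by
    funext i
    fin_cases i <;> simp [rowMatrix, Matrix.mulVec, dotProduct, Fin.sum_univ_three] <;> ring
  rw [isEpipolar_framePoints_iff, and_iff_right h0]
  simp only [rowMatrix, Matrix.mulVec, dotProduct, Fin.sum_univ_three]
  simp
  refine and_congr ?_ ?_
  · rw [← sub_eq_zero, ← sub_eq_zero (a := _ + _)]
    ring_nf
  · rw [← sub_eq_zero, ← sub_eq_zero (a := _ + _)]
    ring_nf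

theorem exists_eq_neg_mul_of_dot_eq_zero {s t x y : ℂ} (h : s * x + t * y = 0)
    (hxy : x ≠ 0 ∨ y ≠ 0) : ∃ p, s = -(p * y) ∧ t = p * x := by
  rcases hxy with hx | hy
  · refine ⟨t / x, ?_, by field_simp⟩
    field_simp
    linear_combination h
  · refine ⟨-s / y, by field_simp, ?_⟩
    field_simp
    linear_combination h

/-- `a` is not a multiple of a coordinate vector. -/
def OffVertices (a : Fin 3 → ℂ) : Prop :=
  (a 1 ≠ 0 ∨ a 2 ≠ 0) ∧ (a 2 ≠ 0 ∨ a 0 ≠ 0) ∧ (a 0 ≠ 0 ∨ a 1 ≠ 0)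

/-- With zero diagonal, each row has two free entries subject to one equation, whose coefficients
are two coordinates of a. Off the vertices these are not both zero, so the row is determined up to a
scalar. -/
theorem IsEpipolar.exists_rowMatrix {ξ η a : Fin 3 → ℂ} {F : Matrix (Fin 3) (Fin 3) ℂ}
    (hF : IsEpipolar (framePoints ξ) (framePoints η) a F) (ha : OffVertices a) :
    ∃ p, F = rowMatrix p a := by
  obtain ⟨h, h00, h11, h22, -, -⟩ := isEpipolar_framePoints_iff.1 hF
  have r0 := congrFun h 0
  have r1 := congrFun h 1
  have r2 := congrFun h 2
  simp only [Matrix.mulVec, dotProduct, Fin.sum_univ_three, h00, h11, h22, Pi.zero_apply] at r0 r1 r2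
  obtain ⟨p0, h01, h02⟩ := exists_eq_neg_mul_of_dot_eq_zero
    (by linear_combination r0 : F 0 1 * a 1 + F 0 2 * a 2 = 0) ha.1
  obtain ⟨p1, h12, h10⟩ := exists_eq_neg_mul_of_dot_eq_zero
    (by linear_combination r1 : F 1 2 * a 2 + F 1 0 * a 0 = 0) ha.2.1
  obtain ⟨p2, h20, h21⟩ := exists_eq_neg_mul_of_dot_eq_zero
    (by linear_combination r2 : F 2 0 * a 0 + F 2 1 * a 1 = 0) ha.2.2
  refine ⟨![p0, p1, p2], ?_⟩
  ext i j
  fin_cases i <;> fin_cases j <;> simp [rowMatrix, *]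

theorem rowMatrix_injective {a : Fin 3 → ℂ} (ha : OffVertices a) :
    Function.Injective (fun p => rowMatrix p a) := by
  intro p q h
  have e : ∀ i j, rowMatrix p a i j = rowMatrix q a i j := fun i j => congrFun (congrFun h i) j
  have key : ∀ {x y s t : ℂ}, x ≠ 0 ∨ y ≠ 0 → s * x = t * x → s * y = t * y → s = t := by
    rintro x y s t (h | h) h1 h2
    · exact mul_right_cancel₀ h h1
    · exact mul_right_cancel₀ h h2
  funext i
  fin_cases i
  · exact key ha.1 (by simpa [rowMatrix] using e 0 2) (by simpa [rowMatrix] using e 0 1)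
  · exact key ha.2.1 (by simpa [rowMatrix] using e 1 0) (by simpa [rowMatrix] using e 1 2)
  · exact key ha.2.2 (by simpa [rowMatrix] using e 2 1) (by simpa [rowMatrix] using e 2 0)

theorem rowMatrix_smul (c : ℂ) (p a : Fin 3 → ℂ) : rowMatrix (c • p) a = c • rowMatrix p a := by
  ext i j
  fin_cases i <;> fin_cases j <;> simp [rowMatrix] <;> ring

theorem rowMatrix_eq_zero_iff {p a : Fin 3 → ℂ} (ha : OffVertices a) :
    rowMatrix p a = 0 ↔ p = 0 := by
  have h0 : rowMatrix 0 a = 0 := by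
    have := rowMatrix_smul 0 0 a
    simpa using this
  exact ⟨fun h => rowMatrix_injective ha (h.trans h0.symm), fun h => h ▸ h0⟩

/-- Since the rows are pᵢ (eᵢ × a), `Fᵀ b` is the cross product of the vector (pᵢ bᵢ) with a. -/
theorem rowMatrix_transpose_mulVec_eq_zero_iff {p a b : Fin 3 → ℂ} :
    (rowMatrix p a).transpose.mulVec b = 0 ↔
      (p 1 * b 1 * a 2 = p 2 * b 2 * a 1 ∧ p 2 * b 2 * a 0 = p 0 * b 0 * a 2 ∧
        p 0 * b 0 * a 1 = p 1 * b 1 * a 0) := by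
  simp only [funext_iff, Fin.forall_fin_succ, Matrix.mulVec, dotProduct, Fin.sum_univ_three,
    rowMatrix, Matrix.transpose_apply]
  simp
  refine and_congr ?_ (and_congr ?_ ?_)
  · rw [← sub_eq_zero (b := p 2 * b 2 * a 1)]; ring_nf
  · rw [← sub_eq_zero (b := p 0 * b 0 * a 2)]; ring_nf
  · rw [← sub_eq_zero (b := p 1 * b 1 * a 0)]; ring_nf

theorem offVertices_of_quintics_ne_zero {ξ η a : Fin 3 → ℂ} (h : quintics ξ η a ≠ 0) :
    OffVertices a := by
  by_contra hc
  apply h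
  unfold OffVertices at hc
  rw [not_and_or, not_and_or] at hc
  push Not at hc
  funext i
  rcases hc with hc | hc | hc <;> obtain ⟨h1, h2⟩ := hc <;> fin_cases i <;>
    simp [quintics, quadrics, h1, h2]

theorem quadrics_ne_zero_of_quintics_ne_zero {ξ η a : Fin 3 → ℂ} (h : quintics ξ η a ≠ 0) :
    quadrics ξ η a ≠ 0 := by
  intro h0
  apply h
  funext i
  fin_cases i <;> simp [quintics, h0]

theorem hasEpipolar_quintics {ξ η a : Fin 3 → ℂ} (h : quintics ξ η a ≠ 0) :
    HasEpipolar (framePoints ξ) (framePoints η) a (quintics ξ η a) := by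
  have hq := quadrics_ne_zero_of_quintics_ne_zero h
  refine ⟨rowMatrix (quadrics ξ η a) a, fun h0 => hq
    ((rowMatrix_eq_zero_iff (offVertices_of_quintics_ne_zero h)).1 h0),
    isEpipolar_rowMatrix_iff.2 ⟨dot_quadrics_cross_one ξ η a, dot_quadrics_mul_cross ξ η a⟩, ?_⟩
  rw [rowMatrix_transpose_mulVec_eq_zero_iff]
  refine ⟨?_, ?_, ?_⟩ <;> simp [quintics] <;> ring

/-- p is orthogonal to two vectors whose cross product q is nonzero, so it lies on the line spanned
by q. -/
theorem exists_eq_smul_quadrics {ξ η a p : Fin 3 → ℂ} (hq : quadrics ξ η a ≠ 0)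
    (h1 : p 0 * (a 1 - a 2) + p 1 * (a 2 - a 0) + p 2 * (a 0 - a 1) = 0)
    (h2 : p 0 * (η 0 * (a 1 * ξ 2 - a 2 * ξ 1)) + p 1 * (η 1 * (a 2 * ξ 0 - a 0 * ξ 2)) +
      p 2 * (η 2 * (a 0 * ξ 1 - a 1 * ξ 0)) = 0) : ∃ c : ℂ, p = c • quadrics ξ η a := by
  apply exists_eq_smul_of_cross_eq_zero hq
  rw [cross_apply]
  funext i
  fin_cases i
  · simp [quadrics]
    linear_combination (η 0 * (a 1 * ξ 2 - a 2 * ξ 1)) * h1 * (-1) + (a 1 - a 2) * h2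
  · simp [quadrics]
    linear_combination (η 1 * (a 2 * ξ 0 - a 0 * ξ 2)) * h1 * (-1) + (a 2 - a 0) * h2
  · simp [quadrics]
    linear_combination (η 2 * (a 0 * ξ 1 - a 1 * ξ 0)) * h1 * (-1) + (a 0 - a 1) * h2

theorem cross_quintics_eq_zero_of_hasEpipolar {ξ η a b : Fin 3 → ℂ} (h : quintics ξ η a ≠ 0)
    (hab : HasEpipolar (framePoints ξ) (framePoints η) a b) :
    crossProduct (quintics ξ η a) b = 0 := by
  have ha := offVertices_of_quintics_ne_zero h
  obtain ⟨F, hF0, hF, hFb⟩ := hab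
  obtain ⟨p, rfl⟩ := hF.exists_rowMatrix ha
  obtain ⟨h1, h2⟩ := isEpipolar_rowMatrix_iff.1 hF
  obtain ⟨c, rfl⟩ := exists_eq_smul_quadrics (quadrics_ne_zero_of_quintics_ne_zero h) h1 h2
  have hc : c ≠ 0 := by
    rintro rfl
    exact hF0 (by rw [zero_smul, rowMatrix_eq_zero_iff ha])
  obtain ⟨e0, e1, e2⟩ := rowMatrix_transpose_mulVec_eq_zero_iff.1 hFb
  simp only [Pi.smul_apply, smul_eq_mul, mul_assoc] at e0 e1 e2
  replace e0 := mul_left_cancel₀ hc e0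
  replace e1 := mul_left_cancel₀ hc e1
  replace e2 := mul_left_cancel₀ hc e2
  rw [cross_apply]
  funext i
  fin_cases i
  · simp [quintics]
    linear_combination (-quadrics ξ η a 0) * e0
  · simp [quintics]
    linear_combination (-quadrics ξ η a 1) * e1
  · simp [quintics]
    linear_combination (-quadrics ξ η a 2) * e2

/-- The sixth base point, for fifth points `ξ` and `η`. -/
def sixthPoint (ξ η : Fin 3 → ℂ) : Fin 3 → ℂ :=
  crossProduct (crossProduct η ξ) (η * crossProduct η ξ)

/-- The fifth points are in sufficiently general position with respect to the frame. -/
structure GeneralPosition (ξ η : Fin 3 → ℂ) : Prop where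
  left_ne_zero : ∀ i, ξ i ≠ 0
  right_ne_zero : ∀ i, η i ≠ 0
  left_injective : Function.Injective ξ
  right_injective : Function.Injective η
  sixthPoint_ne_zero : sixthPoint ξ η ≠ 0

/-- The six base points of the quintic map. -/
def basePoints (ξ η : Fin 3 → ℂ) : Fin 6 → Fin 3 → ℂ :=
  ![![1, 0, 0], ![0, 1, 0], ![0, 0, 1], ![1, 1, 1], ξ, sixthPoint ξ η]

/-- If two quadrics vanish, the two linear relations between the quadrics kill the third. If only qᵢ
vanishes, the i-th quintic forces aᵢ = 0, but off the vertices qᵢ has no zero on that side of the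
triangle. If none vanishes, then a = 0. -/
theorem quadrics_eq_zero_of_offVertices {ξ η a : Fin 3 → ℂ} (h : GeneralPosition ξ η)
    (h0 : quintics ξ η a = 0) (hoff : OffVertices a) : quadrics ξ η a = 0 := by
  have hξ := h.left_injective
  have hη := h.right_injective
  have e0 : a 0 * quadrics ξ η a 1 * quadrics ξ η a 2 = 0 := congrFun h0 0
  have e1 : a 1 * quadrics ξ η a 0 * quadrics ξ η a 2 = 0 := congrFun h0 1
  have e2 : a 2 * quadrics ξ η a 0 * quadrics ξ η a 1 = 0 := congrFun h0 2
  have d1 := dot_quadrics_cross_one ξ η a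
  have d2 := dot_quadrics_mul_cross ξ η a
  -- two of the quadrics determine the third
  have third : ∀ {q r x y s t : ℂ}, q * (x - y) = 0 → q * (r * (x * t - y * s)) = 0 → r ≠ 0 →
      s ≠ t → (x ≠ 0 ∨ y ≠ 0) → q = 0 := by
    intro q r x y s t h1 h2 hr hst hxy
    by_contra hq
    have hx : x = y := sub_eq_zero.1 ((mul_eq_zero.1 h1).resolve_left hq)
    have h3 := (mul_eq_zero.1 ((mul_eq_zero.1 h2).resolve_left hq)).resolve_left hr
    rw [hx, ← mul_sub] at h3
    have hy := (mul_eq_zero.1 h3).resolve_right (sub_ne_zero.2 hst.symm)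
    rw [hx, hy] at hxy
    simp at hxy
  have t0 : quadrics ξ η a 1 = 0 → quadrics ξ η a 2 = 0 → quadrics ξ η a 0 = 0 := by
    intro h1 h2
    rw [h1, h2] at d1 d2
    exact third (by linear_combination d1) (by linear_combination d2) (h.right_ne_zero 0)
      (hξ.ne (by decide : (1 : Fin 3) ≠ 2)) hoff.1
  have t1 : quadrics ξ η a 2 = 0 → quadrics ξ η a 0 = 0 → quadrics ξ η a 1 = 0 := by
    intro h1 h2
    rw [h1, h2] at d1 d2
    exact third (by linear_combination d1) (by linear_combination d2) (h.right_ne_zero 1)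
      (hξ.ne (by decide : (2 : Fin 3) ≠ 0)) hoff.2.1
  have t2 : quadrics ξ η a 0 = 0 → quadrics ξ η a 1 = 0 → quadrics ξ η a 2 = 0 := by
    intro h1 h2
    rw [h1, h2] at d1 d2
    exact third (by linear_combination d1) (by linear_combination d2) (h.right_ne_zero 2)
      (hξ.ne (by decide : (0 : Fin 3) ≠ 1)) hoff.2.2
  -- on a side of the triangle, the corresponding quadric vanishes at the vertices only
  have side : ∀ {x y r s t : ℂ}, x * y * (r * (s - t)) = 0 → r ≠ 0 → s ≠ t → x = 0 ∨ y = 0 := by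
    intro x y r s t h1 hr hst
    exact mul_eq_zero.1 ((mul_eq_zero.1 h1).resolve_right (mul_ne_zero hr (sub_ne_zero.2 hst)))
  have s0 : quadrics ξ η a 0 = 0 → a 0 ≠ 0 := by
    intro hq ha0
    simp only [quadrics, Matrix.cons_val_zero, ha0] at hq
    rcases side (by linear_combination hq : a 1 * a 2 * (ξ 0 * (η 2 - η 1)) = 0)
      (h.left_ne_zero 0) (hη.ne (by decide : (2 : Fin 3) ≠ 1)) with h1 | h1
    · exact hoff.2.2.elim (fun h => h ha0) (fun h => h h1)
    · exact hoff.2.1.elim (fun h => h h1) (fun h => h ha0)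
  have s1 : quadrics ξ η a 1 = 0 → a 1 ≠ 0 := by
    intro hq ha0
    simp only [quadrics, Matrix.cons_val_one, Matrix.cons_val_zero, ha0] at hq
    rcases side (by linear_combination hq : a 0 * a 2 * (ξ 1 * (η 0 - η 2)) = 0)
      (h.left_ne_zero 1) (hη.ne (by decide : (0 : Fin 3) ≠ 2)) with h1 | h1
    · exact hoff.2.2.elim (fun h => h h1) (fun h => h ha0)
    · exact hoff.1.elim (fun h => h ha0) (fun h => h h1)
  have s2 : quadrics ξ η a 2 = 0 → a 2 ≠ 0 := by
    intro hq ha0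
    simp only [quadrics, Matrix.cons_val, ha0] at hq
    rcases side (by linear_combination hq : a 0 * a 1 * (ξ 2 * (η 1 - η 0)) = 0)
      (h.left_ne_zero 2) (hη.ne (by decide : (1 : Fin 3) ≠ 0)) with h1 | h1
    · exact hoff.2.1.elim (fun h => h ha0) (fun h => h h1)
    · exact hoff.1.elim (fun h => h h1) (fun h => h ha0)
  have hall : quadrics ξ η a 0 = 0 ∧ quadrics ξ η a 1 = 0 ∧ quadrics ξ η a 2 = 0 := by
    by_cases h0 : quadrics ξ η a 0 = 0
    · by_cases h1 : quadrics ξ η a 1 = 0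
      · exact ⟨h0, h1, t2 h0 h1⟩
      · by_cases h2 : quadrics ξ η a 2 = 0
        · exact ⟨h0, t1 h2 h0, h2⟩
        · exact absurd e0 (mul_ne_zero (mul_ne_zero (s0 h0) h1) h2)
    · by_cases h1 : quadrics ξ η a 1 = 0
      · by_cases h2 : quadrics ξ η a 2 = 0
        · exact ⟨t0 h1 h2, h1, h2⟩
        · exact absurd e1 (mul_ne_zero (mul_ne_zero (s1 h1) h0) h2)
      · by_cases h2 : quadrics ξ η a 2 = 0
        · exact absurd e2 (mul_ne_zero (mul_ne_zero (s2 h2) h0) h1)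
        · have a0 := (mul_eq_zero.1 ((mul_eq_zero.1 e0).resolve_right h2)).resolve_right h1
          have a1 := (mul_eq_zero.1 ((mul_eq_zero.1 e1).resolve_right h2)).resolve_right h0
          exact absurd hoff.2.2 (by simp [a0, a1])
  funext i
  fin_cases i
  · exact hall.1
  · exact hall.2.1
  · exact hall.2.2

theorem quadrics_eq_cross (ξ η a : Fin 3 → ℂ) :
    quadrics ξ η a = crossProduct (η * crossProduct a ξ) (crossProduct a 1) := by
  simp only [cross_apply]
  funext i
  fin_cases i <;> simp [quadrics] <;> ring

theorem exists_eq_smul_of_not_offVertices {a : Fin 3 → ℂ} (hoff : ¬ OffVertices a)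
    (ξ : Fin 3 → ℂ) : ∃ (i : Fin 3) (t : ℂ), a = t • framePoints ξ (i.castAdd 2) := by
  unfold OffVertices at hoff
  rw [not_and_or, not_and_or] at hoff
  push Not at hoff
  rcases hoff with ⟨h1, h2⟩ | ⟨h1, h2⟩ | ⟨h1, h2⟩
  · refine ⟨0, a 0, funext fun i => ?_⟩
    fin_cases i <;> simp [framePoints, h1, h2]
  · refine ⟨1, a 1, funext fun i => ?_⟩
    fin_cases i <;> simp [framePoints, h1, h2]
  · refine ⟨2, a 2, funext fun i => ?_⟩
    fin_cases i <;> simp [framePoints, h1, h2]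

/-- Put u = a × 1 and w = a × ξ, both nonzero in the remaining case. Then q = 0 makes u a nonzero
multiple of η * w. Pairing with 1 gives η · w = 0, so w is a multiple of k = η × ξ. Now a is
orthogonal to k and to η * k, hence parallel to their cross product, the sixth point. -/
theorem exists_eq_smul_of_quadrics_eq_zero {ξ η a : Fin 3 → ℂ} (h : GeneralPosition ξ η)
    (h0 : quadrics ξ η a = 0) :
    (∃ t : ℂ, a = t • 1) ∨ (∃ t : ℂ, a = t • ξ) ∨ ∃ t : ℂ, a = t • sixthPoint ξ η := by
  by_cases hu : crossProduct a 1 = 0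
  · left
    apply exists_eq_smul_of_cross_eq_zero one_ne_zero
    rw [← cross_anticomm, hu, neg_zero]
  by_cases hw : crossProduct a ξ = 0
  · right; left
    apply exists_eq_smul_of_cross_eq_zero (fun h1 => h.left_ne_zero 0 (congrFun h1 0))
    rw [← cross_anticomm, hw, neg_zero]
  right; right
  rw [quadrics_eq_cross] at h0
  set u := crossProduct a 1 with hu'
  set w := crossProduct a ξ with hw'
  have hηw : η * w ≠ 0 := by
    intro h1
    apply hw
    funext i
    exact (mul_eq_zero.1 (congrFun h1 i)).resolve_left (h.right_ne_zero i)
  obtain ⟨s, hs⟩ := exists_eq_smul_of_cross_eq_zero hηw h0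
  have hs0 : s ≠ 0 := by
    rintro rfl
    exact hu (by rw [hs, zero_smul])
  set k := crossProduct η ξ with hk'
  have hk : k ≠ 0 := by
    intro h1
    apply h.sixthPoint_ne_zero
    rw [sixthPoint, ← hk', h1]
    simp
  have h1 : dotProduct η w = 0 := by
    have h2 : dotProduct 1 u = 0 := by rw [hu', dot_cross_self]
    rw [hs, dotProduct_smul, smul_eq_zero] at h2
    have h3 := h2.resolve_left hs0
    simpa [dotProduct] using h3
  have h2 : dotProduct ξ w = 0 := by rw [hw', dot_cross_self]
  obtain ⟨c, hc⟩ : ∃ c : ℂ, w = c • k := by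
    apply exists_eq_smul_of_cross_eq_zero hk
    rw [hk', cross_cross_eq_smul_sub_smul, h1, h2]
    simp
  have hc0 : c ≠ 0 := by
    rintro rfl
    exact hw (by rw [hc, zero_smul])
  have hka : dotProduct k a = 0 := by
    have h3 : dotProduct w a = 0 := by rw [hw', dotProduct_comm, dot_self_cross]
    rw [hc, smul_dotProduct, smul_eq_zero] at h3
    exact h3.resolve_left hc0
  have hηka : dotProduct (η * k) a = 0 := by
    have h3 : dotProduct u a = 0 := by rw [hu', dotProduct_comm, dot_self_cross]
    rw [hs, hc, mul_smul_comm, smul_smul, smul_dotProduct, smul_eq_zero] at h3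
    exact h3.resolve_left (mul_ne_zero hs0 hc0)
  apply exists_eq_smul_of_cross_eq_zero h.sixthPoint_ne_zero
  rw [sixthPoint, ← hk', cross_cross_eq_smul_sub_smul, hka, hηka]
  simp

theorem exists_eq_smul_basePoints {ξ η a : Fin 3 → ℂ} (h : GeneralPosition ξ η)
    (h0 : quintics ξ η a = 0) : ∃ (j : Fin 6) (t : ℂ), a = t • basePoints ξ η j := by
  by_cases hoff : OffVertices a
  · rcases exists_eq_smul_of_quadrics_eq_zero h (quadrics_eq_zero_of_offVertices h h0 hoff) with
      ⟨t, ht⟩ | ⟨t, ht⟩ | ⟨t, ht⟩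
    · refine ⟨3, t, ?_⟩
      rw [ht]
      congr 1
      funext i
      fin_cases i <;> simp [basePoints]
    · exact ⟨4, t, ht⟩
    · exact ⟨5, t, ht⟩
  · obtain ⟨i, t, ht⟩ := exists_eq_smul_of_not_offVertices hoff ξ
    refine ⟨i.castAdd 3, t, ?_⟩
    rw [ht]
    congr 1
    fin_cases i <;> rfl

/-- Off the vertices q = 0, so the two conditions on p are dependent and follow from a single
equation, which has two independent solutions. At a vertex one incidence is redundant and the
dimension count gains one. -/
theorem exists_isEpipolar_not_smul_of_quintics_eq_zero {ξ η a : Fin 3 → ℂ}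
    (h : GeneralPosition ξ η) (ha : a ≠ 0) (h0 : quintics ξ η a = 0)
    (F : Matrix (Fin 3) (Fin 3) ℂ) :
    ∃ G, IsEpipolar (framePoints ξ) (framePoints η) a G ∧ ∀ c : ℂ, G ≠ c • F := by
  by_cases hoff : OffVertices a
  · have hq := quadrics_eq_zero_of_offVertices h h0 hoff
    rw [quadrics_eq_cross] at hq
    obtain ⟨n, hn⟩ : ∃ n : Fin 3 → ℂ, ∀ p, dotProduct p n = 0 →
        dotProduct p (crossProduct a 1) = 0 ∧ dotProduct p (η * crossProduct a ξ) = 0 := by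
      by_cases hw : η * crossProduct a ξ = 0
      · exact ⟨crossProduct a 1, fun p hp => ⟨hp, by rw [hw, dotProduct_zero]⟩⟩
      · obtain ⟨t, ht⟩ := exists_eq_smul_of_cross_eq_zero hw hq
        refine ⟨_, fun p hp => ⟨?_, hp⟩⟩
        rw [ht, dotProduct_smul, hp, smul_zero]
    have hrow : ∀ p, dotProduct p n = 0 →
        IsEpipolar (framePoints ξ) (framePoints η) a (rowMatrix p a) := by
      intro p hp
      obtain ⟨h1, h2⟩ := hn p hp
      rw [isEpipolar_rowMatrix_iff]
      simp only [cross_apply, dotProduct, Fin.sum_univ_three] at h1 h2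
      simp at h1 h2
      exact ⟨h1, h2⟩
    obtain ⟨l, m, -, hm, hln, hmn, hlm⟩ := exists_pair_dot_eq_zero n
    by_contra! hc
    obtain ⟨c, hcl⟩ := hc _ (hrow l hln)
    obtain ⟨d, hdm⟩ := hc _ (hrow m hmn)
    have hd : d ≠ 0 := by
      rintro rfl
      rw [zero_smul, rowMatrix_eq_zero_iff hoff] at hdm
      exact hm hdm
    apply hlm (c * d⁻¹)
    apply rowMatrix_injective hoff
    simp only [rowMatrix_smul, hcl, hdm, smul_smul]
    rw [mul_assoc, inv_mul_cancel₀ hd, mul_one]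
  · obtain ⟨i, t, ht⟩ := exists_eq_smul_of_not_offVertices hoff ξ
    have ht0 : t ≠ 0 := by
      rintro rfl
      exact ha (by rw [ht, zero_smul])
    refine exists_isEpipolar_not_smul_of_eq_smul le_rfl (i := i.castAdd 2) (t := t⁻¹) ?_ F
    rw [ht, smul_smul, inv_mul_cancel₀ ht0, one_smul]

end StandardCoordinates

/-! ### The quintic map in arbitrary coordinates -/

section QuinticPlaneMap

/-- By the pigeonhole principle, two of the infinitely many points (0,1,s) would be multiples of the
same base point. -/
theorem exists_quintics_ne_zero {ξ η : Fin 3 → ℂ} (h : GeneralPosition ξ η) :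
    ∃ a, quintics ξ η a ≠ 0 := by
  by_contra! hc
  choose j t ht using fun s : ℂ => exists_eq_smul_basePoints h (hc ![0, 1, s])
  obtain ⟨s, s', hne, hs⟩ := Finite.exists_ne_map_eq_of_infinite j
  have h1 := ht s
  have h2 := ht s'
  rw [← hs] at h2
  have e1 := congrFun h1 1
  have e2 := congrFun h2 1
  have f1 := congrFun h1 2
  have f2 := congrFun h2 2
  simp only [Matrix.cons_val, Pi.smul_apply, smul_eq_mul] at e1 e2 f1 f2
  have hB : basePoints ξ η (j s) 1 ≠ 0 := fun h0 => by simp [h0] at e1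
  have htt : t s = t s' := mul_right_cancel₀ hB (e1.symm.trans e2)
  exact hne (by rw [f1, f2, htt])

theorem mulVec_inv_mulVec {G : Matrix (Fin 3) (Fin 3) ℂ} (hG : IsUnit G.det) (v : Fin 3 → ℂ) :
    G.mulVec (G⁻¹.mulVec v) = v := by
  rw [Matrix.mulVec_mulVec, Matrix.mul_nonsing_inv _ hG, Matrix.one_mulVec]

theorem inv_mulVec_mulVec {G : Matrix (Fin 3) (Fin 3) ℂ} (hG : IsUnit G.det) (v : Fin 3 → ℂ) :
    G⁻¹.mulVec (G.mulVec v) = v := by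
  rw [Matrix.mulVec_mulVec, Matrix.nonsing_inv_mul _ hG, Matrix.one_mulVec]

theorem mulVec_eq_zero_iff {G : Matrix (Fin 3) (Fin 3) ℂ} (hG : IsUnit G.det) {v : Fin 3 → ℂ} :
    G.mulVec v = 0 ↔ v = 0 :=
  ⟨fun h => by rw [← inv_mulVec_mulVec hG v, h, Matrix.mulVec_zero],
    fun h => by rw [h, Matrix.mulVec_zero]⟩

/-- The quintic forms in the coordinates given by `G` and `H`. -/
noncomputable def quinticForm (ξ η : Fin 3 → ℂ) (G H : Matrix (Fin 3) (Fin 3) ℂ) (i : Fin 3) :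
    MvPolynomial (Fin 3) ℂ :=
  ∑ j, C (H i j) * quintics (C ∘ ξ) (C ∘ η) (fun k => linForm (G⁻¹ k)) j

theorem eval_quinticForm (ξ η : Fin 3 → ℂ) (G H : Matrix (Fin 3) (Fin 3) ℂ) (i : Fin 3)
    (v : Fin 3 → ℂ) :
    eval v (quinticForm ξ η G H i) = H.mulVec (quintics ξ η (G⁻¹.mulVec v)) i := by
  simp only [quinticForm, map_sum, map_mul, eval_C, map_quintics, Matrix.mulVec, dotProduct]
  refine Finset.sum_congr rfl fun j _ => ?_
  congr 2
  · funext k; simp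
  · funext k; simp
  · funext k
    exact eval_linForm _ _

theorem isHomogeneous_linForm (l : Fin 3 → ℂ) : (linForm l).IsHomogeneous 1 :=
  IsHomogeneous.sum _ _ _ fun i _ => by
    simpa using (isHomogeneous_C (Fin 3) (l i)).mul (isHomogeneous_X ℂ i)

theorem isHomogeneous_quinticForm (ξ η : Fin 3 → ℂ) (G H : Matrix (Fin 3) (Fin 3) ℂ) (i : Fin 3) :
    (quinticForm ξ η G H i).IsHomogeneous 5 := by
  have hC : ∀ c : ℂ, (C c : MvPolynomial (Fin 3) ℂ).IsHomogeneous 0 := isHomogeneous_C (Fin 3)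
  have hL : ∀ k, (linForm (G⁻¹ k)).IsHomogeneous 1 := fun k => isHomogeneous_linForm _
  have hq : ∀ j, (quadrics (C ∘ ξ) (C ∘ η) (fun k => linForm (G⁻¹ k)) j).IsHomogeneous 2 := by
    have key : ∀ (c : ℂ) (i j k l : Fin 3) (s t : ℂ), (C c * (linForm (G⁻¹ i) - linForm (G⁻¹ j)) *
        (linForm (G⁻¹ k) * C s - linForm (G⁻¹ l) * C t)).IsHomogeneous 2 :=
      fun c i j k l s t => ((hC c).mul ((hL i).sub (hL j))).mul
        (((hL k).mul (hC s)).sub ((hL l).mul (hC t)))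
    intro j
    fin_cases j
    · exact (key _ 0 1 2 0 _ _).sub (key _ 2 0 0 1 _ _)
    · exact (key _ 1 2 0 1 _ _).sub (key _ 0 1 1 2 _ _)
    · exact (key _ 2 0 1 2 _ _).sub (key _ 1 2 2 0 _ _)
  refine IsHomogeneous.sum _ _ _ fun j _ => ?_
  have : (quintics (C ∘ ξ) (C ∘ η) (fun k => linForm (G⁻¹ k)) j).IsHomogeneous 5 := by
    fin_cases j
    · exact ((hL 0).mul (hq 1)).mul (hq 2)
    · exact ((hL 1).mul (hq 0)).mul (hq 2)
    · exact ((hL 2).mul (hq 0)).mul (hq 1)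
  simpa using (hC (H i j)).mul this

theorem finite_setOf_represents {ι : Type*} [Finite ι] (v : ι → Fin 3 → ℂ) :
    {p : P2 | ∃ j, Represents p (v j)}.Finite := by
  have h : {p : P2 | ∃ j, Represents p (v j)} = ⋃ j, {p | Represents p (v j)} := by
    ext p
    simp
  rw [h]
  exact Set.finite_iUnion fun j => Set.Subsingleton.finite fun p hp q hq => hp.unique hq

theorem represents_basePoints_of_quintics_eq_zero {ξ η : Fin 3 → ℂ} (h : GeneralPosition ξ η)
    {G : Matrix (Fin 3) (Fin 3) ℂ} (hG : IsUnit G.det) {p : P2} {v : Fin 3 → ℂ}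
    (hv : Represents p v) (h0 : quintics ξ η (G⁻¹.mulVec v) = 0) :
    ∃ j, Represents p (G.mulVec (basePoints ξ η j)) := by
  obtain ⟨j, t, ht⟩ := exists_eq_smul_basePoints h h0
  have hv' : v = t • G.mulVec (basePoints ξ η j) := by
    rw [← Matrix.mulVec_smul, ← ht, mulVec_inv_mulVec hG]
  have ht0 : t ≠ 0 := by
    rintro rfl
    exact hv.ne_zero (by rw [hv', zero_smul])
  exact ⟨j, (Represents.congr_smul ht0 hv').1 hv⟩

/-- The quintic map in the coordinates given by `G` and `H`. -/
noncomputable def quinticPlaneMap {ξ η : Fin 3 → ℂ} (h : GeneralPosition ξ η)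
    {G H : Matrix (Fin 3) (Fin 3) ℂ} (hG : IsUnit G.det) (hH : IsUnit H.det) :
    PlaneRationalMap where
  degree := 5
  form := quinticForm ξ η G H
  homogeneous := isHomogeneous_quinticForm ξ η G H
  reduced := fun q hq => by
    have hzero : ∀ v, (∀ i, eval v (quinticForm ξ η G H i) = 0) →
        quintics ξ η (G⁻¹.mulVec v) = 0 := by
      intro v hv
      rw [← mulVec_eq_zero_iff hH]
      funext i
      rw [← eval_quinticForm, hv i]
      rfl
    refine isUnit_of_dvd_of_finite ?_
      (finite_setOf_represents fun j => G.mulVec (basePoints ξ η j)) (fun v hv h0 => ?_) hq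
    · obtain ⟨a, ha⟩ := exists_quintics_ne_zero h
      by_contra! hc
      apply ha
      have := hzero (G.mulVec a) fun i => by rw [hc i, map_zero]
      rwa [inv_mulVec_mulVec hG] at this
    · exact represents_basePoints_of_quintics_eq_zero h hG (represents_mk hv) (hzero v h0)

variable {ξ η : Fin 3 → ℂ} (h : GeneralPosition ξ η) {G H : Matrix (Fin 3) (Fin 3) ℂ}
  (hG : IsUnit G.det) (hH : IsUnit H.det)

theorem quinticPlaneMap_evalVec (v : Fin 3 → ℂ) :
    (quinticPlaneMap h hG hH).evalVec v = H.mulVec (quintics ξ η (G⁻¹.mulVec v)) := by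
  funext i
  exact eval_quinticForm ξ η G H i v

theorem mem_quinticPlaneMap_domain_iff {p : P2} {v : Fin 3 → ℂ} (hv : Represents p v) :
    p ∈ (quinticPlaneMap h hG hH).domain ↔ quintics ξ η (G⁻¹.mulVec v) ≠ 0 := by
  rw [PlaneRationalMap.mem_domain_iff _ hv, quinticPlaneMap_evalVec, Ne, mulVec_eq_zero_iff hH]

theorem finite_compl_quinticPlaneMap_domain : ((quinticPlaneMap h hG hH).domain)ᶜ.Finite := by
  refine (finite_setOf_represents fun j => G.mulVec (basePoints ξ η j)).subset fun p hp => ?_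
  rw [Set.mem_compl_iff, mem_quinticPlaneMap_domain_iff h hG hH (represents_rep p), not_not] at hp
  exact represents_basePoints_of_quintics_eq_zero h hG (represents_rep p) hp

theorem quinticPlaneMap_sends_iff {p q : P2} {v w : Fin 3 → ℂ} (hv : Represents p v)
    (hw : Represents q w) (h0 : quintics ξ η (G⁻¹.mulVec v) ≠ 0) :
    (quinticPlaneMap h hG hH).Sends p q ↔
      HasEpipolar (framePoints ξ) (framePoints η) (G⁻¹.mulVec v) (H⁻¹.mulVec w) := by
  rw [PlaneRationalMap.sends_iff _ hv, quinticPlaneMap_evalVec]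
  constructor
  · intro hs
    obtain ⟨t, _, ht⟩ := hs.exists_smul hw
    rw [ht, Matrix.mulVec_smul, inv_mulVec_mulVec hH]
    obtain ⟨F, hF0, hF, hFb⟩ := hasEpipolar_quintics h0
    exact ⟨F, hF0, hF, by rw [Matrix.mulVec_smul, hFb, smul_zero]⟩
  · intro hs
    obtain ⟨t, ht⟩ := exists_eq_smul_of_cross_eq_zero h0
      (cross_quintics_eq_zero_of_hasEpipolar h0 hs)
    have hw' : w = t • H.mulVec (quintics ξ η (G⁻¹.mulVec v)) := by
      rw [← Matrix.mulVec_smul, ← ht, mulVec_inv_mulVec hH]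
    have ht0 : t ≠ 0 := by
      rintro rfl
      exact hw.ne_zero (by rw [hw', zero_smul])
    exact (Represents.congr_smul ht0 hw').1 hw

end QuinticPlaneMap

/-! ### The camera centers variety is a birational correspondence -/

theorem GeneralPosition.isBirationalCorrespondence {ξ η : Fin 3 → ℂ} (h : GeneralPosition ξ η)
    (h' : GeneralPosition η ξ) (hcomp : ∃ a, quintics η ξ (quintics ξ η a) ≠ 0)
    {G H : Matrix (Fin 3) (Fin 3) ℂ} (hG : IsUnit G.det) (hH : IsUnit H.det)
    {x y : Fin 5 → P2} (hx : ∀ i, Represents (x i) (G.mulVec (framePoints ξ i)))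
    (hy : ∀ i, Represents (y i) (H.mulVec (framePoints η i))) :
    IsBirationalCorrespondence (cameraCentersVariety x y)
      ![quinticPlaneMap h hG hH, quinticPlaneMap h' hH hG] := by
  have hmem : ∀ {e : MultiP2 (Fin 2)} {v w}, Represents (e 0) v → Represents (e 1) w →
      (e ∈ cameraCentersVariety x y ↔
        HasEpipolar (framePoints ξ) (framePoints η) (G⁻¹.mulVec v) (H⁻¹.mulVec w)) := by
    intro e v w hv hw
    rw [← mulVec_inv_mulVec hG v] at hv
    rw [← mulVec_inv_mulVec hH w] at hw
    rw [mem_cameraCentersVariety_iff hx hy hv hw, hasEpipolar_mulVec_iff hG hH]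
  refine ⟨isClosed_cameraCentersVariety x y, ?_, ?_, ?_, ?_⟩
  · intro k e he
    have h0 := represents_rep (e 0)
    have h1 := represents_rep (e 1)
    rw [hmem h0 h1]
    fin_cases k
    · exact (quinticPlaneMap_sends_iff h hG hH h0 h1
        ((mem_quinticPlaneMap_domain_iff h hG hH h0).1 he)).symm
    -- Transposing `F` swaps the two planes, so the second map is the first one with ξ, η and `G`,
    -- `H` exchanged.
    · refine Iff.trans ⟨HasEpipolar.symm, HasEpipolar.symm⟩
        (quinticPlaneMap_sends_iff h' hH hG h1 h0
          ((mem_quinticPlaneMap_domain_iff h' hH hG h1).1 he)).symm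
  · intro k
    fin_cases k
    · exact finite_compl_quinticPlaneMap_domain h hG hH
    · exact finite_compl_quinticPlaneMap_domain h' hH hG
  · intro e he h0
    have hr0 := represents_rep (e 0)
    have hr1 := represents_rep (e 1)
    have hq : quintics ξ η (G⁻¹.mulVec (e 0).rep) = 0 :=
      not_not.1 (mt (mem_quinticPlaneMap_domain_iff h hG hH hr0).2 h0)
    have ha : G⁻¹.mulVec (e 0).rep ≠ 0 := by
      rw [Ne, mulVec_eq_zero_iff (Matrix.isUnit_nonsing_inv_det _ hG)]
      exact hr0.ne_zero
    obtain ⟨F, hF0, hF, hFb⟩ := (hmem hr0 hr1).1 he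
    obtain ⟨F', hF', hne⟩ := exists_isEpipolar_not_smul_of_quintics_eq_zero h ha hq F
    obtain ⟨Q, hQ, hQw⟩ := exists_conic ha hF0 hF hFb hF' hne
    have hev : ∀ w, eval w (aeval (fun k => linForm (H⁻¹ k)) Q) = eval (H⁻¹.mulVec w) Q := by
      intro w
      rw [eval_aeval_eq]
      congr 2
      funext k
      exact eval_linForm _ _
    refine ⟨aeval (fun k => linForm (H⁻¹ k)) Q, by rw [hev, hQ], fun w b hb hw => ?_⟩
    exact (hmem (e := (![e 0, b] : Fin 2 → P2)) hr0 hb).2 (hQw _ (by rwa [← hev]))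
  -- Nonvanishing of the composite at a says that the pair of a and its image lies over both
  -- domains.
  · obtain ⟨a, ha⟩ := hcomp
    have hz : ∀ ξ η : Fin 3 → ℂ, quintics ξ η 0 = 0 := by
      intro ξ η
      funext i
      fin_cases i <;> simp [quintics]
    have h1 : quintics ξ η a ≠ 0 := fun h0 => ha (by rw [h0, hz])
    have h2 : a ≠ 0 := fun h0 => h1 (by rw [h0, hz])
    obtain ⟨e, he⟩ := exists_representsTuple (v := ![G.mulVec a, H.mulVec (quintics ξ η a)])
      (Fin.forall_fin_two.2
        ⟨mt (mulVec_eq_zero_iff hG).1 h2, mt (mulVec_eq_zero_iff hH).1 h1⟩)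
    have hr0 : Represents (e 0) (G.mulVec a) := he 0
    have hr1 : Represents (e 1) (H.mulVec (quintics ξ η a)) := he 1
    refine ⟨e, ?_, ?_⟩
    · rw [hmem hr0 hr1, inv_mulVec_mulVec hG, inv_mulVec_mulVec hH]
      exact hasEpipolar_quintics h1
    · intro k
      fin_cases k
      · refine (mem_quinticPlaneMap_domain_iff h hG hH hr0).2 ?_
        rwa [inv_mulVec_mulVec hG]
      · refine (mem_quinticPlaneMap_domain_iff h' hH hG hr1).2 ?_
        rwa [inv_mulVec_mulVec hH]

/-! ### Families of univariate polynomials and separability -/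

section Families

variable {κ : Type}

/-- A family of univariate polynomials whose coefficients are polynomial functions. -/
def IsPolyFamily (g : (κ → Fin 3 → ℂ) → Polynomial ℂ) : Prop :=
  ∃ f : Polynomial (MvPolynomial (κ × Fin 3) ℂ),
    ∀ v, f.map (MvPolynomial.eval (Function.uncurry v)) = g v

namespace IsPolyFamily

variable {g h : (κ → Fin 3 → ℂ) → Polynomial ℂ}

theorem C {a : (κ → Fin 3 → ℂ) → ℂ} (ha : IsPolyFun a) :
    IsPolyFamily fun v => Polynomial.C (a v) := by
  obtain ⟨f, hf⟩ := ha
  exact ⟨Polynomial.C f, fun v => by rw [Polynomial.map_C, hf]⟩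

theorem X : IsPolyFamily fun _ : κ → Fin 3 → ℂ => Polynomial.X :=
  ⟨Polynomial.X, fun v => by rw [Polynomial.map_X]⟩

theorem add (hg : IsPolyFamily g) (hh : IsPolyFamily h) : IsPolyFamily fun v => g v + h v := by
  obtain ⟨a, ha⟩ := hg
  obtain ⟨b, hb⟩ := hh
  exact ⟨a + b, fun v => by rw [Polynomial.map_add, ha, hb]⟩

theorem mul (hg : IsPolyFamily g) (hh : IsPolyFamily h) : IsPolyFamily fun v => g v * h v := by
  obtain ⟨a, ha⟩ := hg
  obtain ⟨b, hb⟩ := hh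
  exact ⟨a * b, fun v => by rw [Polynomial.map_mul, ha, hb]⟩

theorem sum {ι : Type*} (s : Finset ι) {g : ι → (κ → Fin 3 → ℂ) → Polynomial ℂ}
    (hg : ∀ i ∈ s, IsPolyFamily (g i)) : IsPolyFamily fun v => ∑ i ∈ s, g i v := by
  choose! f hf using hg
  exact ⟨∑ i ∈ s, f i, fun v => by
    rw [Polynomial.map_sum]
    exact Finset.sum_congr rfl fun i hi => hf i hi v⟩

theorem aeval {ι : Type*} (f : MvPolynomial ι ℂ) {a : (κ → Fin 3 → ℂ) → ι → Polynomial ℂ}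
    (ha : ∀ i, IsPolyFamily fun v => a v i) : IsPolyFamily fun v => MvPolynomial.aeval (a v) f := by
  induction f using MvPolynomial.induction_on with
  | C c =>
    simp only [algHom_C]
    exact C (IsPolyFun.const c)
  | add p q hp hq =>
    simp only [map_add]
    exact hp.add hq
  | mul_X p i hp =>
    simp only [map_mul, aeval_X]
    exact hp.mul (ha i)

theorem quintics {ξ η a : (κ → Fin 3 → ℂ) → Fin 3 → Polynomial ℂ}
    (hξ : ∀ i, IsPolyFamily fun v => ξ v i) (hη : ∀ i, IsPolyFamily fun v => η v i)
    (ha : ∀ i, IsPolyFamily fun v => a v i) (i : Fin 3) :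
    IsPolyFamily fun v => _root_.quintics (ξ v) (η v) (a v) i := by
  choose x hx using hξ
  choose y hy using hη
  choose z hz using ha
  refine ⟨_root_.quintics x y z i, fun v => ?_⟩
  rw [← Polynomial.coe_mapRingHom, map_quintics]
  congr 1
  · funext j; exact hx j v
  · funext j; exact hy j v
  · funext j; exact hz j v

/-- With the formal degrees `N` and `N - 1` fixed, the resultant stays polynomial in the
coefficients even where the degree drops; the factor `coeff N` excludes such drops. -/
theorem isPolyFun_coeff_mul_resultant (hg : IsPolyFamily g) (N : ℕ) : IsPolyFun fun v =>
    (g v).coeff N * Polynomial.resultant (g v) (Polynomial.derivative (g v)) N (N - 1) := by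
  obtain ⟨f, hf⟩ := hg
  refine ⟨f.coeff N * Polynomial.resultant f (Polynomial.derivative f) N (N - 1), fun v => ?_⟩
  dsimp only
  rw [map_mul, ← hf, Polynomial.derivative_map, Polynomial.resultant_map_map,
    Polynomial.coeff_map]

end IsPolyFamily

/-- When the degree is exactly `N`, the derivative has degree `N - 1` in characteristic zero, so the
formal resultant is the true one and detects common factors. -/
theorem coeff_mul_resultant_ne_zero_iff {p : Polynomial ℂ} {N : ℕ} (hN : 0 < N)
    (hp : p.natDegree ≤ N) :
    p.coeff N * Polynomial.resultant p (Polynomial.derivative p) N (N - 1) ≠ 0 ↔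
      p.natDegree = N ∧ p.Separable := by
  rw [mul_ne_zero_iff]
  have key : p.natDegree = N → (Polynomial.resultant p (Polynomial.derivative p) N (N - 1) ≠ 0 ↔
      p.Separable) := by
    intro h
    have hd : (Polynomial.derivative p).natDegree = N - 1 := by
      have := Polynomial.degree_derivative (p := p) (by omega)
      rw [← h]
      exact Polynomial.natDegree_eq_of_degree_eq_some this
    have h0 : p ≠ 0 := by
      rintro rfl
      simp at h
      omega
    have hr := Polynomial.resultant_eq_zero_iff (f := p) (g := Polynomial.derivative p)
    rw [h, hd] at hr
    rw [Ne, hr]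
    simp [h0, Polynomial.separable_def]
  constructor
  · rintro ⟨h1, h2⟩
    have h3 : p.natDegree = N := hp.antisymm (Polynomial.le_natDegree_of_ne_zero h1)
    exact ⟨h3, (key h3).1 h2⟩
  · rintro ⟨h1, h2⟩
    refine ⟨?_, (key h1).2 h2⟩
    rw [← h1, Polynomial.coeff_natDegree, Polynomial.leadingCoeff_ne_zero]
    rintro rfl
    simp at h1
    omega

end Families

/-! ### Line sections and the mixed multidegree -/

section LineSections

/-- The restriction of the curve `m · φ = 0` to the line `t ↦ P + t R`. -/
noncomputable def lineSection (φ : PlaneRationalMap) (P R m : Fin 3 → ℂ) : Polynomial ℂ :=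
  ∑ i, Polynomial.C (m i) *
    aeval (fun j => Polynomial.C (P j) + Polynomial.C (R j) * Polynomial.X) (φ.form i)

theorem eval_aeval_line (f : MvPolynomial (Fin 3) ℂ) (P R : Fin 3 → ℂ) (t : ℂ) :
    (aeval (fun j => Polynomial.C (P j) + Polynomial.C (R j) * Polynomial.X) f).eval t =
      eval (P + t • R) f := by
  induction f using MvPolynomial.induction_on with
  | C c => simp
  | add p q hp hq => rw [map_add, Polynomial.eval_add, hp, hq, map_add]
  | mul_X p i hp =>
    rw [map_mul, Polynomial.eval_mul, hp, map_mul, aeval_X, eval_X]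
    simp only [Polynomial.eval_add, Polynomial.eval_mul, Polynomial.eval_C, Polynomial.eval_X,
      Pi.add_apply, Pi.smul_apply, smul_eq_mul]
    ring

theorem eval_lineSection (φ : PlaneRationalMap) (P R m : Fin 3 → ℂ) (t : ℂ) :
    (lineSection φ P R m).eval t = dotProduct m (φ.evalVec (P + t • R)) := by
  simp only [lineSection, Polynomial.eval_finsetSum, Polynomial.eval_mul, Polynomial.eval_C,
    eval_aeval_line, dotProduct, PlaneRationalMap.evalVec]

theorem natDegree_lineSection_le (φ : PlaneRationalMap) (P R m : Fin 3 → ℂ) :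
    (lineSection φ P R m).natDegree ≤ φ.degree := by
  refine Polynomial.natDegree_sum_le_of_forall_le _ _ fun i _ => ?_
  refine (Polynomial.natDegree_C_mul_le _ _).trans ?_
  have h := aeval_natDegree_le (φ.form i) (φ.homogeneous i).totalDegree_le
    (fun j => Polynomial.C (P j) + Polynomial.C (R j) * Polynomial.X) (n := 1) fun j => by
      compute_degree
  simpa using h

theorem isPolyFamily_lineSection (φ : PlaneRationalMap) {κ : Type}
    {P R m : (κ → Fin 3 → ℂ) → Fin 3 → ℂ} (hP : ∀ i, IsPolyFun fun v => P v i)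
    (hR : ∀ i, IsPolyFun fun v => R v i) (hm : ∀ i, IsPolyFun fun v => m v i) :
    IsPolyFamily fun v => lineSection φ (P v) (R v) (m v) :=
  IsPolyFamily.sum _ fun i _ => (IsPolyFamily.C (hm i)).mul
    (IsPolyFamily.aeval _ fun j =>
      (IsPolyFamily.C (hP j)).add ((IsPolyFamily.C (hR j)).mul IsPolyFamily.X))

/-- Serves to parametrize a line polynomially in its dual vector l: both l × c and l × d lie on the
line, and at l = P × R they return P and R. -/
theorem exists_cross_eq {P R : Fin 3 → ℂ} (h : crossProduct P R ≠ 0) :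
    ∃ c d, crossProduct (crossProduct P R) c = P ∧ crossProduct (crossProduct P R) d = R := by
  obtain ⟨i, hi⟩ := Function.ne_iff.1 h
  set s := crossProduct P R i with hs
  have hs0 : s ≠ 0 := hi
  set k : Fin 3 → ℂ := Pi.single i 1
  have hk : dotProduct (crossProduct P R) k = s := by simp [k, hs]
  refine ⟨s⁻¹ • crossProduct P k, s⁻¹ • crossProduct R k, ?_, ?_⟩
  · have h1 : dotProduct R (crossProduct P k) = -s := by
      rw [← hk, triple_product_permutation, triple_product_permutation, ← cross_anticomm,
        dotProduct_neg, dotProduct_comm k]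
    rw [cross_cross_eq_smul_sub_smul, dotProduct_smul, dotProduct_smul, dot_self_cross, h1]
    simp [hs0]
  · have h1 : dotProduct P (crossProduct R k) = s := by
      rw [← hk, triple_product_permutation, triple_product_permutation, dotProduct_comm]
    rw [cross_cross_eq_smul_sub_smul, dotProduct_smul, dotProduct_smul, dot_self_cross, h1]
    simp [hs0]

theorem exists_eq_smul_add_smul {P R w : Fin 3 → ℂ} (h : crossProduct P R ≠ 0)
    (hw : dotProduct (crossProduct P R) w = 0) : ∃ α β : ℂ, w = α • P + β • R := by
  obtain ⟨i, hi⟩ := Function.ne_iff.1 h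
  have hi' : crossProduct P R i ≠ 0 := hi
  refine ⟨-(crossProduct R w i) / crossProduct P R i, -(crossProduct w P i) / crossProduct P R i,
    ?_⟩
  have key : ∀ j, crossProduct P R i * w j + crossProduct R w i * P j + crossProduct w P i * R j =
      if i = j then dotProduct (crossProduct P R) w else 0 := by
    intro j
    fin_cases i <;> fin_cases j <;>
      simp [cross_apply, dotProduct, Fin.sum_univ_three] <;> ring
  funext j
  have := key j
  rw [hw, ite_self] at this
  simp only [Pi.add_apply, Pi.smul_apply, smul_eq_mul]
  field_simp
  linear_combination this

end LineSections

namespace IsBirationalCorrespondence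

variable {E : Set (MultiP2 (Fin 2))} {φ : Fin 2 → PlaneRationalMap}
  (hE : IsBirationalCorrespondence E φ)

include hE

/-- The line avoids the base points, so the points of `E` over it are graph points over P + t R. The
parameter t = ∞ is excluded by `hR`, so these points correspond to the roots of a separable
polynomial of full degree. -/
theorem encard_lineSection {P R m : Fin 3 → ℂ}
    (hnat : (lineSection (φ 0) P R m).natDegree = (φ 0).degree)
    (hsep : (lineSection (φ 0) P R m).Separable)
    (hR : dotProduct m ((φ 0).evalVec R) ≠ 0) (hPR : crossProduct P R ≠ 0)
    (hbase : ∀ z, z ∉ (φ 0).domain → dotProduct (crossProduct P R) z.rep ≠ 0) :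
    {e ∈ E | dotProduct (crossProduct P R) (e 0).rep = 0 ∧
      dotProduct m (e 1).rep = 0}.encard = (φ 0).degree := by
  classical
  have hdot : ∀ t : ℂ, dotProduct (crossProduct P R) (P + t • R) = 0 := by
    intro t
    rw [dotProduct_add, dotProduct_smul, dotProduct_comm, dot_self_cross, dotProduct_comm,
      dot_cross_self]
    simp
  have hcr : ∀ t u : ℂ, crossProduct (P + t • R) (P + u • R) = (u - t) • crossProduct P R := by
    intro t u
    have h := cross_anticomm P R
    simp only [map_add, map_smul, LinearMap.add_apply, LinearMap.smul_apply, cross_self,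
      ← h, smul_neg, sub_smul, smul_zero, add_zero, zero_add]
    abel
  have hne : ∀ t : ℂ, P + t • R ≠ 0 := by
    intro t h
    have h1 := hcr t (t + 1)
    rw [h, map_zero, LinearMap.zero_apply, add_sub_cancel_left, one_smul] at h1
    exact hPR h1.symm
  have hval : ∀ t : ℂ, (φ 0).evalVec (P + t • R) ≠ 0 := by
    intro t h
    have h1 := represents_mk (hne t)
    have h2 : Projectivization.mk ℂ _ (hne t) ∉ (φ 0).domain := fun h3 =>
      ((φ 0).mem_domain_iff h1).1 h3 h
    obtain ⟨c, -, hc⟩ := h1.exists_smul (represents_rep _)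
    apply hbase _ h2
    rw [hc, dotProduct_smul, hdot, smul_zero]
  have hlift : ∀ t : ℂ, ∃ e : MultiP2 (Fin 2), RepresentsTuple e (graphLift φ 0 (P + t • R)) := by
    intro t
    refine exists_representsTuple fun j => ?_
    unfold graphLift
    split_ifs
    · exact hne t
    · exact hval t
  choose e he using hlift
  have he0 : ∀ t, Represents (e t 0) (P + t • R) := fun t => he t 0
  have he1 : ∀ t, Represents (e t 1) ((φ 0).evalVec (P + t • R)) := fun t => he t 1
  have hinj : Function.Injective e := by
    intro t u h
    have h1 := he0 u
    rw [← h] at h1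
    have h2 := (he0 t).cross_eq_zero h1
    rw [hcr] at h2
    exact (sub_eq_zero.1 ((smul_eq_zero.1 h2).resolve_right hPR)).symm
  have hset : {e ∈ E | dotProduct (crossProduct P R) (e 0).rep = 0 ∧
      dotProduct m (e 1).rep = 0} = e '' ((lineSection (φ 0) P R m).roots.toFinset : Set ℂ) := by
    have h0 : lineSection (φ 0) P R m ≠ 0 := hsep.ne_zero
    ext f
    simp only [Set.mem_ofPred_eq, Set.mem_image, SetLike.mem_coe, Multiset.mem_toFinset,
      Polynomial.mem_roots h0, Polynomial.IsRoot.def, eval_lineSection]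
    constructor
    · rintro ⟨hf, h1, h2⟩
      obtain ⟨α, β, hw⟩ := exists_eq_smul_add_smul hPR h1
      have hdom : f 0 ∈ (φ 0).domain := by
        by_contra h
        exact hbase _ h h1
      have hs : Represents (f 1) ((φ 0).evalVec (f 0).rep) := (hE.mem_iff 0 f hdom).1 hf
      obtain ⟨c, hc, hc'⟩ := (represents_rep (f 1)).exists_smul hs
      have h3 : dotProduct m ((φ 0).evalVec (f 0).rep) = 0 := by
        rw [hc', dotProduct_smul, h2, smul_zero]
      have hα : α ≠ 0 := by
        rintro rfl
        rw [zero_smul, zero_add] at hw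
        have hβ : β ≠ 0 := by
          rintro rfl
          exact (f 0).rep_nonzero (by rw [hw, zero_smul])
        rw [hw, PlaneRationalMap.evalVec_smul, dotProduct_smul, smul_eq_zero] at h3
        exact hR (h3.resolve_left (pow_ne_zero _ hβ))
      have hw' : (f 0).rep = α • (P + (β / α) • R) := by
        rw [hw, smul_add, smul_smul, mul_div_cancel₀ _ hα]
      have hf0 : Represents (f 0) (P + (β / α) • R) := by
        have := (represents_rep (f 0)).smul (inv_ne_zero hα)
        rwa [hw', smul_smul, inv_mul_cancel₀ hα, one_smul] at this
      refine ⟨β / α, ?_, ?_⟩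
      · rw [hw', PlaneRationalMap.evalVec_smul, dotProduct_smul, smul_eq_zero] at h3
        exact h3.resolve_left (pow_ne_zero _ hα)
      · exact (he _).unique (representsTuple_graphLift.2 ⟨hf0, (hE.mem_iff 0 f hdom).1 hf⟩)
    · rintro ⟨t, ht, rfl⟩
      have h1 := representsTuple_graphLift.1 (he t)
      refine ⟨(hE.mem_iff 0 _ h1.2.mem_domain).2 h1.2, ?_, ?_⟩
      · obtain ⟨c, -, hc⟩ := (he0 t).exists_smul (represents_rep _)
        rw [hc, dotProduct_smul, hdot, smul_zero]
      · obtain ⟨c, -, hc⟩ := (he1 t).exists_smul (represents_rep _)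
        rw [hc, dotProduct_smul, ht, smul_zero]
  rw [hset, hinj.injOn.encard_image, Set.encard_coe_eq_coe_finsetCard,
    Multiset.toFinset_card_of_nodup (Polynomial.nodup_roots hsep),
    IsAlgClosed.card_roots_eq_natDegree, hnat]

/-- The hypotheses at one line and one m are nonvanishing conditions on polynomial functions of the
pair of lines, so they persist generically. Avoiding the finitely many base points adds one more
nonzero factor. -/
theorem hasMultidegree_one_one (hdeg : 0 < (φ 0).degree) {P R m : Fin 3 → ℂ}
    (hnat : (lineSection (φ 0) P R m).natDegree = (φ 0).degree)
    (hsep : (lineSection (φ 0) P R m).Separable)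
    (hR : dotProduct m ((φ 0).evalVec R) ≠ 0) (hPR : crossProduct P R ≠ 0) :
    HasMultidegree E 1 1 (φ 0).degree := by
  classical
  obtain ⟨c, d, hc, hd⟩ := exists_cross_eq hPR
  set κ := Fin 1 ⊕ Fin 1
  let L : (κ → Fin 3 → ℂ) → Fin 3 → ℂ := fun v => v (Sum.inl 0)
  let M : (κ → Fin 3 → ℂ) → Fin 3 → ℂ := fun v => v (Sum.inr 0)
  have hL : ∀ i, IsPolyFun fun v => L v i := fun i => IsPolyFun.coord _ i
  have hM : ∀ i, IsPolyFun fun v => M v i := fun i => IsPolyFun.coord _ i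
  have hLc : ∀ i, IsPolyFun fun v => crossProduct (L v) c i :=
    IsPolyFun.cross hL fun i => IsPolyFun.const (c i)
  have hLd : ∀ i, IsPolyFun fun v => crossProduct (L v) d i :=
    IsPolyFun.cross hL fun i => IsPolyFun.const (d i)
  have hcross : ∀ l, crossProduct (crossProduct l c) (crossProduct l d) =
      -dotProduct c (crossProduct l d) • l := by
    intro l
    rw [cross_cross_eq_smul_sub_smul, dot_self_cross, zero_smul, zero_sub, neg_smul]
  let p : (κ → Fin 3 → ℂ) → Polynomial ℂ := fun v =>
    lineSection (φ 0) (crossProduct (L v) c) (crossProduct (L v) d) (M v)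
  have hdisc := (isPolyFamily_lineSection (φ 0) hLc hLd hM).isPolyFun_coeff_mul_resultant
    (φ 0).degree
  have hmR : IsPolyFun fun v => dotProduct (M v) ((φ 0).evalVec (crossProduct (L v) d)) :=
    IsPolyFun.dot hM fun i => (φ 0).isPolyFun_evalVec hLd i
  have hcd : IsPolyFun fun v => dotProduct c (crossProduct (L v) d) :=
    IsPolyFun.dot (fun i => IsPolyFun.const (c i)) hLd
  let Z := (hE.finite 0).toFinset
  have hz : ∀ z ∈ Z, IsPolyFun fun v => dotProduct (L v) z.rep := fun z _ =>
    IsPolyFun.dot hL fun i => IsPolyFun.const (z.rep i)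
  refine (((hdisc.mul hmR).mul hcd).mul (IsPolyFun.prod Z hz)).generically ?_ ?_
  · have h1 : ∃ v, (p v).coeff (φ 0).degree *
        Polynomial.resultant (p v) (Polynomial.derivative (p v)) (φ 0).degree ((φ 0).degree - 1) *
        dotProduct (M v) ((φ 0).evalVec (crossProduct (L v) d)) *
        dotProduct c (crossProduct (L v) d) ≠ 0 := by
      let v : κ → Fin 3 → ℂ := Sum.elim (fun _ => crossProduct P R) fun _ => m
      have hLv : L v = crossProduct P R := rfl
      have hMv : M v = m := rfl
      have hpv : p v = lineSection (φ 0) P R m := by simp only [p, hLv, hMv, hc, hd]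
      refine ⟨v, ?_⟩
      rw [hpv, hLv, hMv, hd, mul_ne_zero_iff, mul_ne_zero_iff,
        coeff_mul_resultant_ne_zero_iff hdeg (natDegree_lineSection_le _ _ _ _)]
      refine ⟨⟨⟨hnat, hsep⟩, hR⟩, fun h0 => hPR ?_⟩
      have h1 := hcross (crossProduct P R)
      rwa [hc, hd, h0, neg_zero, zero_smul] at h1
    have h2 : ∃ v, ∏ z ∈ Z, dotProduct (L v) z.rep ≠ 0 := by
      obtain ⟨v, hv⟩ := IsPolyFun.exists_ne_zero_forall Z hz fun z _ => by
        obtain ⟨i, hi⟩ := Function.ne_iff.1 z.rep_nonzero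
        exact ⟨fun _ => Pi.single i 1, by simpa [L] using hi⟩
      exact ⟨v, Finset.prod_ne_zero_iff.2 hv⟩
    obtain ⟨v, h3, h4⟩ := ((hdisc.mul hmR).mul hcd).exists_ne_zero_and (IsPolyFun.prod Z hz) h1 h2
    exact ⟨v, mul_ne_zero h3 h4⟩
  · intro l v hlv hne
    obtain ⟨hne, hZ⟩ := mul_ne_zero_iff.1 hne
    obtain ⟨hne, h3⟩ := mul_ne_zero_iff.1 hne
    obtain ⟨h1, h2⟩ := mul_ne_zero_iff.1 hne
    obtain ⟨h4, h5⟩ := (coeff_mul_resultant_ne_zero_iff hdeg (natDegree_lineSection_le _ _ _ _)).1 h1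
    have hs : -dotProduct c (crossProduct (L v) d) ≠ 0 := neg_ne_zero.2 h3
    have hLv : L v ≠ 0 := (hlv _).ne_zero
    have hiff : ∀ w, dotProduct (crossProduct (crossProduct (L v) c) (crossProduct (L v) d)) w = 0 ↔
        dotProduct (L v) w = 0 := by
      intro w
      rw [hcross, smul_dotProduct, smul_eq_zero]
      simp [hs]
    rw [← hE.encard_lineSection h4 h5 h2 (by rw [hcross]; exact smul_ne_zero hs hLv) ?_]
    · congr 1
      ext e
      simp only [Set.mem_ofPred_eq, hiff, Fin.forall_fin_one,
        onLine_iff (hlv _) (represents_rep _), L, M]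
    · intro z hzd
      rw [Ne, hiff]
      exact Finset.prod_ne_zero_iff.1 hZ z (by simpa [Z] using hzd)

end IsBirationalCorrespondence

/-! ### Projective frames and the fifth point -/

section ProjectiveFrames

/-- The coefficients of the linear relation between the first four vectors. -/
def frameScale (X : Fin 5 → Fin 3 → ℂ) : Fin 3 → ℂ :=
  ![dotProduct (X 3) (crossProduct (X 1) (X 2)), dotProduct (X 0) (crossProduct (X 3) (X 2)),
    dotProduct (X 0) (crossProduct (X 1) (X 3))]

/-- The determinant of the first three vectors. -/
def frameDet (X : Fin 5 → Fin 3 → ℂ) : ℂ := dotProduct (X 0) (crossProduct (X 1) (X 2))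

/-- The matrix that takes the standard frame to the first four vectors, up to scale. -/
def frameMatrix (X : Fin 5 → Fin 3 → ℂ) : Matrix (Fin 3) (Fin 3) ℂ :=
  Matrix.of fun i j => frameScale X j * X (j.castLE (by norm_num)) i

/-- The coordinates of the fifth vector with respect to the first four. -/
def fifthPoint (X : Fin 5 → Fin 3 → ℂ) : Fin 3 → ℂ :=
  ![dotProduct (X 4) (crossProduct (X 1) (X 2)) * (frameScale X 1 * frameScale X 2),
    dotProduct (X 0) (crossProduct (X 4) (X 2)) * (frameScale X 0 * frameScale X 2),
    dotProduct (X 0) (crossProduct (X 1) (X 4)) * (frameScale X 0 * frameScale X 1)]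

theorem det_frameMatrix (X : Fin 5 → Fin 3 → ℂ) :
    (frameMatrix X).det = (∏ i, frameScale X i) * frameDet X := by
  have h : ∀ i j, frameMatrix X i j = frameScale X j * X (j.castLE (by norm_num)) i :=
    fun _ _ => rfl
  have h0 : (Fin.castLE (by norm_num : 3 ≤ 5) 0) = 0 := rfl
  have h1 : (Fin.castLE (by norm_num : 3 ≤ 5) 1) = 1 := rfl
  have h2 : (Fin.castLE (by norm_num : 3 ≤ 5) 2) = 2 := rfl
  rw [Matrix.det_fin_three, Fin.prod_univ_three]
  simp only [h, h0, h1, h2, frameDet, cross_apply, dotProduct, Fin.sum_univ_three,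
    Matrix.cons_val_zero, Matrix.cons_val_one, Matrix.cons_val]
  ring

/-- Cramer's rule expresses the fourth and fifth vectors through the first three. The coordinates of
the fifth point are multiplied by the product of the three scales, which avoids division. -/
theorem frameMatrix_mulVec_framePoints (X : Fin 5 → Fin 3 → ℂ) (i : Fin 5) :
    (frameMatrix X).mulVec (framePoints (fifthPoint X) i) =
      (![frameScale X 0, frameScale X 1, frameScale X 2, frameDet X,
        (∏ i, frameScale X i) * frameDet X] : Fin 5 → ℂ) i • X i := by
  have h : ∀ i j, frameMatrix X i j = frameScale X j * X (j.castLE (by norm_num)) i :=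
    fun _ _ => rfl
  have h0 : (Fin.castLE (by norm_num : 3 ≤ 5) 0) = 0 := rfl
  have h1 : (Fin.castLE (by norm_num : 3 ≤ 5) 1) = 1 := rfl
  have h2 : (Fin.castLE (by norm_num : 3 ≤ 5) 2) = 2 := rfl
  funext j
  simp only [Matrix.mulVec, dotProduct, Fin.sum_univ_three, h, h0, h1, h2, Pi.smul_apply,
    smul_eq_mul]
  fin_cases i
  · simp [framePoints]
  · simp [framePoints]
  · simp [framePoints]
  · simp only [framePoints, frameScale, frameDet, cross_apply, dotProduct, Fin.sum_univ_three,
      Fin.reduceFinMk, Matrix.cons_val_zero, Matrix.cons_val_one, Matrix.cons_val]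
    fin_cases j <;> ring!
  · simp only [framePoints, fifthPoint, Fin.reduceFinMk, Fin.prod_univ_three, Matrix.cons_val_zero,
      Matrix.cons_val_one, Matrix.cons_val]
    have key : dotProduct (X 4) (crossProduct (X 1) (X 2)) * X 0 j +
        dotProduct (X 0) (crossProduct (X 4) (X 2)) * X 1 j +
        dotProduct (X 0) (crossProduct (X 1) (X 4)) * X 2 j = frameDet X * X 4 j := by
      simp only [frameDet, cross_apply, dotProduct, Fin.sum_univ_three,
        Matrix.cons_val_zero, Matrix.cons_val_one, Matrix.cons_val]
      fin_cases j <;> ring!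
    linear_combination (frameScale X 0 * frameScale X 1 * frameScale X 2) * key

theorem represents_frameMatrix_mulVec {x : Fin 5 → P2} {X : Fin 5 → Fin 3 → ℂ}
    (hX : ∀ i, Represents (x i) (X i)) (hs : ∀ i, frameScale X i ≠ 0) (hd : frameDet X ≠ 0)
    (i : Fin 5) : Represents (x i) ((frameMatrix X).mulVec (framePoints (fifthPoint X) i)) := by
  rw [frameMatrix_mulVec_framePoints]
  have hp : ∏ i, frameScale X i ≠ 0 := Finset.prod_ne_zero_iff.2 fun i _ => hs i
  refine (hX i).smul ?_
  fin_cases i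
  · exact hs 0
  · exact hs 1
  · exact hs 2
  · exact hd
  · exact mul_ne_zero hp hd

theorem frameScale_framePoints (ξ : Fin 3 → ℂ) (i : Fin 3) : frameScale (framePoints ξ) i = 1 := by
  fin_cases i <;> simp [frameScale, framePoints, cross_apply]

theorem frameDet_framePoints (ξ : Fin 3 → ℂ) : frameDet (framePoints ξ) = 1 := by
  simp [frameDet, framePoints, cross_apply]

theorem fifthPoint_framePoints (ξ : Fin 3 → ℂ) : fifthPoint (framePoints ξ) = ξ := by
  funext i
  simp only [fifthPoint, frameScale_framePoints]
  fin_cases i <;> simp [framePoints, cross_apply, dotProduct, Fin.sum_univ_three]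

theorem IsPolyFun.comp {κ κ' : Type} {g : (κ' → Fin 3 → ℂ) → ℂ} (hg : IsPolyFun g)
    {Φ : (κ → Fin 3 → ℂ) → κ' → Fin 3 → ℂ} (hΦ : ∀ k i, IsPolyFun fun v => Φ v k i) :
    IsPolyFun fun v => g (Φ v) := by
  obtain ⟨f, hf⟩ := hg
  obtain ⟨f', hf'⟩ := IsPolyFun.eval f (φ := fun v => Function.uncurry (Φ v)) fun i => hΦ i.1 i.2
  exact ⟨f', fun v => (hf' v).trans (hf _)⟩

/-- The matrix `G⁻¹ * G'` fixes four frame points up to scale: the vertices make it diagonal and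
(1,1,1) makes it scalar. So the explicit formula need only be known for one choice of coordinates.
-/
theorem StandardPosition.exists_smul {x : Fin 5 → P2} {G G' : Matrix (Fin 3) (Fin 3) ℂ}
    {ξ ξ' : Fin 3 → ℂ} (hG : IsUnit G.det)
    (hx : ∀ i, Represents (x i) (G.mulVec (framePoints ξ i))) (h : StandardPosition x G' ξ') :
    ∃ s t : ℂ, s ≠ 0 ∧ t ≠ 0 ∧ (∀ v, G'.mulVec v = s • G.mulVec v) ∧ ξ' = t • ξ := by
  obtain ⟨-, h4, h5⟩ := h
  have hinv : ∀ v, G.mulVec (G⁻¹.mulVec v) = v := mulVec_inv_mulVec hG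
  set N := G⁻¹ * G' with hN
  have hN' : ∀ v, N.mulVec v = G⁻¹.mulVec (G'.mulVec v) := fun v => by
    rw [hN, Matrix.mulVec_mulVec]
  have hfr : ∀ i : Fin 4, framePoints ξ i.castSucc = frame i := by
    intro i
    fin_cases i <;> rfl
  have hex : ∀ i : Fin 4, ∃ s : ℂ, s ≠ 0 ∧ N.mulVec (frame i) = s • frame i := by
    intro i
    obtain ⟨s, hs, hs'⟩ := (hx i.castSucc).exists_smul (h4 i)
    refine ⟨s, hs, ?_⟩
    rw [hN', hs', Matrix.mulVec_smul, inv_mulVec_mulVec hG, hfr]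
  choose s hs hs' using hex
  have hNs : ∀ i j, N i j = if i = j then s 3 else 0 := by
    have e : ∀ k i, N.mulVec (frame k) i = s k * frame k i := fun k i => by
      rw [hs']; rfl
    intro i j
    have e0 := e 0 i
    have e1 := e 1 i
    have e2 := e 2 i
    have e3 := e 3 i
    simp only [frame, Matrix.mulVec, dotProduct, Fin.sum_univ_three, Matrix.cons_val_zero,
      Matrix.cons_val_one, Matrix.cons_val, mul_one, mul_zero, add_zero, zero_add] at e0 e1 e2 e3
    fin_cases i <;> fin_cases j <;> simp_all
  have hNv : ∀ v, N.mulVec v = s 3 • v := by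
    intro v
    funext i
    simp [Matrix.mulVec, dotProduct, hNs]
  have hG' : ∀ v, G'.mulVec v = s 3 • G.mulVec v := by
    intro v
    rw [← hinv (G'.mulVec v), ← hN', hNv, Matrix.mulVec_smul]
  obtain ⟨t, ht, ht'⟩ := (hx 4).exists_smul h5
  refine ⟨s 3, t / s 3, hs 3, div_ne_zero ht (hs 3), hG', ?_⟩
  have h6 := congrArg (G⁻¹.mulVec) ht'
  rw [hG', Matrix.mulVec_smul, Matrix.mulVec_smul, inv_mulVec_mulVec hG,
    inv_mulVec_mulVec hG] at h6
  rw [div_eq_inv_mul, ← smul_smul]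
  change _ = _ • (t • framePoints ξ 4)
  rw [← h6, smul_smul, inv_mul_cancel₀ (hs 3), one_smul]

variable {κ : Type} {X : (κ → Fin 3 → ℂ) → Fin 5 → Fin 3 → ℂ}
  (hX : ∀ k i, IsPolyFun fun v => X v k i)

include hX

theorem isPolyFun_triple (a b c : Fin 5) :
    IsPolyFun fun v => dotProduct (X v a) (crossProduct (X v b) (X v c)) :=
  IsPolyFun.dot (hX a) (IsPolyFun.cross (hX b) (hX c))

theorem isPolyFun_frameScale (i : Fin 3) : IsPolyFun fun v => frameScale (X v) i := by
  fin_cases i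
  · exact isPolyFun_triple hX 3 1 2
  · exact isPolyFun_triple hX 0 3 2
  · exact isPolyFun_triple hX 0 1 3

theorem isPolyFun_fifthPoint (i : Fin 3) : IsPolyFun fun v => fifthPoint (X v) i := by
  have h := isPolyFun_frameScale hX
  fin_cases i
  · exact (isPolyFun_triple hX 4 1 2).mul ((h 1).mul (h 2))
  · exact (isPolyFun_triple hX 0 4 2).mul ((h 0).mul (h 2))
  · exact (isPolyFun_triple hX 0 1 4).mul ((h 0).mul (h 1))

end ProjectiveFrames

/-! ### Transversal lines in standard coordinates -/

section Transversality

/-- The restriction of the first quintic form to the line `t ↦ P + t R`. -/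
noncomputable def quinticSection (ξ η P R : Fin 3 → ℂ) : Polynomial ℂ :=
  quintics (fun j => Polynomial.C (ξ j)) (fun j => Polynomial.C (η j))
    (fun j => Polynomial.C (P j) + Polynomial.C (R j) * Polynomial.X) 0

theorem eval_quinticSection (ξ η P R : Fin 3 → ℂ) (t : ℂ) :
    (quinticSection ξ η P R).eval t = quintics ξ η (P + t • R) 0 := by
  rw [quinticSection, ← Polynomial.coe_evalRingHom, map_quintics]
  congr 1
  · funext j; simp
  · funext j; simp
  · funext j
    simp only [Function.comp_apply, Polynomial.coe_evalRingHom, Polynomial.eval_add, Polynomial.eval_mul,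
      Polynomial.eval_C, Polynomial.eval_X, Pi.add_apply, Pi.smul_apply, smul_eq_mul]
    ring

/-- The line `t ↦ P + t R` meets the first quintic in five distinct points, none of them at
`t = ∞`. -/
structure IsTransversalLine (ξ η P R : Fin 3 → ℂ) : Prop where
  cross_ne_zero : crossProduct P R ≠ 0
  quintics_ne_zero : quintics ξ η R 0 ≠ 0
  natDegree_eq : (quinticSection ξ η P R).natDegree = 5
  separable : (quinticSection ξ η P R).Separable

/-- The dual vector in this section undoes `H` and selects the quintic of index 0, so transversality
can be tested in standard coordinates. -/
theorem lineSection_quinticPlaneMap {ξ η : Fin 3 → ℂ} (h : GeneralPosition ξ η)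
    {G H : Matrix (Fin 3) (Fin 3) ℂ} (hG : IsUnit G.det) (hH : IsUnit H.det)
    (P R : Fin 3 → ℂ) :
    lineSection (quinticPlaneMap h hG hH) (G.mulVec P) (G.mulVec R)
      (Matrix.vecMul (Pi.single 0 1) H⁻¹) = quinticSection ξ η P R := by
  refine Polynomial.funext fun t => ?_
  rw [eval_lineSection, eval_quinticSection, quinticPlaneMap_evalVec, ← Matrix.mulVec_smul,
    ← Matrix.mulVec_add, inv_mulVec_mulVec hG, ← Matrix.dotProduct_mulVec, inv_mulVec_mulVec hH]
  simp

theorem natDegree_quinticSection_le {ξ η : Fin 3 → ℂ} (h : GeneralPosition ξ η)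
    (P R : Fin 3 → ℂ) : (quinticSection ξ η P R).natDegree ≤ 5 := by
  have h1 : IsUnit (1 : Matrix (Fin 3) (Fin 3) ℂ).det := by simp
  rw [← lineSection_quinticPlaneMap h h1 h1]
  exact natDegree_lineSection_le _ _ _ _

theorem cross_mulVec_ne_zero {G : Matrix (Fin 3) (Fin 3) ℂ} (hG : IsUnit G.det)
    {P R : Fin 3 → ℂ} (h : crossProduct P R ≠ 0) :
    crossProduct (G.mulVec P) (G.mulVec R) ≠ 0 := by
  intro h0
  have hP : P ≠ 0 := by
    rintro rfl
    exact h (by simp)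
  obtain ⟨t, ht⟩ := exists_eq_smul_of_cross_eq_zero (mt (mulVec_eq_zero_iff hG).1 hP) h0
  have hR : R = t • P := by
    rw [← inv_mulVec_mulVec hG R, ht, Matrix.mulVec_smul, inv_mulVec_mulVec hG]
  exact h (by rw [hR, map_smul, cross_self, smul_zero])

theorem IsBirationalCorrespondence.hasMultidegree_of_isTransversalLine
    {E : Set (MultiP2 (Fin 2))} {φ : Fin 2 → PlaneRationalMap}
    (hE : IsBirationalCorrespondence E φ) {ξ η P R : Fin 3 → ℂ} (h : GeneralPosition ξ η)
    {G H : Matrix (Fin 3) (Fin 3) ℂ} (hG : IsUnit G.det) (hH : IsUnit H.det)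
    (hφ : φ 0 = quinticPlaneMap h hG hH) (hPR : IsTransversalLine ξ η P R) :
    HasMultidegree E 1 1 5 := by
  have hdeg : (φ 0).degree = 5 := by rw [hφ]; rfl
  rw [← hdeg]
  refine hE.hasMultidegree_one_one (P := G.mulVec P) (R := G.mulVec R)
    (m := Matrix.vecMul (Pi.single 0 1) H⁻¹) (by rw [hdeg]; norm_num) ?_ ?_ ?_
    (cross_mulVec_ne_zero hG hPR.cross_ne_zero)
  · rw [hdeg, hφ, lineSection_quinticPlaneMap, hPR.natDegree_eq]
  · rw [hφ, lineSection_quinticPlaneMap]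
    exact hPR.separable
  · rw [hφ, quinticPlaneMap_evalVec, inv_mulVec_mulVec hG, ← Matrix.dotProduct_mulVec,
      inv_mulVec_mulVec hH]
    simpa using hPR.quintics_ne_zero

end Transversality

/-! ### An explicit witness for all generic conditions -/

section Genericity

theorem isPolyFun_quintics {κ : Type} {ξ η a : (κ → Fin 3 → ℂ) → Fin 3 → ℂ}
    (hξ : ∀ i, IsPolyFun fun v => ξ v i) (hη : ∀ i, IsPolyFun fun v => η v i)
    (ha : ∀ i, IsPolyFun fun v => a v i) (i : Fin 3) :
    IsPolyFun fun v => quintics (ξ v) (η v) (a v) i := by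
  choose x hx using hξ
  choose y hy using hη
  choose z hz using ha
  refine ⟨quintics x y z i, fun v => ?_⟩
  rw [map_quintics]
  congr 1
  · funext j; exact hx j v
  · funext j; exact hy j v
  · funext j; exact hz j v

/-- On this line `a 0` is 2 - t, and the quadrics of index 1 and 2 are 8t² + 2t and 8t² + 16t - 24;
their product has five distinct roots. -/
theorem quinticSection_example :
    quinticSection ![1, -1, 3] ![1, -3, -1] ![2, 1, 0] ![-1, -2, -2] =
      Polynomial.C (-64) * ∏ i, (Polynomial.X - Polynomial.C ((![2, 0, -1/4, 1, -3] : Fin 5 → ℂ) i)) := by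
  refine Polynomial.funext fun t => ?_
  rw [eval_quinticSection]
  simp [quintics, quadrics, Fin.prod_univ_succ]
  ring

theorem isTransversalLine_example :
    IsTransversalLine ![1, -1, 3] ![1, -3, -1] ![2, 1, 0] ![-1, -2, -2] where
  cross_ne_zero := fun h => by simpa [cross_apply] using congrFun h 0
  quintics_ne_zero := by simp [quintics, quadrics]; norm_num
  natDegree_eq := by
    rw [quinticSection_example, Polynomial.natDegree_C_mul (by norm_num),
      Polynomial.natDegree_finsetProd_X_sub_C_eq_card]
    simp
  separable := by
    rw [quinticSection_example]
    refine Polynomial.Separable.unit_mul (Polynomial.isUnit_C.2 (by norm_num)) ?_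
    rw [Polynomial.separable_prod_X_sub_C_iff]
    intro i j hij
    fin_cases i <;> fin_cases j <;> first | rfl | (exfalso; revert hij; norm_num)

/-- A polynomial condition on the fifth points that guarantees everything we need. -/
theorem exists_isPolyFun_generalPosition : ∃ g : (Fin 2 → Fin 3 → ℂ) → ℂ, IsPolyFun g ∧
    (∃ v, g v ≠ 0) ∧ ∀ v, g v ≠ 0 → GeneralPosition (v 0) (v 1) ∧ GeneralPosition (v 1) (v 0) ∧
      (∃ a, quintics (v 1) (v 0) (quintics (v 0) (v 1) a) ≠ 0) ∧
      ∃ P R, IsTransversalLine (v 0) (v 1) P R := by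
  have hc : ∀ k i, IsPolyFun fun v : Fin 2 → Fin 3 → ℂ => v k i := IsPolyFun.coord
  have hcross : ∀ i, IsPolyFun fun v : Fin 2 → Fin 3 → ℂ => crossProduct (v 1) (v 0) i :=
    IsPolyFun.cross (hc 1) (hc 0)
  have hcross' : ∀ i, IsPolyFun fun v : Fin 2 → Fin 3 → ℂ => crossProduct (v 0) (v 1) i :=
    IsPolyFun.cross (hc 0) (hc 1)
  have hcoord : IsPolyFun fun v : Fin 2 → Fin 3 → ℂ =>
      ∏ k, ∏ i, (v k i * (v k i - v k (i + 1))) :=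
    IsPolyFun.prod _ fun k _ => IsPolyFun.prod _ fun i _ => (hc k i).mul ((hc k i).sub (hc k _))
  have hsix : IsPolyFun fun v : Fin 2 → Fin 3 → ℂ => sixthPoint (v 0) (v 1) 0 :=
    IsPolyFun.cross hcross (fun i => (hc 1 i).mul (hcross i)) 0
  have hsix' : IsPolyFun fun v : Fin 2 → Fin 3 → ℂ => sixthPoint (v 1) (v 0) 0 :=
    IsPolyFun.cross hcross' (fun i => (hc 0 i).mul (hcross' i)) 0
  -- The composite only has to be nonzero somewhere, so one fixed test point turns this into a
  -- polynomial condition on the fifth points.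
  have hcomp : IsPolyFun fun v : Fin 2 → Fin 3 → ℂ =>
      quintics (v 1) (v 0) (quintics (v 0) (v 1) ![-1, -1, 0]) 0 :=
    isPolyFun_quintics (ξ := fun v => v 1) (η := fun v => v 0)
      (a := fun v => quintics (v 0) (v 1) ![-1, -1, 0]) (hc 1) (hc 0)
      (isPolyFun_quintics (ξ := fun v => v 0) (η := fun v => v 1) (a := fun _ => ![-1, -1, 0])
        (hc 0) (hc 1) fun i => IsPolyFun.const _) 0
  have hR : IsPolyFun fun v : Fin 2 → Fin 3 → ℂ => quintics (v 0) (v 1) ![-1, -2, -2] 0 :=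
    isPolyFun_quintics (ξ := fun v => v 0) (η := fun v => v 1) (a := fun _ => ![-1, -2, -2])
      (hc 0) (hc 1) (fun i => IsPolyFun.const _) 0
  have hfam : IsPolyFamily fun v : Fin 2 → Fin 3 → ℂ =>
      quinticSection (v 0) (v 1) ![2, 1, 0] ![-1, -2, -2] :=
    IsPolyFamily.quintics (fun i => IsPolyFamily.C (hc 0 i)) (fun i => IsPolyFamily.C (hc 1 i))
      (fun i => (IsPolyFamily.C (IsPolyFun.const _)).add
        ((IsPolyFamily.C (IsPolyFun.const _)).mul IsPolyFamily.X)) 0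
  obtain ⟨d, hd, hd'⟩ : ∃ d : (Fin 2 → Fin 3 → ℂ) → ℂ, IsPolyFun d ∧ ∀ v,
      (quinticSection (v 0) (v 1) ![2, 1, 0] ![-1, -2, -2]).natDegree ≤ 5 →
        (d v ≠ 0 ↔ (quinticSection (v 0) (v 1) ![2, 1, 0] ![-1, -2, -2]).natDegree = 5 ∧
          (quinticSection (v 0) (v 1) ![2, 1, 0] ![-1, -2, -2]).Separable) :=
    ⟨_, hfam.isPolyFun_coeff_mul_resultant 5, fun v =>
      coeff_mul_resultant_ne_zero_iff (by norm_num)⟩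
  obtain ⟨g, hg, hg'⟩ : ∃ g : (Fin 2 → Fin 3 → ℂ) → ℂ, IsPolyFun g ∧ ∀ v, g v ≠ 0 ↔
      (∀ k i, v k i ≠ 0 ∧ v k i - v k (i + 1) ≠ 0) ∧ sixthPoint (v 0) (v 1) 0 ≠ 0 ∧
      sixthPoint (v 1) (v 0) 0 ≠ 0 ∧
      quintics (v 1) (v 0) (quintics (v 0) (v 1) ![-1, -1, 0]) 0 ≠ 0 ∧
      quintics (v 0) (v 1) ![-1, -2, -2] 0 ≠ 0 ∧ d v ≠ 0 := by
    refine ⟨_, hcoord.mul (hsix.mul (hsix'.mul (hcomp.mul (hR.mul hd)))), fun v => ?_⟩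
    simp only [mul_ne_zero_iff, Finset.prod_ne_zero_iff, Finset.mem_univ, true_imp_iff]
  refine ⟨g, hg, ⟨![![1, -1, 3], ![1, -3, -1]], ?_⟩, fun v hv => ?_⟩
  · have h := isTransversalLine_example
    have hdv := hd' ![![1, -1, 3], ![1, -3, -1]]
    simp only [Matrix.cons_val_zero, Matrix.cons_val_one] at hdv
    rw [hg', hdv h.natDegree_eq.le]
    refine ⟨?_, ?_, ?_, ?_, h.quintics_ne_zero, h.natDegree_eq, h.separable⟩
    · have key : ∀ a b c : ℂ, a ≠ 0 → b ≠ 0 → c ≠ 0 → a ≠ b → b ≠ c → c ≠ a →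
          ∀ i, ![a, b, c] i ≠ 0 ∧ ![a, b, c] i - ![a, b, c] (i + 1) ≠ 0 := by
        intro a b c ha hb hc hab hbc hca i
        fin_cases i
        · exact ⟨ha, sub_ne_zero.2 hab⟩
        · exact ⟨hb, sub_ne_zero.2 hbc⟩
        · exact ⟨hc, sub_ne_zero.2 hca⟩
      rw [Fin.forall_fin_two]
      constructor <;> apply key <;> norm_num
    · simp [sixthPoint, cross_apply]
      norm_num
    · simp [sixthPoint, cross_apply]
      norm_num
    · simp [quintics, quadrics]
      norm_num
  · obtain ⟨h7, h2, h3, h4, h5, h6⟩ := (hg' v).1 hv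
    have hinj : ∀ k, Function.Injective (v k) := by
      intro k i j hij
      have e0 := (h7 k 0).2
      have e1 := (h7 k 1).2
      have e2 := (h7 k 2).2
      rw [sub_ne_zero] at e0 e1 e2
      fin_cases i <;> fin_cases j <;> first | rfl | exact absurd hij ‹_› | exact absurd hij.symm ‹_›
    have hgp : GeneralPosition (v 0) (v 1) := ⟨fun i => (h7 0 i).1, fun i => (h7 1 i).1, hinj 0,
      hinj 1, fun h => h2 (by rw [h]; rfl)⟩
    obtain ⟨h8, h9⟩ := (hd' v (natDegree_quinticSection_le hgp _ _)).1 h6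
    exact ⟨hgp, ⟨fun i => (h7 1 i).1, fun i => (h7 0 i).1, hinj 1, hinj 0,
      fun h => h3 (by rw [h]; rfl)⟩, ⟨![-1, -1, 0], fun h => h4 (by rw [h]; rfl)⟩,
      ![2, 1, 0], ![-1, -2, -2], isTransversalLine_example.cross_ne_zero, h5, h8, h9⟩

end Genericity

/-! ### Assembly of the main theorem -/

theorem mainTheorem9 :
    Generically fun D : MultiP2 (Fin 5 ⊕ Fin 5) =>
      let x : Fin 5 → P2 := fun i => D (Sum.inl i)
      let y : Fin 5 → P2 := fun i => D (Sum.inr i)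
      let E : Set (MultiP2 (Fin 2)) := cameraCentersVariety x y
      -- `E` is a surface
      (IsClosed E ∧ IsIrreducible E ∧ topologicalKrullDim E = 2) ∧
      -- both projections are surjective
      (∀ a : P2, ∃ e ∈ E, e 0 = a) ∧
      (∀ b : P2, ∃ e ∈ E, e 1 = b) ∧
      -- both projections have rational inverses `σ` and `τ`, and the composite `σ 1` of `σ` with
      -- the second projection is a Cremona transformation of degree 5, given by explicit forms
      (∃ σ τ : Fin 2 → PlaneRationalMap,
        IsRationalInverse E 0 σ ∧ IsRationalInverse E 1 τ ∧
        (σ 1).IsCremona ∧ (σ 1).degree = 5 ∧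
        ∀ (G H : Matrix (Fin 3) (Fin 3) ℂ) (ξ η : Fin 3 → ℂ),
          StandardPosition x G ξ → StandardPosition y H η →
          ∃ c : ℂ, c ≠ 0 ∧ ∀ v : Fin 3 → ℂ,
            (σ 1).evalVec (G.mulVec v) = c • H.mulVec (quinticMap ξ η v)) ∧
      -- the multidegrees
      HasMultidegree E 2 0 1 ∧ HasMultidegree E 0 2 1 ∧ HasMultidegree E 1 1 5 := by
  obtain ⟨g, hg, ⟨v₀, hv₀⟩, hgen⟩ := exists_isPolyFun_generalPosition
  let X : (Fin 5 ⊕ Fin 5 → Fin 3 → ℂ) → Fin 5 → Fin 3 → ℂ := fun v i => v (Sum.inl i)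
  let Y : (Fin 5 ⊕ Fin 5 → Fin 3 → ℂ) → Fin 5 → Fin 3 → ℂ := fun v i => v (Sum.inr i)
  have hX : ∀ k i, IsPolyFun fun v => X v k i := fun k i => IsPolyFun.coord _ i
  have hY : ∀ k i, IsPolyFun fun v => Y v k i := fun k i => IsPolyFun.coord _ i
  let Φ : (Fin 5 ⊕ Fin 5 → Fin 3 → ℂ) → Fin 2 → Fin 3 → ℂ := fun v =>
    ![fifthPoint (X v), fifthPoint (Y v)]
  have hΦ : ∀ k i, IsPolyFun fun v => Φ v k i := by
    intro k i
    fin_cases k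
    · exact isPolyFun_fifthPoint hX i
    · exact isPolyFun_fifthPoint hY i
  have hframe : ∀ {Z : (Fin 5 ⊕ Fin 5 → Fin 3 → ℂ) → Fin 5 → Fin 3 → ℂ},
      (∀ k i, IsPolyFun fun v => Z v k i) →
      IsPolyFun fun v => (∏ i, frameScale (Z v) i) * frameDet (Z v) := fun hZ =>
    (IsPolyFun.prod _ fun i _ => isPolyFun_frameScale hZ i).mul (isPolyFun_triple hZ 0 1 2)
  -- The witness has standard frames in both planes: there all scales and determinants are 1, and
  -- the normalized fifth points are those of `v₀`.
  refine (((hframe hX).mul (hframe hY)).mul (hg.comp hΦ)).generically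
    ⟨Sum.elim (framePoints (v₀ 0)) (framePoints (v₀ 1)), ?_⟩ ?_
  · have hX₀ : X (Sum.elim (framePoints (v₀ 0)) (framePoints (v₀ 1))) = framePoints (v₀ 0) := rfl
    have hY₀ : Y (Sum.elim (framePoints (v₀ 0)) (framePoints (v₀ 1))) = framePoints (v₀ 1) := rfl
    have hΦ₀ : Φ (Sum.elim (framePoints (v₀ 0)) (framePoints (v₀ 1))) = v₀ := by
      funext k
      fin_cases k
      · exact fifthPoint_framePoints _
      · exact fifthPoint_framePoints _
    simp only [hX₀, hY₀, hΦ₀, frameScale_framePoints, frameDet_framePoints, Finset.prod_const_one,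
      one_mul]
    exact hv₀
  · intro D v hD hv
    obtain ⟨hv, hgv⟩ := mul_ne_zero_iff.1 hv
    obtain ⟨hdX, hdY⟩ := mul_ne_zero_iff.1 hv
    obtain ⟨h, h', hcomp, P, R, hPR⟩ := hgen _ hgv
    have hG : IsUnit (frameMatrix (X v)).det := by
      rw [det_frameMatrix]
      exact hdX.isUnit
    have hH : IsUnit (frameMatrix (Y v)).det := by
      rw [det_frameMatrix]
      exact hdY.isUnit
    have hx := represents_frameMatrix_mulVec (fun i => hD (Sum.inl i))
      (fun i => Finset.prod_ne_zero_iff.1 (left_ne_zero_of_mul hdX) i (Finset.mem_univ _))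
      (right_ne_zero_of_mul hdX)
    have hy := represents_frameMatrix_mulVec (fun i => hD (Sum.inr i))
      (fun i => Finset.prod_ne_zero_iff.1 (left_ne_zero_of_mul hdY) i (Finset.mem_univ _))
      (right_ne_zero_of_mul hdY)
    have hE := h.isBirationalCorrespondence h' hcomp hG hH hx hy
    refine ⟨⟨hE.isClosed, hE.isIrreducible, hE.topologicalKrullDim_eq⟩,
      exists_mem_fst_eq _ _ le_rfl, exists_mem_snd_eq _ _ le_rfl,
      ⟨_, _, hE.isRationalInverse 0, hE.isRationalInverse 1, hE.isCremona, rfl, ?_⟩,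
      hE.hasMultidegree_two_zero, hE.hasMultidegree_zero_two,
      hE.hasMultidegree_of_isTransversalLine h hG hH rfl hPR⟩
    intro G H ξ η hGξ hHη
    obtain ⟨s, t, hs, ht, hG', rfl⟩ := hGξ.exists_smul hG hx
    obtain ⟨s', t', hs', ht', hH', rfl⟩ := hHη.exists_smul hH hy
    -- The quintics have degree 5 in a and degree 2 in each of ξ and η; `s`, `s'` rescale the
    -- coordinate matrices and `t`, `t'` the fifth points.
    refine ⟨s ^ 5 / (s' * (t ^ 2 * t' ^ 2)), by positivity, fun w => ?_⟩
    change (quinticPlaneMap h hG hH).evalVec _ = _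
    have h1 := quintics_smul 1 1 s (fifthPoint (X v)) (fifthPoint (Y v)) w
    have h2 := quintics_smul t t' 1 (fifthPoint (X v)) (fifthPoint (Y v)) w
    simp only [one_smul, one_pow, one_mul, mul_one] at h1 h2
    rw [quinticPlaneMap_evalVec, hG', Matrix.mulVec_smul, inv_mulVec_mulVec hG, hH',
      quinticMap_eq_quintics]
    change Matrix.mulVec _ (quintics (fifthPoint (X v)) (fifthPoint (Y v)) _) = _
    rw [h1, h2, Matrix.mulVec_smul, Matrix.mulVec_smul, smul_smul, smul_smul]
    congr 1
    field_simp
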